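/- **Setting.** Let $(K,d)$ be a complete metric space. A countable Markov system $\mathcal{M}=(K_{i(e)},w_e,p_e)_{e\in E}$ on $K$ consists of an at most countable set $E$, a set $N\subset\mathbb{N}$ with $1\in N$, a partition $(K_j)_{j\in N}$ of $K$ into non-empty Borel sets, a surjective map $i:E\to N$, a map $t:E\to N$, Borel maps $w_e:K_{i(e)}\to K_{t(e)}$ and Borel functions $p_e:K_{i(e)}\to[0,1]$, none of the $p_e$ identically zero, with $\sum_{e:\,i(e)=j}p_e(y)=1$ for all $y\in K_j$, $j\in N$. Extend $p_e$ to $K$ by zero and $w_e$ by arbitrary values so that it stays Borel. Put $Uf=\sum_{e\in E}p_e\, f\circ w_e$ for Borel $f\ge 0$, let $U^*\nu$ be the measure with $\int f\,d(U^*\nu)=\int Uf\,d\nu$, and let $P(\mathcal{M})$ be the set of Borel probability measures $\mu$ on $K$ with $U^*\mu=\mu$. $\mathcal{M}$ is *contractive* if there is $0<a<1$ with $\sum_{e:\,i(e)=j}p_e(x)\,d(w_ex,w_ey)\le a\,d(x,y)$ for all $x,y\in K_j$, $j\in N$; *uniformly continuous* if all $w_e|_{K_{i(e)}}$ and $p_e|_{K_{i(e)}}$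 are uniformly continuous; it *has a dominating Markov chain* if $\sum_{e:\,i(e)=j}\sup_{x\in K_j}p_e(x)<\infty$ for every $j\in N$. Fix points $x_j\in K_j$, $j\in N$, and put $b=\sup_{j\in N}\sup_{x\in K_j}\sum_{e:\,i(e)=j}p_e(x)\,d\big(w_e(x_{i(e)}),x_{t(e)}\big)$. Let $\bar E=E\cup\{\infty\}$ be the one-point compactification of the discrete space $E$, $\bar\Sigma=\bar E^{\mathbb{Z}}$ with its Borel $\sigma$-algebra, $S$ the left shift, $\mathcal{F}$ the $\sigma$-algebra generated by the coordinates $\sigma_m$, $m\le 0$, and ${}_1[e]=\{\sigma:\sigma_1=e\}$. Put $i(\infty)=t(\infty)=1$. Let $\Sigma_G$ be the set of $\sigma\in E^{\mathbb{Z}}$ with $i(\sigma_{n+1})=t(\sigma_n)$ for all $n$, let $T_j=\{\sigma\in\Sigma_G: t(\sigma_0)=j\}$, let $D$ be the set of $\sigma\in\Sigma_G$ for which $\lim_{m\to-\infty}w_{\sigma_0}\circ\dots\circ w_{\sigma_m}(x_{i(\sigma_m)})$ exists, and let $F(\sigma)$ be this limit for $\sigma\in D$ and $F(\sigma)=x_{t(\sigma_0)}$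 otherwise. For uniformly continuous $\mathcal{M}$ let $\bar p_e$ be the continuous extension of $p_e|_{K_{i(e)}}$ to the closure $\overline{K_{i(e)}}$, extended further to $K$ by zero. An *asymptotic state* is an $S$-invariant Borel probability measure $\Lambda$ on $\bar\Sigma$ with $\Lambda(D)=1$ and $E_\Lambda(1_{{}_1[e]}\mid\mathcal{F})=1_{T_{i(e)}}\cdot\bar p_e\circ F$ $\Lambda$-a.e. for all $e\in E$. A uniformly continuous $\mathcal{M}$ is *non-degenerate* if for every asymptotic state $\Lambda$ there is $j\in N$ with $\Lambda(T_j\cap F^{-1}(K_j))>0$, and *consistent* if $\Lambda\circ F^{-1}\in P(\mathcal{M})$ for every asymptotic state $\Lambda$. *Condition (T)*: there is $x_0\in K$ such that, with $\alpha_n(\{j\})=\frac1n\sum_{k=1}^n (U^*)^k\delta_{x_0}(K_j)$, for every $\epsilon>0$ there is a finite $V\subset N$ with $\alpha_n(N\setminus V)<\epsilon$ for all $n\ge 1$. **Corollary.** Suppose $\mathcal{M}$ is contractive and uniformly continuous, and $b<\infty$. Then: (i) If $\mathcal{M}$ is non-degenerate and has a dominating Markov chain, then $P(\mathcal{M})\neq\emptyset$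 if and only if Condition (T) holds. (ii) If $\mathcal{M}$ is consistent, has a dominating Markov chain and satisfies Condition (T), then $P(\mathcal{M})\ne\emptyset$. (iii) Every $\mu\in P(\mathcal{M})$ is tight. (iv) If the sets $\{e\in E: i(e)=j\}$ and $\{e\in E: t(e)=j\}$ are finite for all $j\in N$, then for every finite $c\subset N$ and every $\epsilon>0$ there is a compact $C\subset K$ such that $\mu(C)>\mu\big(\bigcup_{j\in c}K_j\big)-\epsilon$ for all $\mu\in P(\mathcal{M})$. (v) If $E$ is finite, then $P(\mathcal{M})$ is uniformly tight. -/

import Mathlib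

open MeasureTheory Filter Topology Set
open scoped ENNReal NNReal

noncomputable section

/-- A countable Markov system on `X` with edge set `E` (at most countable wherever it is used).
The vertices are the elements of `N ⊆ ℕ`; the maps `w e` and the probability functions `p e` are
given together with their extensions from the vertex set of the initial vertex of `e` to `X`:
`p e` is extended by zero, `w e` by arbitrary (measurable) values. -/
structure MarkovSystem (X E : Type*) [MetricSpace X] [MeasurableSpace X] where
  /-- The index set of the vertex sets. -/
  N : Set ℕ
  one_mem : 1 ∈ N
  /-- The vertex sets, a partition of `X` into non-empty Borel sets. -/
  vertex : N → Set X
  measurableSet_vertex : ∀ j, MeasurableSet (vertex j)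
  nonempty_vertex : ∀ j, (vertex j).Nonempty
  disjoint_vertex : Pairwise fun j k => Disjoint (vertex j) (vertex k)
  iUnion_vertex : ⋃ j, vertex j = univ
  /-- The initial vertex of an edge. -/
  i : E → N
  i_surjective : Function.Surjective i
  /-- The terminal vertex of an edge. -/
  t : E → N
  /-- The maps. -/
  w : E → X → X
  measurable_w : ∀ e, Measurable (w e)
  mapsTo_w : ∀ e, MapsTo (w e) (vertex (i e)) (vertex (t e))
  /-- The probability functions. -/
  p : E → X → ℝ≥0
  measurable_p : ∀ e, Measurable (p e)
  p_eq_zero : ∀ e, ∀ x ∉ vertex (i e), p e x = 0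
  exists_p_pos : ∀ e, ∃ x ∈ vertex (i e), 0 < p e x
  sum_p : ∀ j, ∀ x ∈ vertex j, ∑' e : {e : E // i e = j}, (p e x : ℝ≥0∞) = 1

/-- The one-point compactification of `E` with the discrete topology. -/
def Alphabet (E : Type*) : Type _ := OnePoint E

namespace Alphabet

instance (E : Type*) : TopologicalSpace (Alphabet E) :=
  letI : TopologicalSpace E := ⊥
  inferInstanceAs (TopologicalSpace (OnePoint E))

/-- Every subset is measurable; this is the Borel `σ`-algebra if `E` is countable. -/
instance (E : Type*) : MeasurableSpace (Alphabet E) := ⊤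

instance (E : Type*) : DiscreteMeasurableSpace (Alphabet E) := ⟨fun _ => trivial⟩

instance (E : Type*) [Countable E] : Countable (Alphabet E) :=
  inferInstanceAs (Countable (Option E))

instance (E : Type*) : T1Space (Alphabet E) :=
  let _ : TopologicalSpace E := ⊥
  have : DiscreteTopology E := ⟨rfl⟩
  inferInstanceAs (T1Space (OnePoint E))

instance (E : Type*) [Countable E] : BorelSpace (Alphabet E) := by
  refine ⟨le_antisymm (fun s _ => ?_) le_top⟩
  let _ : MeasurableSpace (Alphabet E) := borel _
  have : BorelSpace (Alphabet E) := ⟨rfl⟩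
  exact s.to_countable.measurableSet

/-- The letter of an edge. -/
def letter {E : Type*} (e : E) : Alphabet E := OnePoint.some e

/-- Definition of a function on the extended alphabet by its value at `∞` and its values
on `E`. -/
def extend {E Y : Type*} (y : Y) (f : E → Y) (a : Alphabet E) : Y := OnePoint.elim a y f

end Alphabet

/-- The code space: bi-infinite sequences over the extended alphabet, with the product topology
and the product `σ`-algebra. -/
abbrev CodeSpace (E : Type*) : Type _ := ℤ → Alphabet E

namespace CodeSpace

variable {E : Type*}

/-- The left shift. -/
def shift (σ : CodeSpace E) : CodeSpace E := fun n => σ (n + 1)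

/-- The cylinder set fixing the coordinates from `m` to `n`. -/
def cylinder (m n : ℤ) (e : ℤ → Alphabet E) : Set (CodeSpace E) :=
  {σ | ∀ k, m ≤ k → k ≤ n → σ k = e k}

/-- The `σ`-algebra of the past, generated by all cylinder sets on coordinates `m, …, 0`
with `m ≤ 0`. -/
@[reducible] def past (E : Type*) : MeasurableSpace (CodeSpace E) :=
  MeasurableSpace.generateFrom {A | ∃ m ≤ (0 : ℤ), ∃ e : ℤ → Alphabet E, A = cylinder m 0 e}

lemma past_le : past E ≤ MeasurableSpace.pi := by
  refine MeasurableSpace.generateFrom_le ?_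
  rintro _ ⟨m, -, e, rfl⟩
  have : cylinder m 0 e =
      ⋂ k ∈ Icc m 0, (fun σ : CodeSpace E => σ k) ⁻¹' {e k} := by
    ext σ
    simp [cylinder]
  rw [this]
  exact MeasurableSet.biInter (to_countable _) fun k _ =>
    measurable_pi_apply k (MeasurableSet.of_discrete)

/-- The set of sequences whose coordinate `1` is the edge `e`. -/
def next (e : E) : Set (CodeSpace E) := {σ | σ 1 = Alphabet.letter e}

/-- The shift-invariant probability measures on the code space. -/
def invariantMeasures (E : Type*) : Set (Measure (CodeSpace E)) :=
  {Λ | IsProbabilityMeasure Λ ∧ Λ.map shift = Λ}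

end CodeSpace

namespace MarkovSystem

variable {X E : Type*} [MetricSpace X] [MeasurableSpace X] (M : MarkovSystem X E)

/-- There is `0 < a < 1` such that the system contracts distances on average at rate `a`
within each vertex set. -/
def IsContractive : Prop :=
  ∃ a : ℝ, 0 < a ∧ a < 1 ∧ ∀ j, ∀ x ∈ M.vertex j, ∀ y ∈ M.vertex j,
    ∑' e : {e : E // M.i e = j}, (M.p e x : ℝ≥0∞) * edist (M.w e x) (M.w e y)
      ≤ ENNReal.ofReal a * edist x y

/-- All maps and all probability functions are uniformly continuous on their vertex sets. -/
def IsUniformlyContinuous : Prop :=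
  ∀ e, UniformContinuousOn (M.w e) (M.vertex (M.i e)) ∧
    UniformContinuousOn (M.p e) (M.vertex (M.i e))

/-- The system has a dominating Markov chain. -/
def HasDominatingMarkovChain : Prop :=
  ∀ j, (∑' e : {e : E // M.i e = j}, ⨆ x ∈ M.vertex j, (M.p e x : ℝ≥0∞)) < ∞

/-- The constant `b`, for the choice `x₀` of a point in every vertex set. -/
def b (x₀ : M.N → X) : ℝ≥0∞ :=
  ⨆ j, ⨆ x ∈ M.vertex j, ∑' e : {e : E // M.i e = j},
    (M.p e x : ℝ≥0∞) * edist (M.w e (x₀ (M.i e))) (x₀ (M.t e))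

/-! ### Invariant measures -/

/-- The Markov operator. -/
def U (f : X → ℝ≥0∞) (x : X) : ℝ≥0∞ := ∑' e, (M.p e x : ℝ≥0∞) * f (M.w e x)

/-- The adjoint of the Markov operator, acting on measures. -/
def adjoint (ν : Measure X) : Measure X :=
  Measure.sum fun e => (ν.withDensity fun x => (M.p e x : ℝ≥0∞)).map (M.w e)

lemma lintegral_adjoint [Countable E] (ν : Measure X) {f : X → ℝ≥0∞} (hf : Measurable f) :
    ∫⁻ x, f x ∂M.adjoint ν = ∫⁻ x, M.U f x ∂ν := by
  have h1 : ∀ e, Measurable fun x => (M.p e x : ℝ≥0∞) := fun e =>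
    (M.measurable_p e).coe_nnreal_ennreal
  have h2 : ∀ e, Measurable fun x => f (M.w e x) := fun e => hf.comp (M.measurable_w e)
  have h3 : ∫⁻ x, M.U f x ∂ν = ∑' e, ∫⁻ x, (M.p e x : ℝ≥0∞) * f (M.w e x) ∂ν :=
    lintegral_tsum fun e => ((h1 e).mul (h2 e)).aemeasurable
  rw [h3, adjoint, lintegral_sum_measure]
  refine tsum_congr fun e => ?_
  rw [lintegral_map hf (M.measurable_w e),
    lintegral_withDensity_eq_lintegral_mul _ (h1 e) (h2 e)]
  rfl

/-- The invariant Borel probability measures of the system. -/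
def invariantMeasures : Set (Measure X) := {μ | IsProbabilityMeasure μ ∧ M.adjoint μ = μ}

/-- The averaged distribution on the vertices of the process started at `x`. -/
def averagedVertexMeasure (x : X) (n : ℕ) : Measure M.N :=
  Measure.sum fun j =>
    ((n : ℝ≥0∞)⁻¹ * ∑ k ∈ Finset.Icc 1 n, (M.adjoint^[k] (Measure.dirac x)) (M.vertex j)) •
      Measure.dirac j

/-- For some starting point, the averaged vertex distributions are uniformly tight. -/
def IsRecurrent : Prop :=
  ∃ x : X, ∀ ε > (0 : ℝ≥0∞), ∃ V : Finset M.N, ∀ n ≥ 1,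
    M.averagedVertexMeasure x n ((V : Set M.N)ᶜ) < ε

/-! ### The coding map -/

/-- The vertex `1`. -/
def vertexOne : M.N := ⟨1, M.one_mem⟩

/-- The initial vertex of a letter, with `1` for the letter `∞`. -/
def i' : Alphabet E → M.N := Alphabet.extend M.vertexOne M.i

/-- The terminal vertex of a letter, with `1` for the letter `∞`. -/
def t' : Alphabet E → M.N := Alphabet.extend M.vertexOne M.t

/-- The map of a letter, with the identity for the letter `∞`. -/
def w' : Alphabet E → X → X := Alphabet.extend id M.w

/-- The path space. -/
def pathSpace : Set (CodeSpace E) :=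
  {σ | ∀ n, (∃ e, σ n = Alphabet.letter e) ∧ M.i' (σ (n + 1)) = M.t' (σ n)}

/-- The composition `w_{σ_0} ∘ w_{σ_{-1}} ∘ ⋯ ∘ w_{σ_{-n}}`. -/
def backward (σ : CodeSpace E) : ℕ → X → X
  | 0 => M.w' (σ 0)
  | n + 1 => backward σ n ∘ M.w' (σ (-((n : ℤ) + 1)))

/-- `w_{σ_0} ∘ ⋯ ∘ w_{σ_{-n}}` at the chosen point of the initial vertex set of `σ_{-n}`. -/
def approx (x₀ : M.N → X) (n : ℕ) (σ : CodeSpace E) : X :=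
  M.backward σ n (x₀ (M.i' (σ (-(n : ℤ)))))

/-- The paths along which the backward compositions converge. -/
def convergenceSet (x₀ : M.N → X) : Set (CodeSpace E) :=
  {σ | σ ∈ M.pathSpace ∧ ∃ y, Tendsto (fun n => M.approx x₀ n σ) atTop (𝓝 y)}

open Classical in
/-- The coding map. -/
def codingMap (x₀ : M.N → X) (σ : CodeSpace E) : X :=
  if h : σ ∈ M.convergenceSet x₀ then h.2.choose else x₀ (M.t' (σ 0))

lemma stronglyMeasurable_approx [Countable E] [BorelSpace X] (x₀ : M.N → X) (n : ℕ) :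
    StronglyMeasurable (M.approx x₀ n) := by
  have hw : ∀ (k : ℤ) (f : CodeSpace E → X), Measurable f ∧ (range f).Countable →
      Measurable (fun σ => M.w' (σ k) (f σ)) ∧ (range fun σ => M.w' (σ k) (f σ)).Countable := by
    intro k f hf
    refine ⟨?_, ?_⟩
    · have h1 : Measurable fun q : Alphabet E × X => M.w' q.1 q.2 := by
        refine measurable_from_prod_countable_right fun a => ?_
        rcases a with _ | e
        · exact measurable_id
        · exact M.measurable_w e
      exact h1.comp ((measurable_pi_apply k).prodMk hf.1)
    · refine (countable_iUnion fun a : Alphabet E => hf.2.image (M.w' a)).mono ?_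
      rintro _ ⟨σ, rfl⟩
      exact mem_iUnion.2 ⟨σ k, f σ, mem_range_self σ, rfl⟩
  have hb : ∀ (n : ℕ) (f : CodeSpace E → X), Measurable f ∧ (range f).Countable →
      Measurable (fun σ => M.backward σ n (f σ)) ∧
        (range fun σ => M.backward σ n (f σ)).Countable := by
    intro n
    induction n with
    | zero => exact fun f hf => hw 0 f hf
    | succ n ih => exact fun f hf => ih _ (hw _ f hf)
  have h := hb n (fun σ => x₀ (M.i' (σ (-(n : ℤ)))))
    ⟨(Measurable.of_discrete (f := fun a => x₀ (M.i' a))).comp (measurable_pi_apply _),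
      (countable_range x₀).mono (by rintro _ ⟨σ, rfl⟩; exact mem_range_self _)⟩
  exact stronglyMeasurable_iff_measurable_separable.2 ⟨h.1, h.2.isSeparable⟩

lemma measurableSet_pathSpace [Countable E] : MeasurableSet M.pathSpace := by
  have : M.pathSpace = ⋂ n : ℤ, (fun σ : CodeSpace E => σ n) ⁻¹' (range Alphabet.letter) ∩
      (fun σ : CodeSpace E => (σ (n + 1), σ n)) ⁻¹' {q | M.i' q.1 = M.t' q.2} := by
    ext σ
    simp [pathSpace, eq_comm]
  rw [this]
  exact MeasurableSet.iInter fun n =>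
    (measurable_pi_apply n MeasurableSet.of_discrete).inter
      (((measurable_pi_apply (n + 1)).prodMk (measurable_pi_apply n)) (MeasurableSet.of_discrete))

lemma measurableSet_convergenceSet [Countable E] [CompleteSpace X] [BorelSpace X]
    (x₀ : M.N → X) : MeasurableSet (M.convergenceSet x₀) :=
  M.measurableSet_pathSpace.inter
    (StronglyMeasurable.measurableSet_exists_tendsto (M.stronglyMeasurable_approx x₀))

lemma measurable_codingMap [Countable E] [CompleteSpace X] [BorelSpace X] (x₀ : M.N → X) :
    Measurable (M.codingMap x₀) := by
  classical
  have hD := M.measurableSet_convergenceSet x₀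
  have h0 : Measurable fun σ : CodeSpace E => x₀ (M.t' (σ 0)) :=
    (Measurable.of_discrete (f := fun a => x₀ (M.t' a))).comp (measurable_pi_apply 0)
  refine measurable_of_tendsto_metrizable (f := fun n σ =>
    if σ ∈ M.convergenceSet x₀ then M.approx x₀ n σ else x₀ (M.t' (σ 0)))
    (fun n => Measurable.ite hD (M.stronglyMeasurable_approx x₀ n).measurable h0) ?_
  refine tendsto_pi_nhds.2 fun σ => ?_
  by_cases h : σ ∈ M.convergenceSet x₀
  · simpa [codingMap, h] using h.2.choose_spec
  · simp [codingMap, h]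

/-- The paths whose coordinate `0` ends at the vertex `j`. -/
def endsAt (j : M.N) : Set (CodeSpace E) := {σ | σ ∈ M.pathSpace ∧ M.t' (σ 0) = j}

/-! ### Asymptotic states, non-degeneracy and consistency -/

/-- The continuous extension of `p e` from its vertex set to the closure of the vertex set,
extended further by zero. -/
def pBar (e : E) : X → ℝ≥0 :=
  (closure (M.vertex (M.i e))).indicator (extendFrom (M.vertex (M.i e)) (M.p e))

/-- The asymptotic states of the system. -/
def asymptoticStates (x₀ : M.N → X) : Set (Measure (CodeSpace E)) :=
  {Λ | Λ ∈ CodeSpace.invariantMeasures E ∧ Λ (M.convergenceSet x₀) = 1 ∧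
    ∀ e, Λ[(CodeSpace.next e).indicator (fun _ => (1 : ℝ)) | CodeSpace.past E] =ᵐ[Λ]
      (M.endsAt (M.i e)).indicator fun σ => (M.pBar e (M.codingMap x₀ σ) : ℝ)}

/-- Every asymptotic state charges, for some vertex `j`, the paths which end at `j` and are coded
into the vertex set of `j`. -/
def IsNondegenerate (x₀ : M.N → X) : Prop :=
  ∀ Λ ∈ M.asymptoticStates x₀, ∃ j,
    0 < Λ (M.endsAt j ∩ M.codingMap x₀ ⁻¹' M.vertex j)

/-- The coding map takes every asymptotic state to an invariant measure. -/
def IsConsistent (x₀ : M.N → X) : Prop :=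
  ∀ Λ ∈ M.asymptoticStates x₀, Λ.map (M.codingMap x₀) ∈ M.invariantMeasures

end MarkovSystem

end

/-!
The proof follows the process together with its history. On `X × CodeSpace E` let a point move
along a random edge, which is appended to the history (`MarkovSystem.process`). Contractivity,
applied once per step, shows that the mean distance between the current point and the value
`MarkovSystem.approx` computed from its last `l + 1` edges is at most `a ^ (l + 1) * c`, where `c`
bounds the mean distance of the points from the base points `x₀` (`MarkovSystem.lintegral_gap_le`).
For the process started at a point, or in an invariant measure, `c` is finite because that distance
is a Lyapunov function of the Markov operator, with additive constant `b`
(`MarkovSystem.U_distBase_le`).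

*Tightness.* For an invariant initial measure the point has the same law at all times, and it is
close to a value determined by finitely many edges. These values form a countable set, and finitely
many of them suffice up to a small probability; if vertices have finitely many incoming edges, the
values in finitely many vertex sets are even finite in number, independently of the measure. This
is total boundedness up to a small measure (`MarkovSystem.exists_isCompact_measure_diff_le`).

*Recurrence from an invariant measure.* A maximal inequality for the Markov operator, proved by
Garsia's argument (`MarkovSystem.mul_measure_exists_lt_orbitSum_le`), bounds the measure of the
starting points at which some average of the time spent outside a finite set of vertices is large.
With summable bounds, a set of starting points of positive measure is left on which all averages
are tight (`MarkovSystem.isRecurrent_of_nonempty`).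

*An asymptotic state from recurrence.* The code space is compact and metrizable, so the time
averages of the law of the sequence of edges have a weak limit `Λ`, which is shift invariant
(`MarkovSystem.exists_isOccupationLimit`). By recurrence and the dominating Markov chain, the edges
stay in a finite set up to a small probability, so `Λ` does not charge the letter `∞`; the
geometric bound above passes to `Λ` and makes the backward compositions converge almost everywhere
(`MarkovSystem.IsOccupationLimit.ae_mem_convergenceSet`). Events that fix finitely many edges are
open, so that weak convergence applies to functions of finitely many edges without any continuity
(`MarkovSystem.IsOccupationLimit.tendsto_lintegral`). As the probability functions are uniformly
continuous and bounded, the probability of the next edge at the current point may be replaced by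
its value at the approximation, with an error that vanishes as `l` grows; this identifies the
conditional law of the next edge under `Λ` (`MarkovSystem.IsOccupationLimit.measure_inter_next`).

*An invariant measure from an asymptotic state.* If the system is consistent, the image under the
coding map is invariant by definition. If it is non-degenerate, consider the set of sequences coded
into the vertex set in which their last edge ends. There the coding map intertwines the shift with
the maps `w e`, and the transition law is given by `p e` itself. The shift maps the set into
itself, so it is invariant up to a null set, and the state conditioned on it has an invariant image
(`MarkovSystem.nonempty_of_isNondegenerate`).
-/

noncomputable section

/-! ### The Markov operator and its action on a distance function -/

namespace MarkovSystem

variable {X E : Type*} [MetricSpace X] [MeasurableSpace X] (M : MarkovSystem X E)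

lemma exists_mem_vertex (x : X) : ∃ j, x ∈ M.vertex j := by
  have : x ∈ ⋃ j, M.vertex j := M.iUnion_vertex ▸ mem_univ x
  simpa using this

lemma eq_of_mem_vertex {x : X} {j k : M.N} (hj : x ∈ M.vertex j) (hk : x ∈ M.vertex k) :
    j = k := by
  by_contra h
  exact (M.disjoint_vertex h).le_bot ⟨hj, hk⟩

lemma mem_vertex_of_p_ne_zero {e : E} {x : X} (h : M.p e x ≠ 0) : x ∈ M.vertex (M.i e) := by
  by_contra h'
  exact h (M.p_eq_zero e x h')

/-- At a point of the vertex set of `j`, only the edges starting at `j` contribute. -/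
lemma tsum_p_mul_eq {j : M.N} {x : X} (hx : x ∈ M.vertex j) (f : E → ℝ≥0∞) :
    ∑' e, (M.p e x : ℝ≥0∞) * f e =
      ∑' e : {e : E // M.i e = j}, (M.p e x : ℝ≥0∞) * f e := by
  refine (tsum_subtype_eq_of_support_subset (s := {e | M.i e = j})
    (f := fun e => (M.p e x : ℝ≥0∞) * f e) ?_).symm
  intro e he
  have : M.p e x ≠ 0 := by
    intro h
    simp [h] at he
  exact M.eq_of_mem_vertex (M.mem_vertex_of_p_ne_zero this) hx

lemma tsum_p (x : X) : ∑' e, (M.p e x : ℝ≥0∞) = 1 := by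
  obtain ⟨j, hj⟩ := M.exists_mem_vertex x
  have := M.tsum_p_mul_eq hj fun _ => 1
  simp only [mul_one] at this
  rw [this, M.sum_p j x hj]

lemma p_le_one (e : E) (x : X) : (M.p e x : ℝ≥0∞) ≤ 1 :=
  (ENNReal.le_tsum e).trans (M.tsum_p x).le

lemma countable_vertices [Countable E] : Countable M.N := M.i_surjective.countable

variable {M} in
lemma IsContractive.exists_rate (h : M.IsContractive) :
    ∃ a : ℝ≥0∞, a < 1 ∧ ∀ j, ∀ x ∈ M.vertex j, ∀ y ∈ M.vertex j,
      ∑' e, (M.p e x : ℝ≥0∞) * edist (M.w e x) (M.w e y) ≤ a * edist x y := by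
  obtain ⟨a, -, ha, h⟩ := h
  refine ⟨ENNReal.ofReal a, by simpa using ha, fun j x hx y hy => ?_⟩
  rw [M.tsum_p_mul_eq hx]
  exact h j x hx y hy

lemma measurable_p_ennreal (e : E) : Measurable fun x => (M.p e x : ℝ≥0∞) :=
  (M.measurable_p e).coe_nnreal_ennreal

lemma measurable_U [Countable E] {f : X → ℝ≥0∞} (hf : Measurable f) : Measurable (M.U f) :=
  Measurable.tsum fun e => (M.measurable_p_ennreal e).mul (hf.comp (M.measurable_w e))

lemma U_mono {f g : X → ℝ≥0∞} (h : f ≤ g) : M.U f ≤ M.U g := fun x =>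
  ENNReal.tsum_le_tsum fun e => mul_le_mul_right (h (M.w e x)) _

lemma U_add (f g : X → ℝ≥0∞) : M.U (f + g) = M.U f + M.U g := by
  funext x
  simp only [U, Pi.add_apply, mul_add]
  exact ENNReal.tsum_add

lemma U_const (c : ℝ≥0∞) : M.U (fun _ => c) = fun _ => c := by
  funext x
  simp only [U]
  rw [ENNReal.tsum_mul_right, M.tsum_p, one_mul]

lemma U_const_mul (c : ℝ≥0∞) (f : X → ℝ≥0∞) : M.U (fun x => c * f x) = fun x => c * M.U f x := by
  funext x
  simp only [U]
  rw [← ENNReal.tsum_mul_left]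
  exact tsum_congr fun e => by ring

lemma lintegral_adjoint_iterate [Countable E] (ν : Measure X) (k : ℕ) {f : X → ℝ≥0∞}
    (hf : Measurable f) :
    ∫⁻ x, f x ∂(M.adjoint^[k] ν) = ∫⁻ x, (M.U^[k] f) x ∂ν := by
  induction k generalizing f with
  | zero => rfl
  | succ k ih =>
    rw [Function.iterate_succ_apply', M.lintegral_adjoint _ hf, ih (M.measurable_U hf),
      Function.iterate_succ_apply]

/-- The distance of a point from the chosen point of its vertex set. -/
def distBase (x₀ : M.N → X) (x : X) : ℝ≥0∞ :=
  ∑' j, (M.vertex j).indicator (fun y => edist y (x₀ j)) x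

lemma distBase_eq {x₀ : M.N → X} {j : M.N} {x : X} (hx : x ∈ M.vertex j) :
    M.distBase x₀ x = edist x (x₀ j) := by
  rw [distBase, tsum_eq_single j]
  · simp [hx]
  · intro k hk
    rw [indicator_of_notMem]
    exact fun h => hk (M.eq_of_mem_vertex h hx)

lemma distBase_ne_top {x₀ : M.N → X} (x : X) : M.distBase x₀ x ≠ ∞ := by
  obtain ⟨j, hj⟩ := M.exists_mem_vertex x
  rw [M.distBase_eq hj]
  exact edist_ne_top _ _

lemma measurable_distBase [Countable E] [BorelSpace X] (x₀ : M.N → X) :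
    Measurable (M.distBase x₀) := by
  have := M.countable_vertices
  exact Measurable.tsum fun j =>
    (by fun_prop : Measurable fun y => edist y (x₀ j)).indicator (M.measurableSet_vertex j)

/-- The distance from the base points is a Lyapunov function of the Markov operator. -/
lemma U_distBase_le {x₀ : M.N → X} (hx₀ : ∀ j, x₀ j ∈ M.vertex j) {a : ℝ≥0∞}
    (ha : ∀ j, ∀ x ∈ M.vertex j, ∀ y ∈ M.vertex j,
      ∑' e, (M.p e x : ℝ≥0∞) * edist (M.w e x) (M.w e y) ≤ a * edist x y) (x : X) :
    M.U (M.distBase x₀) x ≤ a * M.distBase x₀ x + M.b x₀ := by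
  obtain ⟨j, hj⟩ := M.exists_mem_vertex x
  have h1 : ∀ e, (M.p e x : ℝ≥0∞) * M.distBase x₀ (M.w e x) ≤
      (M.p e x : ℝ≥0∞) * edist (M.w e x) (M.w e (x₀ j)) +
        (M.p e x : ℝ≥0∞) * edist (M.w e (x₀ (M.i e))) (x₀ (M.t e)) := by
    intro e
    by_cases hp : M.p e x = 0
    · simp [hp]
    · have hxe := M.mem_vertex_of_p_ne_zero hp
      obtain rfl := M.eq_of_mem_vertex hj hxe
      rw [M.distBase_eq (M.mapsTo_w e hxe), ← mul_add]
      exact mul_le_mul_right (edist_triangle _ _ _) _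
  calc M.U (M.distBase x₀) x
      ≤ ∑' e, ((M.p e x : ℝ≥0∞) * edist (M.w e x) (M.w e (x₀ j)) +
        (M.p e x : ℝ≥0∞) * edist (M.w e (x₀ (M.i e))) (x₀ (M.t e))) := ENNReal.tsum_le_tsum h1
    _ ≤ a * edist x (x₀ j) + M.b x₀ := by
      rw [ENNReal.tsum_add]
      refine add_le_add (ha j x hj _ (hx₀ j)) ?_
      rw [M.tsum_p_mul_eq hj]
      exact le_iSup_of_le j (le_iSup₂_of_le x hj le_rfl)
    _ = a * M.distBase x₀ x + M.b x₀ := by rw [M.distBase_eq hj]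

/-- Iterating the Lyapunov inequality; the constant bounds the geometric series `∑ b aⁱ`. -/
lemma U_iterate_distBase_le {x₀ : M.N → X} (hx₀ : ∀ j, x₀ j ∈ M.vertex j) {a : ℝ≥0∞}
    (ha : ∀ j, ∀ x ∈ M.vertex j, ∀ y ∈ M.vertex j,
      ∑' e, (M.p e x : ℝ≥0∞) * edist (M.w e x) (M.w e y) ≤ a * edist x y) (k : ℕ) (x : X) :
    (M.U^[k] (M.distBase x₀)) x ≤ a ^ k * M.distBase x₀ x + (1 - a)⁻¹ * M.b x₀ := by
  have h : ∀ (k : ℕ) (x : X), (M.U^[k] (M.distBase x₀)) x ≤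
      a ^ k * M.distBase x₀ x + (∑ i ∈ Finset.range k, a ^ i) * M.b x₀ := by
    intro k
    induction k with
    | zero => simp
    | succ k ih =>
      intro x
      rw [Function.iterate_succ_apply']
      calc M.U (M.U^[k] (M.distBase x₀)) x
          ≤ M.U ((fun x => a ^ k * M.distBase x₀ x) +
              fun _ => (∑ i ∈ Finset.range k, a ^ i) * M.b x₀) x := M.U_mono (fun y => ih y) x
        _ = a ^ k * M.U (M.distBase x₀) x + (∑ i ∈ Finset.range k, a ^ i) * M.b x₀ := by
            rw [U_add, U_const, U_const_mul]; rfl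
        _ ≤ a ^ k * (a * M.distBase x₀ x + M.b x₀) +
              (∑ i ∈ Finset.range k, a ^ i) * M.b x₀ := by
            gcongr
            exact M.U_distBase_le hx₀ ha x
        _ = _ := by
            rw [Finset.sum_range_succ]
            ring
  refine (h k x).trans ?_
  gcongr
  rw [← ENNReal.tsum_geometric]
  exact ENNReal.sum_le_tsum _

/-- An invariant probability measure integrates the distance from the base points. -/
lemma lintegral_distBase_le [Countable E] [BorelSpace X] {x₀ : M.N → X}
    (hx₀ : ∀ j, x₀ j ∈ M.vertex j) {a : ℝ≥0∞} (ha1 : a < 1)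
    (ha : ∀ j, ∀ x ∈ M.vertex j, ∀ y ∈ M.vertex j,
      ∑' e, (M.p e x : ℝ≥0∞) * edist (M.w e x) (M.w e y) ≤ a * edist x y)
    {μ : Measure X} (hμ : μ ∈ M.invariantMeasures) :
    ∫⁻ x, M.distBase x₀ x ∂μ ≤ (1 - a)⁻¹ * M.b x₀ := by
  obtain ⟨hp, hinv⟩ := hμ
  set C := (1 - a)⁻¹ * M.b x₀
  have hV := M.measurable_distBase x₀
  -- The truncations are integrable, so that invariance may be combined with dominated convergence.
  have htrunc : ∀ m : ℕ, ∫⁻ x, min (M.distBase x₀ x) m ∂μ ≤ C := by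
    intro m
    have hle : ∀ k : ℕ, ∫⁻ x, min (M.distBase x₀ x) m ∂μ ≤
        ∫⁻ x, min (a ^ k * M.distBase x₀ x + C) m ∂μ := by
      intro k
      have h1 : M.adjoint^[k] μ = μ := Function.iterate_fixed hinv k
      have h2 := M.lintegral_adjoint_iterate μ k (hV.min (measurable_const (a := (m : ℝ≥0∞))))
      rw [h1] at h2
      rw [h2]
      refine lintegral_mono fun x => le_min ?_ ?_
      · refine le_trans ?_ (M.U_iterate_distBase_le hx₀ ha k x)
        exact (Monotone.iterate (fun _ _ h => M.U_mono h) k)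
          (fun x => min_le_left _ _ : (fun x => min (M.distBase x₀ x) m) ≤ M.distBase x₀) x
      · have h3 := (Monotone.iterate (fun _ _ h => M.U_mono h) k)
          (fun x => min_le_right _ _ : (fun x => min (M.distBase x₀ x) m) ≤ fun _ => (m : ℝ≥0∞)) x
        rwa [Function.iterate_fixed (M.U_const _)] at h3
    have hlim : Tendsto (fun k : ℕ => ∫⁻ x, min (a ^ k * M.distBase x₀ x + C) m ∂μ) atTop
        (𝓝 (∫⁻ _, min C m ∂μ)) := by
      refine tendsto_lintegral_of_dominated_convergence (fun _ => (m : ℝ≥0∞))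
        (fun k => ((hV.const_mul _).add_const _).min measurable_const)
        (fun k => ae_of_all _ fun x => min_le_right _ _) (by simp) (ae_of_all _ fun x => ?_)
      have h4 : Tendsto (fun k : ℕ => a ^ k * M.distBase x₀ x) atTop (𝓝 0) := by
        simpa using ENNReal.Tendsto.mul_const (ENNReal.tendsto_pow_atTop_nhds_zero_of_lt_one ha1)
          (Or.inr (M.distBase_ne_top x))
      simpa using (h4.add_const C).min tendsto_const_nhds
    refine (ge_of_tendsto' hlim hle).trans ?_
    simp
  have hsup : ∀ x, M.distBase x₀ x = ⨆ m : ℕ, min (M.distBase x₀ x) m := by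
    intro x
    refine le_antisymm ?_ (iSup_le fun m => min_le_left _ _)
    obtain ⟨m, hm⟩ := ENNReal.exists_nat_gt (M.distBase_ne_top (x₀ := x₀) x)
    exact le_iSup_of_le m (le_min le_rfl hm.le)
  rw [lintegral_congr hsup, lintegral_iSup (fun m => hV.min measurable_const)
    (fun m n h x => min_le_min_left _ (by exact_mod_cast h))]
  exact iSup_le htrunc

/-- The expected distance from the base points stays bounded along the process started at a
point. -/
lemma lintegral_distBase_adjoint_dirac_le [Countable E] [BorelSpace X] {x₀ : M.N → X}
    (hx₀ : ∀ j, x₀ j ∈ M.vertex j) {a : ℝ≥0∞} (ha1 : a < 1)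
    (ha : ∀ j, ∀ x ∈ M.vertex j, ∀ y ∈ M.vertex j,
      ∑' e, (M.p e x : ℝ≥0∞) * edist (M.w e x) (M.w e y) ≤ a * edist x y) (x : X) (k : ℕ) :
    ∫⁻ y, M.distBase x₀ y ∂(M.adjoint^[k] (Measure.dirac x)) ≤
      M.distBase x₀ x + (1 - a)⁻¹ * M.b x₀ := by
  rw [M.lintegral_adjoint_iterate _ _ (M.measurable_distBase x₀), lintegral_dirac]
  refine (M.U_iterate_distBase_le hx₀ ha k x).trans ?_
  gcongr
  exact mul_le_of_le_one_left' (pow_le_one₀ zero_le ha1.le)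

end MarkovSystem

/-! ### The process together with its history of edges -/

namespace CodeSpace

variable {E : Type*}

/-- Append an edge to the past of a sequence: the sequence is shifted to the left and its
coordinate `0` is overwritten. -/
def push (e : E) (σ : CodeSpace E) : CodeSpace E := Function.update (shift σ) 0 (Alphabet.letter e)

@[simp] lemma push_zero (e : E) (σ : CodeSpace E) : push e σ 0 = Alphabet.letter e := by
  simp [push]

lemma push_of_ne (e : E) (σ : CodeSpace E) {n : ℤ} (hn : n ≠ 0) : push e σ n = σ (n + 1) := by
  simp [push, hn, shift]

@[simp] lemma push_neg_succ (e : E) (σ : CodeSpace E) (n : ℕ) :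
    push e σ (-((n : ℤ) + 1)) = σ (-(n : ℤ)) := by
  rw [push_of_ne _ _ (by omega)]
  congr 1
  omega

lemma push_neg_cast_succ (e : E) (σ : CodeSpace E) (n : ℕ) :
    push e σ (-((n + 1 : ℕ) : ℤ)) = σ (-(n : ℤ)) := by
  rw [Nat.cast_succ, push_neg_succ]

/-- The sequence with all coordinates equal to `∞`. -/
def emptyHistory (E : Type*) : CodeSpace E := fun _ => (OnePoint.infty : OnePoint E)

lemma measurable_start {X : Type*} [MeasurableSpace X] :
    Measurable fun x : X => (x, emptyHistory E) :=
  measurable_id.prodMk measurable_const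

lemma measurable_shift : Measurable (shift : CodeSpace E → CodeSpace E) :=
  measurable_pi_lambda _ fun n => measurable_pi_apply (n + 1)

lemma measurable_push (e : E) : Measurable (push e : CodeSpace E → CodeSpace E) := by
  refine measurable_pi_lambda _ fun n => ?_
  by_cases hn : n = 0
  · subst hn
    simp
  · simpa only [push_of_ne e _ hn] using measurable_pi_apply (n + 1)

lemma letter_injective : Function.Injective (Alphabet.letter : E → Alphabet E) :=
  OnePoint.coe_injective

end CodeSpace

namespace MarkovSystem

open CodeSpace

variable {X E : Type*} [MetricSpace X] [MeasurableSpace X] (M : MarkovSystem X E)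

@[simp] lemma i'_letter (e : E) : M.i' (Alphabet.letter e) = M.i e := rfl
@[simp] lemma t'_letter (e : E) : M.t' (Alphabet.letter e) = M.t e := rfl
@[simp] lemma w'_letter (e : E) : M.w' (Alphabet.letter e) = M.w e := rfl

lemma backward_push_succ (e : E) (σ : CodeSpace E) (n : ℕ) :
    M.backward (push e σ) (n + 1) = M.w e ∘ M.backward σ n := by
  induction n with
  | zero =>
    have := push_neg_succ e σ 0
    simp only [backward, push_zero, w'_letter]
    rw [this]
    simp
  | succ n ih =>
    rw [backward, ih, backward, push_neg_succ]
    simp only [Nat.cast_add, Nat.cast_one, Function.comp_assoc]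

lemma approx_push_succ (x₀ : M.N → X) (e : E) (σ : CodeSpace E) (n : ℕ) :
    M.approx x₀ (n + 1) (push e σ) = M.w e (M.approx x₀ n σ) := by
  rw [approx, backward_push_succ, approx]
  simp only [Nat.cast_add, Nat.cast_one, push_neg_succ, Function.comp_apply]

lemma approx_push_zero (x₀ : M.N → X) (e : E) (σ : CodeSpace E) :
    M.approx x₀ 0 (push e σ) = M.w e (x₀ (M.i e)) := by
  simp [approx, backward]

/-- The sequences whose coordinates from `-l` to `0` form a path of edges. -/
def window (l : ℕ) : Set (CodeSpace E) :=
  {σ | (∀ k : ℕ, k ≤ l → ∃ e, σ (-(k : ℤ)) = Alphabet.letter e) ∧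
    ∀ k : ℕ, k < l → M.i' (σ (-(k : ℤ))) = M.t' (σ (-((k : ℤ) + 1)))}

lemma push_mem_window_zero (e : E) (σ : CodeSpace E) : push e σ ∈ M.window 0 := by
  refine ⟨fun k hk => ⟨e, ?_⟩, fun k hk => absurd hk (by omega)⟩
  obtain rfl : k = 0 := by omega
  simp

lemma push_mem_window_succ {e : E} {σ : CodeSpace E} {l : ℕ} :
    push e σ ∈ M.window (l + 1) ↔ σ ∈ M.window l ∧ M.i e = M.t' (σ 0) := by
  constructor
  · rintro ⟨h1, h2⟩
    refine ⟨⟨fun k hk => ?_, fun k hk => ?_⟩, ?_⟩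
    · simpa only [push_neg_cast_succ] using h1 (k + 1) (by omega)
    · have := h2 (k + 1) (by omega)
      rw [push_neg_cast_succ, push_neg_succ] at this
      rw [this, Nat.cast_succ]
    · have := h2 0 (by omega)
      have h3 := push_neg_succ e σ 0
      simp only [Nat.cast_zero, neg_zero, push_zero, i'_letter] at this h3
      rw [this, h3]
  · rintro ⟨⟨h1, h2⟩, h3⟩
    refine ⟨fun k hk => ?_, fun k hk => ?_⟩
    · cases k with
      | zero => exact ⟨e, by simp⟩
      | succ k => simpa only [push_neg_cast_succ] using h1 k (by omega)
    · cases k with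
      | zero =>
        have h4 := push_neg_succ e σ 0
        simp only [Nat.cast_zero, neg_zero, push_zero, i'_letter] at h4 ⊢
        rw [h3, h4]
      | succ k =>
        have := h2 k (by omega)
        rw [push_neg_cast_succ, push_neg_succ, this, Nat.cast_succ]

lemma window_mono {l m : ℕ} (h : l ≤ m) : M.window m ⊆ M.window l := fun _ hσ =>
  ⟨fun k hk => hσ.1 k (by omega), fun k hk => hσ.2 k (by omega)⟩

lemma backward_mem_vertex {σ : CodeSpace E} {l : ℕ} (hσ : σ ∈ M.window l) {y : X}
    (hy : y ∈ M.vertex (M.i' (σ (-(l : ℤ))))) : M.backward σ l y ∈ M.vertex (M.t' (σ 0)) := by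
  have key : ∀ k : ℕ, k ≤ l → ∀ z ∈ M.vertex (M.i' (σ (-(k : ℤ)))),
      M.w' (σ (-(k : ℤ))) z ∈ M.vertex (M.t' (σ (-(k : ℤ)))) := by
    intro k hk z hz
    obtain ⟨e, he⟩ := hσ.1 k hk
    rw [he] at hz ⊢
    exact M.mapsTo_w e hz
  induction l generalizing y with
  | zero => simpa [backward] using key 0 le_rfl y hy
  | succ l ih =>
    rw [backward]
    refine ih (M.window_mono (Nat.le_succ l) hσ) ?_ fun k hk => key k (by omega)
    rw [hσ.2 l (by omega)]
    have := key (l + 1) le_rfl y hy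
    rwa [Nat.cast_add, Nat.cast_one] at this

lemma approx_mem_vertex {x₀ : M.N → X} (hx₀ : ∀ j, x₀ j ∈ M.vertex j) {σ : CodeSpace E} {l : ℕ}
    (hσ : σ ∈ M.window l) : M.approx x₀ l σ ∈ M.vertex (M.t' (σ 0)) :=
  M.backward_mem_vertex hσ (hx₀ _)

lemma backward_congr {σ τ : CodeSpace E} {l : ℕ}
    (h : ∀ k : ℕ, k ≤ l → σ (-(k : ℤ)) = τ (-(k : ℤ))) :
    M.backward σ l = M.backward τ l := by
  induction l with
  | zero =>
    have := h 0 le_rfl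
    simp only [Nat.cast_zero, neg_zero] at this
    rw [backward, backward, this]
  | succ l ih =>
    have := h (l + 1) le_rfl
    rw [Nat.cast_add, Nat.cast_one] at this
    rw [backward, backward, ih fun k hk => h k (by omega), this]

lemma approx_congr (x₀ : M.N → X) {σ τ : CodeSpace E} {l : ℕ}
    (h : ∀ k : ℕ, k ≤ l → σ (-(k : ℤ)) = τ (-(k : ℤ))) :
    M.approx x₀ l σ = M.approx x₀ l τ := by
  rw [approx, approx, M.backward_congr h, h l le_rfl]

lemma mem_window_congr {σ τ : CodeSpace E} {l : ℕ}
    (h : ∀ k : ℕ, k ≤ l → σ (-(k : ℤ)) = τ (-(k : ℤ))) (hσ : σ ∈ M.window l) :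
    τ ∈ M.window l := by
  refine ⟨fun k hk => (h k hk) ▸ hσ.1 k hk, fun k hk => ?_⟩
  have h1 := h (k + 1) hk
  rw [Nat.cast_add, Nat.cast_one] at h1
  rw [← h k hk.le, ← h1]
  exact hσ.2 k hk

lemma measurableSet_window [Countable E] (l : ℕ) : MeasurableSet (M.window l) := by
  have : M.window l =
      (⋂ k : ℕ, ⋂ _ : k ≤ l, (fun σ : CodeSpace E => σ (-(k : ℤ))) ⁻¹' range Alphabet.letter) ∩
      ⋂ k : ℕ, ⋂ _ : k < l, (fun σ : CodeSpace E => (σ (-(k : ℤ)), σ (-((k : ℤ) + 1)))) ⁻¹'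
        {q | M.i' q.1 = M.t' q.2} := by
    ext σ
    simp [window, eq_comm]
  rw [this]
  refine MeasurableSet.inter ?_ ?_
  · exact MeasurableSet.iInter fun k => MeasurableSet.iInter fun _ =>
      measurable_pi_apply _ MeasurableSet.of_discrete
  · exact MeasurableSet.iInter fun k => MeasurableSet.iInter fun _ =>
      ((measurable_pi_apply _).prodMk (measurable_pi_apply _)) MeasurableSet.of_discrete

lemma pathSpace_subset_window (l : ℕ) : M.pathSpace ⊆ M.window l := by
  intro σ hσ
  refine ⟨fun k _ => (hσ _).1, fun k _ => ?_⟩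
  have := (hσ (-((k : ℤ) + 1))).2
  rwa [show -((k : ℤ) + 1) + 1 = -(k : ℤ) by ring] at this

lemma measurable_approx [Countable E] [BorelSpace X] (x₀ : M.N → X) (n : ℕ) :
    Measurable (M.approx x₀ n) := (M.stronglyMeasurable_approx x₀ n).measurable

lemma countable_range_approx [Countable E] (x₀ : M.N → X) (n : ℕ) :
    (range (M.approx x₀ n)).Countable := by
  have := M.countable_vertices
  have hb : ∀ (n : ℕ) (f : CodeSpace E → X), (range f).Countable →
      (range fun σ => M.backward σ n (f σ)).Countable := by
    have hw : ∀ (k : ℤ) (f : CodeSpace E → X), (range f).Countable →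
        (range fun σ => M.w' (σ k) (f σ)).Countable := by
      intro k f hf
      refine (countable_iUnion fun a : Alphabet E => hf.image (M.w' a)).mono ?_
      rintro _ ⟨σ, rfl⟩
      exact mem_iUnion.2 ⟨σ k, f σ, mem_range_self σ, rfl⟩
    intro n
    induction n with
    | zero => exact fun f hf => hw 0 f hf
    | succ n ih => exact fun f hf => ih _ (hw _ f hf)
  refine hb n (fun σ => x₀ (M.i' (σ (-(n : ℤ))))) ((countable_range x₀).mono ?_)
  rintro _ ⟨σ, rfl⟩
  exact mem_range_self _

/-! ### The extended Markov operator -/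

/-- One step of the extended process: the point moves along the edge `e`, which is appended to
the history. -/
def skew (e : E) (z : X × CodeSpace E) : X × CodeSpace E := (M.w e z.1, push e z.2)

lemma measurable_skew (e : E) : Measurable (M.skew e) :=
  ((M.measurable_w e).comp measurable_fst).prodMk ((measurable_push e).comp measurable_snd)

/-- The distribution after one step of the extended process with initial distribution `ν`. -/
def skewAdjoint (ν : Measure (X × CodeSpace E)) : Measure (X × CodeSpace E) :=
  Measure.sum fun e => (ν.withDensity fun z => (M.p e z.1 : ℝ≥0∞)).map (M.skew e)

lemma lintegral_skewAdjoint [Countable E] (ν : Measure (X × CodeSpace E))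
    {f : X × CodeSpace E → ℝ≥0∞} (hf : Measurable f) :
    ∫⁻ z, f z ∂M.skewAdjoint ν = ∫⁻ z, ∑' e, (M.p e z.1 : ℝ≥0∞) * f (M.skew e z) ∂ν := by
  have h1 : ∀ e, Measurable fun z : X × CodeSpace E => (M.p e z.1 : ℝ≥0∞) := fun e =>
    (M.measurable_p_ennreal e).comp measurable_fst
  have h2 : ∀ e, Measurable fun z => f (M.skew e z) := fun e => hf.comp (M.measurable_skew e)
  have h3 : ∫⁻ z, ∑' e, (M.p e z.1 : ℝ≥0∞) * f (M.skew e z) ∂ν =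
      ∑' e, ∫⁻ z, (M.p e z.1 : ℝ≥0∞) * f (M.skew e z) ∂ν :=
    lintegral_tsum fun e => ((h1 e).mul (h2 e)).aemeasurable
  rw [h3, skewAdjoint, lintegral_sum_measure]
  refine tsum_congr fun e => ?_
  rw [lintegral_map hf (M.measurable_skew e),
    lintegral_withDensity_eq_lintegral_mul _ (h1 e) (h2 e)]
  rfl

lemma map_fst_skewAdjoint [Countable E] (ν : Measure (X × CodeSpace E)) :
    (M.skewAdjoint ν).map Prod.fst = M.adjoint (ν.map Prod.fst) := by
  refine Measure.ext_of_lintegral _ fun f hf => ?_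
  rw [lintegral_map hf measurable_fst,
    M.lintegral_skewAdjoint _ (f := fun z => f z.1) (hf.comp measurable_fst),
    M.lintegral_adjoint _ hf, lintegral_map (M.measurable_U hf) measurable_fst]
  rfl

lemma ae_skewAdjoint [Countable E] {ν : Measure (X × CodeSpace E)} {s : Set (X × CodeSpace E)}
    (hs : MeasurableSet s) (h : ∀ᵐ z ∂ν, ∀ e, M.p e z.1 ≠ 0 → M.skew e z ∈ s) :
    ∀ᵐ z ∂M.skewAdjoint ν, z ∈ s := by
  rw [ae_iff]
  change M.skewAdjoint ν sᶜ = 0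
  rw [← lintegral_indicator_one hs.compl,
    M.lintegral_skewAdjoint _ (measurable_one.indicator hs.compl)]
  refine (lintegral_congr_ae ?_).trans lintegral_zero
  filter_upwards [h] with z hz
  refine ENNReal.tsum_eq_zero.2 fun e => ?_
  by_cases hp : M.p e z.1 = 0
  · simp [hp]
  · simp [hz e hp]

/-- The joint distribution, after `k` steps from the initial distribution `ν`, of the point and
of its history of edges; before time `1` the history consists of the letter `∞`. -/
def process (ν : Measure X) (k : ℕ) : Measure (X × CodeSpace E) :=
  M.skewAdjoint^[k] (ν.map fun x => (x, emptyHistory E))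

lemma process_succ (ν : Measure X) (k : ℕ) :
    M.process ν (k + 1) = M.skewAdjoint (M.process ν k) :=
  Function.iterate_succ_apply' _ _ _

lemma map_fst_process [Countable E] (ν : Measure X) (k : ℕ) :
    (M.process ν k).map Prod.fst = M.adjoint^[k] ν := by
  induction k with
  | zero =>
    rw [process, Function.iterate_zero, id,
      Measure.map_map measurable_fst measurable_start]
    exact Measure.map_id
  | succ k ih => rw [process_succ, map_fst_skewAdjoint, ih, Function.iterate_succ_apply']

lemma isProbabilityMeasure_process [Countable E] (ν : Measure X) [IsProbabilityMeasure ν]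
    (k : ℕ) : IsProbabilityMeasure (M.process ν k) := by
  induction k with
  | zero =>
    exact Measure.isProbabilityMeasure_map measurable_start.aemeasurable
  | succ k ih =>
    refine ⟨?_⟩
    rw [process_succ, ← lintegral_one, M.lintegral_skewAdjoint _ measurable_const]
    simp [tsum_p]

/-! ### Contraction along the history -/

/-- The points with a history of edges of length at least `l + 1` that is compatible with the
position of the point. -/
def good (l : ℕ) : Set (X × CodeSpace E) :=
  {z | z.2 ∈ M.window l ∧ z.1 ∈ M.vertex (M.t' (z.2 0))}

lemma measurableSet_mem_vertex [Countable E] :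
    MeasurableSet {z : X × CodeSpace E | z.1 ∈ M.vertex (M.t' (z.2 0))} := by
  have : {z : X × CodeSpace E | z.1 ∈ M.vertex (M.t' (z.2 0))} =
      ⋃ a : Alphabet E, (Prod.fst ⁻¹' M.vertex (M.t' a)) ∩
        ((fun z : X × CodeSpace E => z.2 0) ⁻¹' {a}) := by
    ext z
    simp
  rw [this]
  exact MeasurableSet.iUnion fun a => (measurable_fst (M.measurableSet_vertex _)).inter
    (((measurable_pi_apply 0).comp measurable_snd) MeasurableSet.of_discrete)

lemma measurableSet_good [Countable E] (l : ℕ) : MeasurableSet (M.good l) :=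
  (measurable_snd (M.measurableSet_window l)).inter M.measurableSet_mem_vertex

/-- The distance between the point and the approximation given by the last `l + 1` edges of its
history. -/
def gap (x₀ : M.N → X) (l : ℕ) : X × CodeSpace E → ℝ≥0∞ :=
  (M.good l).indicator fun z => edist z.1 (M.approx x₀ l z.2)

lemma measurable_edist_approx [Countable E] [BorelSpace X] (x₀ : M.N → X) (l : ℕ) :
    Measurable fun z : X × CodeSpace E => edist z.1 (M.approx x₀ l z.2) := by
  have hc := M.countable_range_approx x₀ l
  have : Countable (range (M.approx x₀ l)) := hc
  have h1 : Measurable fun q : X × range (M.approx x₀ l) => edist q.1 (q.2 : X) :=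
    measurable_from_prod_countable_left fun y =>
      show Measurable fun x => edist x (y : X) from measurable_edist_left
  exact h1.comp (measurable_fst.prodMk
    (((M.measurable_approx x₀ l).subtype_mk (h := mem_range_self)).comp measurable_snd))

lemma measurable_gap [Countable E] [BorelSpace X] (x₀ : M.N → X) (l : ℕ) :
    Measurable (M.gap x₀ l) :=
  (M.measurable_edist_approx x₀ l).indicator (M.measurableSet_good l)

lemma tsum_p_mul_gap_succ_le {x₀ : M.N → X} (hx₀ : ∀ j, x₀ j ∈ M.vertex j) {a : ℝ≥0∞}
    (ha : ∀ j, ∀ x ∈ M.vertex j, ∀ y ∈ M.vertex j,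
      ∑' e, (M.p e x : ℝ≥0∞) * edist (M.w e x) (M.w e y) ≤ a * edist x y)
    (l : ℕ) (z : X × CodeSpace E) :
    ∑' e, (M.p e z.1 : ℝ≥0∞) * M.gap x₀ (l + 1) (M.skew e z) ≤ a * M.gap x₀ l z := by
  by_cases hz : z ∈ M.good l
  · rw [gap, gap, indicator_of_mem hz]
    refine le_trans (ENNReal.tsum_le_tsum fun e => ?_)
      (ha _ z.1 hz.2 _ (M.approx_mem_vertex hx₀ hz.1))
    gcongr
    refine (indicator_le_self _ _ _).trans ?_
    simp only [skew, approx_push_succ, le_refl]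
  · refine le_of_eq_of_le (ENNReal.tsum_eq_zero.2 fun e => ?_) zero_le
    by_cases hp : M.p e z.1 = 0
    · simp [hp]
    · rw [gap, indicator_of_notMem, mul_zero]
      rintro ⟨h1, -⟩
      obtain ⟨h2, h3⟩ := M.push_mem_window_succ.1 h1
      exact hz ⟨h2, h3 ▸ M.mem_vertex_of_p_ne_zero hp⟩

lemma tsum_p_mul_gap_zero_le {x₀ : M.N → X} (hx₀ : ∀ j, x₀ j ∈ M.vertex j) {a : ℝ≥0∞}
    (ha : ∀ j, ∀ x ∈ M.vertex j, ∀ y ∈ M.vertex j,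
      ∑' e, (M.p e x : ℝ≥0∞) * edist (M.w e x) (M.w e y) ≤ a * edist x y)
    (z : X × CodeSpace E) :
    ∑' e, (M.p e z.1 : ℝ≥0∞) * M.gap x₀ 0 (M.skew e z) ≤ a * M.distBase x₀ z.1 := by
  obtain ⟨j, hj⟩ := M.exists_mem_vertex z.1
  rw [M.distBase_eq hj]
  refine le_trans (ENNReal.tsum_le_tsum fun e => ?_) (ha j z.1 hj _ (hx₀ j))
  by_cases hp : M.p e z.1 = 0
  · simp [hp]
  · obtain rfl := M.eq_of_mem_vertex hj (M.mem_vertex_of_p_ne_zero hp)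
    gcongr
    refine (indicator_le_self _ _ _).trans ?_
    simp only [skew, approx_push_zero, le_refl]

lemma infty_notMem_window (l : ℕ) : emptyHistory E ∉ M.window l := by
  rintro ⟨h, -⟩
  obtain ⟨e, he⟩ := h 0 (Nat.zero_le _)
  exact OnePoint.infty_ne_coe e he

/-- The mean distance between the point and its approximation by a history of length `l + 1`
decays geometrically in `l`, uniformly in time. -/
lemma lintegral_gap_le [Countable E] [BorelSpace X] {x₀ : M.N → X}
    (hx₀ : ∀ j, x₀ j ∈ M.vertex j) {a : ℝ≥0∞}
    (ha : ∀ j, ∀ x ∈ M.vertex j, ∀ y ∈ M.vertex j,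
      ∑' e, (M.p e x : ℝ≥0∞) * edist (M.w e x) (M.w e y) ≤ a * edist x y)
    {ν : Measure X} {c : ℝ≥0∞} (hc : ∀ k, ∫⁻ x, M.distBase x₀ x ∂(M.adjoint^[k] ν) ≤ c)
    (l k : ℕ) : ∫⁻ z, M.gap x₀ l z ∂M.process ν k ≤ a ^ (l + 1) * c := by
  induction k generalizing l with
  | zero =>
    refine le_of_eq_of_le ?_ zero_le
    rw [process, Function.iterate_zero, id, lintegral_map (M.measurable_gap x₀ l)
      measurable_start]
    refine (lintegral_congr fun x => ?_).trans lintegral_zero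
    rw [gap, indicator_of_notMem]
    exact fun h => M.infty_notMem_window l h.1
  | succ k ih =>
    rw [process_succ, M.lintegral_skewAdjoint _ (M.measurable_gap x₀ l)]
    cases l with
    | zero =>
      refine (lintegral_mono fun z => M.tsum_p_mul_gap_zero_le hx₀ ha z).trans ?_
      have hV := M.measurable_distBase x₀
      rw [lintegral_const_mul a (f := fun z : X × CodeSpace E => M.distBase x₀ z.1)
        (hV.comp measurable_fst), zero_add, pow_one]
      gcongr
      rw [← lintegral_map hV measurable_fst, M.map_fst_process]
      exact hc k
    | succ l =>
      refine (lintegral_mono fun z => M.tsum_p_mul_gap_succ_le hx₀ ha l z).trans ?_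
      rw [lintegral_const_mul _ (M.measurable_gap x₀ l), pow_succ' a (l + 1), mul_assoc]
      gcongr
      exact ih l

/-- The point lies in the terminal vertex set of the last edge. -/
lemma ae_process_mem_vertex [Countable E] (ν : Measure X) (k : ℕ) :
    ∀ᵐ z ∂M.process ν k, z.2 ∈ M.window 0 → z.1 ∈ M.vertex (M.t' (z.2 0)) := by
  have hs : MeasurableSet {z : X × CodeSpace E |
      z.2 ∈ M.window 0 → z.1 ∈ M.vertex (M.t' (z.2 0))} :=
    (measurable_snd (M.measurableSet_window 0)).imp M.measurableSet_mem_vertex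
  cases k with
  | zero =>
    rw [process, Function.iterate_zero, id,
      ae_map_iff measurable_start.aemeasurable hs]
    exact ae_of_all _ fun x h => absurd h (M.infty_notMem_window 0)
  | succ k =>
    rw [process_succ]
    refine M.ae_skewAdjoint hs (ae_of_all _ fun z e hp _ => ?_)
    simpa [skew] using M.mapsTo_w e (M.mem_vertex_of_p_ne_zero hp)

lemma ae_process_mem_good [Countable E] (ν : Measure X) (l k : ℕ) :
    ∀ᵐ z ∂M.process ν k, z.2 ∈ M.window l → z ∈ M.good l := by
  filter_upwards [M.ae_process_mem_vertex ν k] with z hz h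
  exact ⟨h, hz (M.window_mono (Nat.zero_le l) h)⟩

/-- From time `l + 1` on, the last `l + 1` letters form a path of edges. -/
lemma ae_process_mem_window [Countable E] (ν : Measure X) {l k : ℕ} (h : l < k) :
    ∀ᵐ z ∂M.process ν k, z.2 ∈ M.window l := by
  induction l generalizing k with
  | zero =>
    obtain ⟨k, rfl⟩ : ∃ m, k = m + 1 := ⟨k - 1, by omega⟩
    rw [process_succ]
    exact M.ae_skewAdjoint (measurable_snd (M.measurableSet_window 0))
      (ae_of_all _ fun z e _ => M.push_mem_window_zero e z.2)
  | succ l ih =>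
    obtain ⟨k, rfl⟩ : ∃ m, k = m + 1 := ⟨k - 1, by omega⟩
    rw [process_succ]
    refine M.ae_skewAdjoint (measurable_snd (M.measurableSet_window (l + 1))) ?_
    filter_upwards [ih (show l < k by omega), M.ae_process_mem_good ν l k] with z hz hg e hp
    exact M.push_mem_window_succ.2
      ⟨hz, M.eq_of_mem_vertex (M.mem_vertex_of_p_ne_zero hp) (hg hz).2⟩

end MarkovSystem

/-! ### Tightness of invariant measures -/

lemma isCompact_iInter_infEDist_le {X : Type*} [MetricSpace X] [CompleteSpace X]
    (A : ℕ → Finset X) {r : ℕ → ℝ≥0∞} (hr : Tendsto r atTop (𝓝 0)) :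
    IsCompact (⋂ k, {x | Metric.infEDist x (A k : Set X) ≤ r k}) := by
  have hclosed : IsClosed (⋂ k, {x | Metric.infEDist x (A k : Set X) ≤ r k}) :=
    isClosed_iInter fun k => isClosed_le Metric.continuous_infEDist continuous_const
  refine TotallyBounded.isCompact_of_isClosed ?_ hclosed
  refine EMetric.totallyBounded_iff.2 fun ε hε => ?_
  obtain ⟨k, hk⟩ := (hr.eventually_lt_const hε).exists
  refine ⟨A k, (A k).finite_toSet, fun x hx => ?_⟩
  obtain ⟨y, hy, hxy⟩ := Metric.infEDist_lt_iff.1 ((mem_iInter.1 hx k).trans_lt hk)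
  exact mem_iUnion₂.2 ⟨y, hy, hxy⟩

/-- A measurable map with countable range takes its values in a finite set up to small measure. -/
lemma exists_finset_measure_notMem_le {Ω Y : Type*} [MeasurableSpace Ω] [MeasurableSpace Y]
    [MeasurableSingletonClass Y] (R : Measure Ω) [IsFiniteMeasure R] {f : Ω → Y}
    (hf : Measurable f) (hc : (range f).Countable) {η : ℝ≥0∞} (hη : 0 < η) :
    ∃ A : Finset Y, R {ω | f ω ∉ A} ≤ η := by
  classical
  have : Countable (range f) := hc
  have hsum : ∑' y : range f, R (f ⁻¹' {(y : Y)}) ≠ ∞ := by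
    rw [← measure_iUnion]
    · exact measure_ne_top _ _
    · intro y z hyz
      refine Disjoint.preimage f ?_
      simpa [Subtype.ext_iff] using hyz
    · exact fun y => hf (measurableSet_singleton _)
  obtain ⟨s, hs⟩ := ((ENNReal.tendsto_tsum_compl_atTop_zero hsum).eventually_lt_const hη).exists
  refine ⟨s.image Subtype.val, le_trans (le_trans (measure_mono ?_) (measure_iUnion_le
    (fun y : {y : range f // y ∉ s} => f ⁻¹' {((y : range f) : Y)}))) hs.le⟩
  intro ω hω
  refine mem_iUnion.2 ⟨⟨⟨f ω, mem_range_self ω⟩, fun h => hω ?_⟩, rfl⟩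
  exact Finset.mem_image_of_mem _ h

namespace MarkovSystem

open CodeSpace

variable {X E : Type*} [MetricSpace X] [MeasurableSpace X] (M : MarkovSystem X E)

/-- Uniform tightness on `B` follows if, at every depth, the approximations of the points of `B`
are concentrated on finite sets, uniformly over the measures considered. -/
lemma exists_isCompact_measure_diff_le [Countable E] [BorelSpace X] [CompleteSpace X]
    {x₀ : M.N → X} (hx₀ : ∀ j, x₀ j ∈ M.vertex j) (hcontr : M.IsContractive)
    (hb : M.b x₀ < ∞) {P : Set (Measure X)} (hP : P ⊆ M.invariantMeasures) {B : Set X}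
    (hB : MeasurableSet B)
    (hA : ∀ (l : ℕ) (η : ℝ≥0∞), 0 < η → ∃ A : Finset X, ∀ μ ∈ P,
      M.process μ (l + 1) {z | z ∈ M.good l ∧ z.1 ∈ B ∧ M.approx x₀ l z.2 ∉ A} ≤ η)
    {ε : ℝ≥0∞} (hε : 0 < ε) : ∃ C : Set X, IsCompact C ∧ ∀ μ ∈ P, μ (B \ C) ≤ ε := by
  obtain ⟨a, ha1, ha⟩ := hcontr.exists_rate
  set c := (1 - a)⁻¹ * M.b x₀ with hc
  have hctop : c ≠ ∞ :=
    ENNReal.mul_ne_top (ENNReal.inv_ne_top.2 (tsub_pos_of_lt ha1).ne') hb.ne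
  obtain ⟨ε', hε'0, hε'⟩ := ENNReal.exists_pos_sum_of_countable' hε.ne' ℕ
  have hr0 : ∀ k : ℕ, (2⁻¹ : ℝ≥0∞) ^ k ≠ 0 := fun k => pow_ne_zero _ (by simp)
  have hrtop : ∀ k : ℕ, (2⁻¹ : ℝ≥0∞) ^ k ≠ ∞ := fun k => ENNReal.pow_ne_top (by simp)
  have hl : ∀ k, ∃ l : ℕ, a ^ (l + 1) * c < ε' k / 2 * 2⁻¹ ^ k := by
    intro k
    have h1 : Tendsto (fun l : ℕ => a ^ (l + 1) * c) atTop (𝓝 0) := by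
      simpa using ENNReal.Tendsto.mul_const ((tendsto_add_atTop_iff_nat 1).2
        (ENNReal.tendsto_pow_atTop_nhds_zero_of_lt_one ha1)) (Or.inr hctop)
    refine (h1.eventually_lt_const ?_).exists
    exact ENNReal.mul_pos (ENNReal.half_pos (hε'0 k).ne').ne' (hr0 k)
  -- Histories of length `l k + 1` determine the point up to `2⁻¹ ^ k`, off a set of measure
  -- `ε' k / 2`, by Markov's inequality.
  choose l hl using hl
  choose A hA using fun k => hA (l k) (ε' k / 2) (ENNReal.half_pos (hε'0 k).ne')
  refine ⟨_, isCompact_iInter_infEDist_le A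
    (ENNReal.tendsto_pow_atTop_nhds_zero_of_lt_one (by simp : (2⁻¹ : ℝ≥0∞) < 1)), fun μ hμ => ?_⟩
  have hprob := (hP hμ).1
  have hfix : ∀ k, M.adjoint^[k] μ = μ := fun k => Function.iterate_fixed (hP hμ).2 k
  have hk : ∀ k, μ {x | x ∈ B ∧ 2⁻¹ ^ k < Metric.infEDist x (A k)} ≤ ε' k := by
    intro k
    set R := M.process μ (l k + 1)
    have hmeas : MeasurableSet {x | x ∈ B ∧ 2⁻¹ ^ k < Metric.infEDist x (A k : Set X)} :=
      hB.inter (measurableSet_lt measurable_const Metric.continuous_infEDist.measurable)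
    have hmarg : R.map Prod.fst = μ := by rw [M.map_fst_process, hfix]
    have hgap : R {z | 2⁻¹ ^ k ≤ M.gap x₀ (l k) z} ≤ ε' k / 2 := by
      refine (meas_ge_le_lintegral_div (M.measurable_gap x₀ (l k)).aemeasurable (hr0 k)
        (hrtop k)).trans ?_
      refine ENNReal.div_le_of_le_mul ((M.lintegral_gap_le hx₀ ha (c := c) (fun m => ?_) _ _).trans
        (hl k).le)
      rw [hfix]
      exact M.lintegral_distBase_le hx₀ ha1 ha (hP hμ)
    calc μ {x | x ∈ B ∧ 2⁻¹ ^ k < Metric.infEDist x (A k)}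
        = R {z | z.1 ∈ B ∧ 2⁻¹ ^ k < Metric.infEDist z.1 (A k)} := by
          conv_lhs => rw [← hmarg]
          rw [Measure.map_apply measurable_fst hmeas]
          rfl
      _ ≤ R ({z | z ∈ M.good (l k) ∧ z.1 ∈ B ∧ M.approx x₀ (l k) z.2 ∉ A k} ∪
            {z | 2⁻¹ ^ k ≤ M.gap x₀ (l k) z}) := by
          refine measure_mono_ae ?_
          filter_upwards [M.ae_process_mem_window μ (Nat.lt_succ_self (l k)),
            M.ae_process_mem_good μ (l k) (l k + 1)] with z hz1 hz2 hz
          have hg := hz2 hz1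
          by_cases hzA : M.approx x₀ (l k) z.2 ∈ A k
          · right
            change 2⁻¹ ^ k ≤ M.gap x₀ (l k) z
            rw [gap, indicator_of_mem hg]
            exact hz.2.le.trans (Metric.infEDist_le_edist_of_mem (Finset.mem_coe.2 hzA))
          · exact Or.inl ⟨hg, hz.1, hzA⟩
      _ ≤ ε' k / 2 + ε' k / 2 := (measure_union_le _ _).trans (add_le_add (hA k μ hμ) hgap)
      _ = ε' k := ENNReal.add_halves _
  calc μ (B \ ⋂ k, {x | Metric.infEDist x (A k : Set X) ≤ 2⁻¹ ^ k})
      ≤ μ (⋃ k, {x | x ∈ B ∧ 2⁻¹ ^ k < Metric.infEDist x (A k)}) := by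
        refine measure_mono fun x hx => ?_
        simpa [hx.1] using hx.2
    _ ≤ ∑' k, ε' k := (measure_iUnion_le _).trans (ENNReal.tsum_le_tsum hk)
    _ ≤ ε := hε'.le

lemma isTightMeasureSet_singleton_of_mem_invariantMeasures [Countable E] [BorelSpace X]
    [CompleteSpace X] {x₀ : M.N → X} (hx₀ : ∀ j, x₀ j ∈ M.vertex j) (hcontr : M.IsContractive)
    (hb : M.b x₀ < ∞) {μ : Measure X} (hμ : μ ∈ M.invariantMeasures) :
    IsTightMeasureSet {μ} := by
  refine isTightMeasureSet_iff_exists_isCompact_measure_compl_le.2 fun ε hε => ?_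
  have := hμ.1
  have hA : ∀ (l : ℕ) (η : ℝ≥0∞), 0 < η → ∃ A : Finset X, ∀ ν ∈ ({μ} : Set (Measure X)),
      M.process ν (l + 1) {z | z ∈ M.good l ∧ z.1 ∈ univ ∧ M.approx x₀ l z.2 ∉ A} ≤ η := by
    intro l η hη
    have := M.isProbabilityMeasure_process μ (l + 1)
    obtain ⟨A, hA⟩ := exists_finset_measure_notMem_le (M.process μ (l + 1))
      (f := fun z => M.approx x₀ l z.2) ((M.measurable_approx x₀ l).comp measurable_snd)
      ((M.countable_range_approx x₀ l).mono (by rintro _ ⟨z, rfl⟩; exact mem_range_self _)) hη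
    refine ⟨A, fun ν hν => ?_⟩
    obtain rfl : ν = μ := hν
    exact (measure_mono fun z hz => hz.2.2).trans hA
  obtain ⟨C, hC, h⟩ := M.exists_isCompact_measure_diff_le hx₀ hcontr hb
    (singleton_subset_iff.2 hμ) MeasurableSet.univ hA hε
  exact ⟨C, hC, fun ν hν => by simpa [compl_eq_univ_sdiff] using h ν hν⟩

/-- If every vertex has finitely many incoming edges, the histories of a given length that end at
a given vertex produce finitely many approximations. -/
lemma finite_approx_image {x₀ : M.N → X} (hfin : ∀ j, {e | M.t e = j}.Finite) (l : ℕ) (j : M.N) :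
    (M.approx x₀ l '' {σ | σ ∈ M.window l ∧ M.t' (σ 0) = j}).Finite := by
  have hpush : ∀ (σ : CodeSpace E) (e : E), σ 0 = Alphabet.letter e →
      push e (fun n => σ (n - 1)) = σ := by
    intro σ e he
    funext n
    by_cases hn : n = 0
    · subst hn
      rw [push_zero, he]
    · rw [push_of_ne _ _ hn, add_sub_cancel_right]
  induction l generalizing j with
  | zero =>
    refine ((hfin j).image fun e => M.w e (x₀ (M.i e))).subset ?_
    rintro _ ⟨σ, ⟨hσ, hj⟩, rfl⟩
    obtain ⟨e, he⟩ := hσ.1 0 le_rfl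
    rw [Nat.cast_zero, neg_zero] at he
    refine ⟨e, ?_, ?_⟩
    · rwa [he] at hj
    · conv_rhs => rw [← hpush σ e he, approx_push_zero]
  | succ l ih =>
    refine ((hfin j).biUnion fun e _ => (ih (M.i e)).image (M.w e)).subset ?_
    rintro _ ⟨σ, ⟨hσ, hj⟩, rfl⟩
    obtain ⟨e, he⟩ := hσ.1 0 (Nat.zero_le _)
    rw [Nat.cast_zero, neg_zero] at he
    rw [← hpush σ e he] at hσ ⊢
    obtain ⟨h1, h2⟩ := M.push_mem_window_succ.1 hσ
    refine mem_iUnion₂.2 ⟨e, ?_, _, ⟨_, ⟨h1, h2.symm⟩, rfl⟩, (M.approx_push_succ x₀ e _ l).symm⟩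
    rwa [he] at hj

lemma exists_isCompact_measure_biUnion_vertex_diff_le [Countable E] [BorelSpace X]
    [CompleteSpace X] {x₀ : M.N → X} (hx₀ : ∀ j, x₀ j ∈ M.vertex j) (hcontr : M.IsContractive)
    (hb : M.b x₀ < ∞) (hfin : ∀ j, {e | M.t e = j}.Finite) (c : Finset M.N) {ε : ℝ≥0∞}
    (hε : 0 < ε) :
    ∃ C : Set X, IsCompact C ∧
      ∀ μ ∈ M.invariantMeasures, μ ((⋃ j ∈ c, M.vertex j) \ C) ≤ ε := by
  refine M.exists_isCompact_measure_diff_le hx₀ hcontr hb Subset.rfl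
    (Finset.measurableSet_biUnion _ fun j _ => M.measurableSet_vertex j) (fun l η _ => ?_) hε
  have hF : (⋃ j ∈ c, M.approx x₀ l '' {σ | σ ∈ M.window l ∧ M.t' (σ 0) = j}).Finite :=
    c.finite_toSet.biUnion fun j _ => M.finite_approx_image hfin l j
  refine ⟨hF.toFinset, fun μ _ => le_of_eq_of_le ?_ zero_le⟩
  convert measure_empty (μ := M.process μ (l + 1))
  refine eq_empty_of_forall_notMem ?_
  rintro z ⟨hz, hzB, hzA⟩
  obtain ⟨j, hj, hzj⟩ := mem_iUnion₂.1 hzB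
  refine hzA (hF.mem_toFinset.2 (mem_iUnion₂.2 ⟨j, hj, _, ⟨hz.1, ?_⟩, rfl⟩))
  exact M.eq_of_mem_vertex hz.2 hzj

lemma exists_isCompact_measureReal_lt [Countable E] [BorelSpace X] [CompleteSpace X]
    {x₀ : M.N → X} (hx₀ : ∀ j, x₀ j ∈ M.vertex j) (hcontr : M.IsContractive)
    (hb : M.b x₀ < ∞) (hfin : ∀ j, {e | M.t e = j}.Finite) (c : Finset M.N) {ε : ℝ}
    (hε : 0 < ε) :
    ∃ C : Set X, IsCompact C ∧
      ∀ μ ∈ M.invariantMeasures, μ.real (⋃ j ∈ c, M.vertex j) - ε < μ.real C := by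
  obtain ⟨C, hC, h⟩ := M.exists_isCompact_measure_biUnion_vertex_diff_le hx₀ hcontr hb hfin c
    (ENNReal.ofReal_pos.2 (half_pos hε))
  refine ⟨C, hC, fun μ hμ => ?_⟩
  have := hμ.1
  have h1 : μ.real ((⋃ j ∈ c, M.vertex j) \ C) ≤ ε / 2 :=
    ENNReal.toReal_le_of_le_ofReal (half_pos hε).le (h μ hμ)
  have h2 := le_measureReal_sdiff (μ := μ) (s₂ := C) (s₁ := ⋃ j ∈ c, M.vertex j)
  linarith

lemma isTightMeasureSet_invariantMeasures [Finite E] [BorelSpace X] [CompleteSpace X]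
    {x₀ : M.N → X} (hx₀ : ∀ j, x₀ j ∈ M.vertex j) (hcontr : M.IsContractive)
    (hb : M.b x₀ < ∞) : IsTightMeasureSet M.invariantMeasures := by
  have : Finite M.N := Finite.of_surjective _ M.i_surjective
  have := Fintype.ofFinite M.N
  refine isTightMeasureSet_iff_exists_isCompact_measure_compl_le.2 fun ε hε => ?_
  obtain ⟨C, hC, h⟩ := M.exists_isCompact_measure_biUnion_vertex_diff_le hx₀ hcontr hb
    (fun j => toFinite _) Finset.univ hε
  refine ⟨C, hC, fun μ hμ => ?_⟩
  simpa [M.iUnion_vertex, compl_eq_univ_sdiff] using h μ hμ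

end MarkovSystem

/-! ### A maximal inequality, and recurrence from an invariant measure -/

namespace MarkovSystem

variable {X E : Type*} [MetricSpace X] [MeasurableSpace X] (M : MarkovSystem X E)

lemma U_finset_sum {ι : Type*} (s : Finset ι) (f : ι → X → ℝ≥0∞) :
    M.U (∑ i ∈ s, f i) = ∑ i ∈ s, M.U (f i) := by
  classical
  induction s using Finset.induction_on with
  | empty => exact M.U_const 0
  | insert i s hi ih => rw [Finset.sum_insert hi, Finset.sum_insert hi, U_add, ih]

lemma measurable_U_iterate [Countable E] {f : X → ℝ≥0∞} (hf : Measurable f) (k : ℕ) :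
    Measurable (M.U^[k] f) := by
  induction k with
  | zero => exact hf
  | succ k ih => rw [Function.iterate_succ_apply']; exact M.measurable_U ih

lemma lintegral_U_of_mem [Countable E] {μ : Measure X} (hμ : μ ∈ M.invariantMeasures)
    {f : X → ℝ≥0∞} (hf : Measurable f) : ∫⁻ x, M.U f x ∂μ = ∫⁻ x, f x ∂μ := by
  rw [← M.lintegral_adjoint μ hf, hμ.2]

/-- The sums of the first iterates of a function under the Markov operator. -/
def orbitSum (f : X → ℝ≥0∞) (n : ℕ) : X → ℝ≥0∞ := ∑ k ∈ Finset.range n, M.U^[k] f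

lemma orbitSum_succ (f : X → ℝ≥0∞) (n : ℕ) :
    M.orbitSum f (n + 1) = f + M.U (M.orbitSum f n) := by
  rw [orbitSum, orbitSum, U_finset_sum, Finset.sum_range_succ', add_comm]
  simp [Function.iterate_succ_apply']

/-- The maximal excess of the sums of the first iterates over the linear function with slope
`c`. -/
def maxExcess (f : X → ℝ≥0∞) (c : ℝ≥0∞) (n : ℕ) (x : X) : ℝ≥0∞ :=
  (Finset.range (n + 1)).sup fun k => M.orbitSum f k x - k * c

/-- The pointwise inequality behind the maximal inequality (Garsia's argument). -/
lemma maxExcess_add_le (f : X → ℝ≥0∞) {c : ℝ≥0∞} (hc : c ≠ ∞) (n : ℕ) (x : X) :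
    M.maxExcess f c n x + {x | 0 < M.maxExcess f c n x}.indicator (fun _ => c) x ≤
      f x + M.U (M.maxExcess f c n) x := by
  by_cases h : 0 < M.maxExcess f c n x
  · rw [indicator_of_mem (show x ∈ {x | 0 < M.maxExcess f c n x} from h)]
    obtain ⟨k, hk, hkx⟩ := Finset.exists_mem_eq_sup (Finset.range (n + 1))
      ⟨0, by simp⟩ fun k => M.orbitSum f k x - k * c
    change M.maxExcess f c n x = _ at hkx
    rw [hkx] at h ⊢
    cases k with
    | zero => simp [orbitSum] at h
    | succ m =>
      have h1 : M.orbitSum f m ≤ M.maxExcess f c n + fun _ => (m : ℝ≥0∞) * c := by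
        intro y
        refine tsub_le_iff_right.1 ?_
        exact Finset.le_sup (f := fun k : ℕ => M.orbitSum f k y - k * c)
          (by simp at hk ⊢; omega : m ∈ Finset.range (n + 1))
      have h2 : M.U (M.orbitSum f m) x ≤ M.U (M.maxExcess f c n) x + m * c := by
        refine (M.U_mono h1 x).trans_eq ?_
        rw [U_add, U_const]
        rfl
      have h3 : M.orbitSum f (m + 1) x - ((m + 1 : ℕ) : ℝ≥0∞) * c + c + m * c =
          M.orbitSum f (m + 1) x := by
        have h4 : c + m * c = ((m + 1 : ℕ) : ℝ≥0∞) * c := by push_cast; ring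
        rw [add_assoc, h4, tsub_add_cancel_of_le (tsub_pos_iff_lt.1 h).le]
      have hm : (m : ℝ≥0∞) * c ≠ ∞ := ENNReal.mul_ne_top (ENNReal.natCast_ne_top m) hc
      refine (ENNReal.add_le_add_iff_right hm).1 ?_
      rw [h3, orbitSum_succ, add_assoc]
      exact add_le_add_right h2 _
  · rw [indicator_of_notMem (show x ∉ {x | 0 < M.maxExcess f c n x} from h),
      (not_lt.1 h).antisymm zero_le]
    simp

lemma measurable_orbitSum [Countable E] {f : X → ℝ≥0∞} (hf : Measurable f) (n : ℕ) :
    Measurable (M.orbitSum f n) := by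
  rw [orbitSum, Finset.sum_fn]
  exact Finset.measurable_sum _ fun k _ => M.measurable_U_iterate hf k

lemma measurable_maxExcess [Countable E] {f : X → ℝ≥0∞} (hf : Measurable f) (c : ℝ≥0∞) (n : ℕ) :
    Measurable (M.maxExcess f c n) := by
  have : M.maxExcess f c n = fun x => ⨆ k ∈ Finset.range (n + 1), (M.orbitSum f k x - k * c) := by
    funext x
    rw [maxExcess, Finset.sup_eq_iSup]
  rw [this]
  exact Measurable.biSup _ (to_countable _) fun k _ => (M.measurable_orbitSum hf k).sub_const _

lemma maxExcess_mono (f : X → ℝ≥0∞) (c : ℝ≥0∞) {m n : ℕ} (h : m ≤ n) (x : X) :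
    M.maxExcess f c m x ≤ M.maxExcess f c n x :=
  Finset.sup_mono (Finset.range_mono (by omega))

/-- The maximal ergodic inequality for the Markov operator. -/
lemma mul_measure_exists_lt_orbitSum_le [Countable E] {μ : Measure X}
    (hμ : μ ∈ M.invariantMeasures) {f : X → ℝ≥0∞} (hf : Measurable f)
    (hfin : ∫⁻ x, f x ∂μ ≠ ∞) {c : ℝ≥0∞} (hc : c ≠ ∞) :
    c * μ {x | ∃ n : ℕ, n * c < M.orbitSum f n x} ≤ ∫⁻ x, f x ∂μ := by
  have hG := fun n => M.measurable_maxExcess hf c n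
  have hpos : ∀ n, MeasurableSet {x | 0 < M.maxExcess f c n x} := fun n =>
    measurableSet_lt measurable_const (hG n)
  have hint : ∀ n, ∫⁻ x, M.orbitSum f n x ∂μ ≠ ∞ := by
    intro n
    induction n with
    | zero => simp [orbitSum]
    | succ n ih =>
      rw [orbitSum_succ]
      simp only [Pi.add_apply]
      rw [lintegral_add_left hf, M.lintegral_U_of_mem hμ (M.measurable_orbitSum hf n)]
      exact ENNReal.add_ne_top.2 ⟨hfin, ih⟩
  have hGint : ∀ n, ∫⁻ x, M.maxExcess f c n x ∂μ ≠ ∞ := by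
    intro n
    refine ne_top_of_le_ne_top (hint n) (lintegral_mono fun x => Finset.sup_le fun k hk => ?_)
    refine tsub_le_self.trans ?_
    simp only [orbitSum, Finset.sum_apply]
    exact Finset.sum_le_sum_of_subset (Finset.range_mono (by simp at hk; omega))
  have hn : ∀ n, c * μ {x | 0 < M.maxExcess f c n x} ≤ ∫⁻ x, f x ∂μ := by
    intro n
    have h1 := lintegral_mono (μ := μ) (M.maxExcess_add_le f hc n)
    rw [lintegral_add_left (hG n), lintegral_add_left hf, M.lintegral_U_of_mem hμ (hG n),
      lintegral_indicator_const (hpos n), add_comm] at h1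
    exact (ENNReal.add_le_add_iff_right (hGint n)).1 h1
  have hset : {x | ∃ n : ℕ, n * c < M.orbitSum f n x} = ⋃ n, {x | 0 < M.maxExcess f c n x} := by
    ext x
    simp only [mem_ofPred_eq, mem_iUnion, maxExcess, Finset.lt_sup_iff, Finset.mem_range,
      tsub_pos_iff_lt]
    exact ⟨fun ⟨n, hn⟩ => ⟨n, n, by omega, hn⟩, fun ⟨_, k, _, hk⟩ => ⟨k, hk⟩⟩
  have hmono : Monotone fun n => {x | 0 < M.maxExcess f c n x} := fun m n h x hx =>
    lt_of_lt_of_le (b := M.maxExcess f c m x) hx (M.maxExcess_mono f c h x)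
  rw [hset, hmono.measure_iUnion, ENNReal.mul_iSup]
  exact iSup_le hn

lemma averagedVertexMeasure_apply [Countable E] (x : X) (n : ℕ) (V : Set M.N) :
    M.averagedVertexMeasure x n V = (n : ℝ≥0∞)⁻¹ * ∑ k ∈ Finset.Icc 1 n,
      (M.adjoint^[k] (Measure.dirac x)) (⋃ j ∈ V, M.vertex j) := by
  have := M.countable_vertices
  have hV : MeasurableSet V := .of_discrete
  have h : ∀ ν : Measure X, ν (⋃ j ∈ V, M.vertex j) =
      ∑' j, V.indicator (fun j => ν (M.vertex j)) j := by
    intro ν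
    rw [measure_biUnion (to_countable V) (fun j _ k _ hjk => M.disjoint_vertex hjk)
      fun j _ => M.measurableSet_vertex j, tsum_subtype V fun j => ν (M.vertex j)]
  simp_rw [h]
  rw [← Summable.tsum_finsetSum (fun _ _ => ENNReal.summable), ← ENNReal.tsum_mul_left,
    averagedVertexMeasure, Measure.sum_apply _ hV]
  refine tsum_congr fun j => ?_
  by_cases hj : j ∈ V
  · simp [hj, Measure.dirac_apply' _ hV]
  · simp [hj, Measure.dirac_apply' _ hV]

lemma sum_adjoint_iterate_dirac_apply [Countable E] [BorelSpace X] (x : X) (n : ℕ) {B : Set X}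
    (hB : MeasurableSet B) :
    ∑ k ∈ Finset.Icc 1 n, (M.adjoint^[k] (Measure.dirac x)) B =
      M.orbitSum (M.U (B.indicator 1)) n x := by
  have hm : Measurable (B.indicator (1 : X → ℝ≥0∞)) := measurable_one.indicator hB
  have h : ∀ k, (M.adjoint^[k] (Measure.dirac x)) B = (M.U^[k] (B.indicator 1)) x := by
    intro k
    rw [← lintegral_indicator_one hB, M.lintegral_adjoint_iterate _ _ hm, lintegral_dirac]
  rw [orbitSum, Finset.sum_apply, ← Finset.Ico_add_one_right_eq_Icc, Finset.sum_Ico_eq_sum_range]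
  refine Finset.sum_congr (by simp) fun k _ => ?_
  rw [h, add_comm, Function.iterate_succ_apply]

/-- An invariant measure forces tightness of the averaged vertex distributions for some starting
point. -/
lemma isRecurrent_of_nonempty [Countable E] [BorelSpace X] (h : M.invariantMeasures.Nonempty) :
    M.IsRecurrent := by
  obtain ⟨μ, hμ⟩ := h
  have hprob := hμ.1
  have := M.countable_vertices
  obtain ⟨δ, hδ0, hδ⟩ := ENNReal.exists_pos_sum_of_countable' one_ne_zero ℕ
  have hr0 : ∀ k : ℕ, (2⁻¹ : ℝ≥0∞) ^ k ≠ 0 := fun k => pow_ne_zero _ (by simp)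
  have hrtop : ∀ k : ℕ, (2⁻¹ : ℝ≥0∞) ^ k ≠ ∞ := fun k => ENNReal.pow_ne_top (by simp)
  have hsum : ∑' j, μ (M.vertex j) ≠ ∞ := by
    rw [← measure_iUnion M.disjoint_vertex M.measurableSet_vertex]
    exact measure_ne_top _ _
  have hV : ∀ m : ℕ, ∃ V : Finset M.N,
      μ (⋃ j ∈ (V : Set M.N)ᶜ, M.vertex j) ≤ 2⁻¹ ^ m * δ m := by
    intro m
    obtain ⟨V, hV⟩ := ((ENNReal.tendsto_tsum_compl_atTop_zero hsum).eventually_lt_const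
      (ENNReal.mul_pos (hr0 m) (hδ0 m).ne')).exists
    refine ⟨V, ?_⟩
    rw [measure_biUnion (to_countable _) (fun j _ k _ hjk => M.disjoint_vertex hjk)
      fun j _ => M.measurableSet_vertex j]
    exact hV.le
  -- By the maximal inequality, the starting points whose averages ever exceed `2⁻¹ ^ m` off `V m`
  -- have measure at most `δ m`, and these measures add up to less than one.
  choose V hV using hV
  set B : ℕ → Set X := fun m => ⋃ j ∈ (V m : Set M.N)ᶜ, M.vertex j with hBdef
  have hB : ∀ m, MeasurableSet (B m) := fun m =>
    MeasurableSet.biUnion (to_countable _) fun j _ => M.measurableSet_vertex j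
  set bad : ℕ → Set X := fun m =>
    {x | ∃ n : ℕ, n * 2⁻¹ ^ m < M.orbitSum (M.U ((B m).indicator 1)) n x} with hbad
  have hbadle : ∀ m, μ (bad m) ≤ δ m := by
    intro m
    have hm : Measurable ((B m).indicator (1 : X → ℝ≥0∞)) := measurable_one.indicator (hB m)
    have hint : ∫⁻ x, M.U ((B m).indicator 1) x ∂μ = μ (B m) := by
      rw [M.lintegral_U_of_mem hμ hm, lintegral_indicator_one (hB m)]
    have h1 := M.mul_measure_exists_lt_orbitSum_le hμ (M.measurable_U hm)
      (by rw [hint]; exact measure_ne_top _ _) (hrtop m)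
    rw [hint] at h1
    exact (ENNReal.mul_le_mul_iff_right (hr0 m) (hrtop m)).1 (h1.trans (hV m))
  obtain ⟨x, hx⟩ : ∃ x, x ∉ ⋃ m, bad m := by
    by_contra! hall
    have h1 : μ (⋃ m, bad m) < 1 :=
      ((measure_iUnion_le _).trans (ENNReal.tsum_le_tsum hbadle)).trans_lt hδ
    rw [eq_univ_of_forall hall, measure_univ] at h1
    exact lt_irrefl _ h1
  refine ⟨x, fun ε hε => ?_⟩
  obtain ⟨m, hm⟩ := ((ENNReal.tendsto_pow_atTop_nhds_zero_of_lt_one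
    (by simp : (2⁻¹ : ℝ≥0∞) < 1)).eventually_lt_const hε).exists
  refine ⟨V m, fun n hn => lt_of_le_of_lt ?_ hm⟩
  have hxm : ¬ ∃ n : ℕ, n * 2⁻¹ ^ m < M.orbitSum (M.U ((B m).indicator 1)) n x := fun h =>
    hx (mem_iUnion.2 ⟨m, h⟩)
  push Not at hxm
  rw [averagedVertexMeasure_apply, M.sum_adjoint_iterate_dirac_apply x n (hB m), mul_comm,
    ← div_eq_mul_inv]
  exact ENNReal.div_le_of_le_mul' (hxm n)

end MarkovSystem

/-! ### Topology of the code space -/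

namespace Alphabet

instance (E : Type*) : CompactSpace (Alphabet E) :=
  let _ : TopologicalSpace E := ⊥
  inferInstanceAs (CompactSpace (OnePoint E))

instance (E : Type*) : TotallySeparatedSpace (Alphabet E) :=
  let _ : TopologicalSpace E := ⊥
  have : DiscreteTopology E := ⟨rfl⟩
  inferInstanceAs (TotallySeparatedSpace (OnePoint E))

lemma isOpen_singleton_letter {E : Type*} (e : E) : IsOpen {letter e} := by
  let _ : TopologicalSpace E := ⊥
  have : DiscreteTopology E := ⟨rfl⟩
  change IsOpen ({((e : E) : OnePoint E)} : Set (OnePoint E))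
  rw [OnePoint.isOpen_iff_of_notMem (by simp)]
  exact isOpen_discrete _

lemma finite_compl_of_isOpen {E : Type*} {s : Set (Alphabet E)} (hs : IsOpen s)
    (h : (OnePoint.infty : OnePoint E) ∈ s) : sᶜ.Finite := by
  let _ : TopologicalSpace E := ⊥
  have : DiscreteTopology E := ⟨rfl⟩
  have h1 := ((OnePoint.isOpen_iff_of_mem (s := s) h).1 hs).2.finite_of_discrete
  refine (h1.image letter).subset fun a ha => ?_
  rcases a with _ | e
  · exact absurd h ha
  · exact ⟨e, ha, rfl⟩

instance (E : Type*) [Countable E] : SecondCountableTopology (Alphabet E) := by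
  refine (TopologicalSpace.isTopologicalBasis_of_isOpen_of_nhds
    (s := range (fun F : Finset (Alphabet E) => (F : Set (Alphabet E))ᶜ) ∪
      range fun e : E => {letter e}) ?_ ?_).secondCountableTopology
    ((countable_range _).union (countable_range _))
  · rintro _ (⟨F, rfl⟩ | ⟨e, rfl⟩)
    · exact F.finite_toSet.isClosed.isOpen_compl
    · exact isOpen_singleton_letter e
  · intro a u ha hu
    rcases a with _ | e
    · have hf := finite_compl_of_isOpen hu ha
      refine ⟨u, Or.inl ⟨hf.toFinset, ?_⟩, ha, Subset.rfl⟩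
      simp
    · exact ⟨{letter e}, Or.inr ⟨e, rfl⟩, rfl, singleton_subset_iff.2 ha⟩

end Alphabet

namespace CodeSpace

variable {E : Type*}

/-- The shift by `m` coordinates to the left. -/
def shiftBy (m : ℤ) (σ : CodeSpace E) : CodeSpace E := fun n => σ (n + m)

lemma measurable_shiftBy (m : ℤ) : Measurable (shiftBy m : CodeSpace E → CodeSpace E) :=
  measurable_pi_lambda _ fun n => measurable_pi_apply (n + m)

lemma measurable_shiftBy_snd {X : Type*} [MeasurableSpace X] (m : ℤ) :
    Measurable fun z : X × CodeSpace E => shiftBy m z.2 :=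
  (measurable_shiftBy m).comp measurable_snd

lemma shift_shiftBy (m : ℤ) (σ : CodeSpace E) : shift (shiftBy m σ) = shiftBy (m + 1) σ := by
  funext n
  simp only [shift, shiftBy]
  congr 1
  ring

lemma continuous_shift : Continuous (shift : CodeSpace E → CodeSpace E) :=
  continuous_pi fun n => continuous_apply (n + 1)

/-- A function on the code space that depends on the coordinates `≤ 0` only. -/
def PastDetermined {Y : Type*} (g : CodeSpace E → Y) : Prop :=
  ∀ σ τ, (∀ n ≤ 0, σ n = τ n) → g σ = g τ

lemma shiftBy_shiftBy (m n : ℤ) (σ : CodeSpace E) :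
    shiftBy m (shiftBy n σ) = shiftBy (m + n) σ := by
  funext k
  simp only [shiftBy]
  congr 1
  ring

lemma shiftBy_zero (σ : CodeSpace E) : shiftBy 0 σ = σ := by
  funext k
  simp [shiftBy]

lemma map_shiftBy {Λ : Measure (CodeSpace E)} (h : Λ.map shift = Λ) (m : ℤ) :
    Λ.map (shiftBy m) = Λ := by
  have hnat : ∀ n : ℕ, Λ.map (shiftBy (n : ℤ)) = Λ := by
    intro n
    induction n with
    | zero =>
      have : (shiftBy ((0 : ℕ) : ℤ) : CodeSpace E → CodeSpace E) = id := funext shiftBy_zero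
      rw [this, Measure.map_id]
    | succ n ih =>
      have : (shiftBy ((n + 1 : ℕ) : ℤ) : CodeSpace E → CodeSpace E) = shift ∘ shiftBy n := by
        funext σ
        rw [Function.comp_apply, shift_shiftBy, Nat.cast_succ]
      rw [this, ← Measure.map_map measurable_shift (measurable_shiftBy _), ih, h]
  obtain ⟨n, rfl | rfl⟩ := m.eq_nat_or_neg
  · exact hnat n
  · have : (shiftBy (-(n : ℤ)) : CodeSpace E → CodeSpace E) ∘ shiftBy n = id := by
      funext σ
      rw [Function.comp_apply, shiftBy_shiftBy, neg_add_cancel, shiftBy_zero, id]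
    conv_lhs => rw [← hnat n]
    rw [Measure.map_map (measurable_shiftBy _) (measurable_shiftBy _), this, Measure.map_id]

end CodeSpace

namespace MarkovSystem

open CodeSpace

variable {X E : Type*} [MetricSpace X] [MeasurableSpace X] (M : MarkovSystem X E)

/-! ### Occupation measures and their limits -/

/-- Going back `r` steps in the history of the process at time `k + r` gives the history at
time `k`. -/
lemma lintegral_shiftBy_process [Countable E] (ν : Measure X) (k r : ℕ) {g : CodeSpace E → ℝ≥0∞}
    (hg : Measurable g) (hp : PastDetermined g) :
    ∫⁻ z, g (shiftBy (-(r : ℤ)) z.2) ∂M.process ν (k + r) = ∫⁻ z, g z.2 ∂M.process ν k := by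
  induction r with
  | zero => simp [shiftBy_zero]
  | succ r ih =>
    rw [← ih, ← add_assoc, process_succ, M.lintegral_skewAdjoint _
      (f := fun z => g (shiftBy (-((r + 1 : ℕ) : ℤ)) z.2))
      (hg.comp ((measurable_shiftBy _).comp measurable_snd))]
    refine lintegral_congr fun z => ?_
    have : ∀ e, g (shiftBy (-((r + 1 : ℕ) : ℤ)) (M.skew e z).2) =
        g (shiftBy (-(r : ℤ)) z.2) := by
      intro e
      refine hp _ _ fun n hn => ?_
      simp only [shiftBy, skew]
      rw [push_of_ne _ _ (by push_cast; omega)]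
      refine congrArg z.2 ?_
      push_cast
      ring
    simp_rw [this]
    rw [ENNReal.tsum_mul_right, tsum_p, one_mul]

/-- The average, over the times `1, …, n + 1`, of the law of the sequence of edges of the process
started at `x`, seen from that time. The process is run up to time `2 (n + 1)`, so that
the sequences have long histories and long futures. -/
def occupation (x : X) (n : ℕ) : Measure (CodeSpace E) :=
  ((n + 1 : ℕ) : ℝ≥0∞)⁻¹ • ∑ k ∈ Finset.range (n + 1),
    (M.process (Measure.dirac x) (2 * (n + 1))).map
      fun z => shiftBy ((k : ℤ) + 1 - (2 * (n + 1) : ℕ)) z.2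

lemma lintegral_occupation [Countable E] (x : X) (n : ℕ) {g : CodeSpace E → ℝ≥0∞}
    (hg : Measurable g) (hp : PastDetermined g) :
    ∫⁻ σ, g σ ∂M.occupation x n = ((n + 1 : ℕ) : ℝ≥0∞)⁻¹ * ∑ k ∈ Finset.range (n + 1),
      ∫⁻ z, g z.2 ∂M.process (Measure.dirac x) (k + 1) := by
  rw [occupation, lintegral_smul_measure, lintegral_finsetSum_measure, smul_eq_mul]
  congr 1
  refine Finset.sum_congr rfl fun k hk => ?_
  have hk : k < n + 1 := Finset.mem_range.1 hk
  obtain ⟨r, hr⟩ : ∃ r, 2 * (n + 1) = k + 1 + r := ⟨2 * (n + 1) - (k + 1), by omega⟩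
  rw [lintegral_map hg (measurable_shiftBy_snd _), hr,
    ← M.lintegral_shiftBy_process _ (k + 1) r hg hp]
  refine lintegral_congr fun z => ?_
  rw [show (k : ℤ) + 1 - (k + 1 + r : ℕ) = -(r : ℤ) by push_cast; ring]

lemma inv_mul_sum_le {n : ℕ} {f : ℕ → ℝ≥0∞} {c : ℝ≥0∞} (h : ∀ k, f k ≤ c) :
    ((n + 1 : ℕ) : ℝ≥0∞)⁻¹ * ∑ k ∈ Finset.range (n + 1), f k ≤ c := by
  rw [mul_comm, ← div_eq_mul_inv]
  refine ENNReal.div_le_of_le_mul' ((Finset.sum_le_card_nsmul _ _ c fun k _ => h k).trans ?_)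
  simp

instance isProbabilityMeasure_occupation [Countable E] (x : X) (n : ℕ) :
    IsProbabilityMeasure (M.occupation x n) := by
  have := fun k => M.isProbabilityMeasure_process (Measure.dirac x) k
  refine ⟨?_⟩
  rw [← lintegral_one, M.lintegral_occupation x n measurable_const fun _ _ _ => rfl]
  simp only [lintegral_one, measure_univ, Finset.sum_const, Finset.card_range, nsmul_eq_mul,
    mul_one]
  exact ENNReal.inv_mul_cancel (by simp) (ENNReal.natCast_ne_top _)

/-- The measure `Λ` is a shift-invariant weak limit of the occupation measures along `φ`. -/
structure IsOccupationLimit (x : X) (φ : ℕ → ℕ) (Λ : Measure (CodeSpace E)) : Prop where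
  isProbabilityMeasure : IsProbabilityMeasure Λ
  strictMono : StrictMono φ
  map_shift : Λ.map shift = Λ
  le_liminf : ∀ G, IsOpen G → Λ G ≤ atTop.liminf fun n => M.occupation x (φ n) G

lemma integral_shift_occupation_sub [Countable E] (x : X) (n : ℕ)
    (f : BoundedContinuousFunction (CodeSpace E) ℝ) :
    |∫ σ, f (shift σ) ∂M.occupation x n - ∫ σ, f σ ∂M.occupation x n| ≤
      2 * ‖f‖ * ((n : ℝ) + 1)⁻¹ := by
  have := fun k => M.isProbabilityMeasure_process (Measure.dirac x) k
  set ρ := M.process (Measure.dirac x) (2 * (n + 1))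
  have hprob : ∀ m : ℤ, IsProbabilityMeasure (ρ.map fun z => shiftBy m z.2) := fun m =>
    Measure.isProbabilityMeasure_map (measurable_shiftBy_snd m).aemeasurable
  let u : ℕ → ℝ := fun k => ∫ z, f (shiftBy ((k : ℤ) + 1 - (2 * (n + 1) : ℕ)) z.2) ∂ρ
  have h1 : ∫ σ, f σ ∂M.occupation x n =
      ((n : ℝ) + 1)⁻¹ * ∑ k ∈ Finset.range (n + 1), u k := by
    rw [occupation, integral_smul_measure, integral_finsetSum_measure fun k _ => f.integrable _]
    simp only [smul_eq_mul, ENNReal.toReal_inv, ENNReal.toReal_natCast]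
    rw [Nat.cast_succ]
    congr 1
    refine Finset.sum_congr rfl fun k _ => ?_
    rw [integral_map (measurable_shiftBy_snd _).aemeasurable
      f.continuous.measurable.aestronglyMeasurable]
  have h2 : ∫ σ, f (shift σ) ∂M.occupation x n =
      ((n : ℝ) + 1)⁻¹ * ∑ k ∈ Finset.range (n + 1), u (k + 1) := by
    let g := f.compContinuous ⟨shift, continuous_shift⟩
    change ∫ σ, g σ ∂M.occupation x n = _
    rw [occupation, integral_smul_measure, integral_finsetSum_measure fun k _ => g.integrable _]
    simp only [smul_eq_mul, ENNReal.toReal_inv, ENNReal.toReal_natCast]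
    rw [Nat.cast_succ]
    congr 1
    refine Finset.sum_congr rfl fun k _ => ?_
    rw [integral_map (measurable_shiftBy_snd _).aemeasurable
      g.continuous.measurable.aestronglyMeasurable]
    refine integral_congr_ae (ae_of_all _ fun z => ?_)
    change f (shift (shiftBy _ z.2)) = f _
    rw [shift_shiftBy]
    congr 2
    push_cast
    ring
  have hbd : ∀ k, |u k| ≤ ‖f‖ := by
    intro k
    refine (abs_integral_le_integral_abs).trans ?_
    refine (integral_mono_of_nonneg (ae_of_all _ fun _ => abs_nonneg _) (integrable_const ‖f‖)
      (ae_of_all _ fun z => ?_)).trans_eq (by simp)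
    exact f.norm_coe_le_norm _
  have hpos : (0 : ℝ) < (n : ℝ) + 1 := by positivity
  rw [h1, h2, ← mul_sub, ← Finset.sum_sub_distrib, Finset.sum_range_sub u, abs_mul,
    abs_of_pos (inv_pos.2 hpos), mul_comm]
  gcongr
  exact (abs_sub _ _).trans (by linarith [hbd (n + 1), hbd 0])

/-- By compactness of the space of probability measures on the code space, the occupation
measures have a limit, and averaging makes it invariant. -/
lemma exists_isOccupationLimit [Countable E] (x : X) :
    ∃ φ Λ, M.IsOccupationLimit x φ Λ := by
  let L : ℕ → ProbabilityMeasure (CodeSpace E) := fun n => ⟨M.occupation x n, inferInstance⟩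
  obtain ⟨Λ, φ, hφ, hΛ⟩ := CompactSpace.tendsto_subseq L
  refine ⟨φ, Λ, inferInstance, hφ, ?_, fun G hG =>
    ProbabilityMeasure.le_liminf_measure_open_of_tendsto hΛ hG⟩
  have hprob : IsProbabilityMeasure ((Λ : Measure (CodeSpace E)).map shift) :=
    Measure.isProbabilityMeasure_map measurable_shift.aemeasurable
  refine ext_of_forall_integral_eq_of_IsFiniteMeasure fun f => ?_
  rw [integral_map measurable_shift.aemeasurable
    f.continuous.measurable.aestronglyMeasurable]
  have h1 := ProbabilityMeasure.tendsto_iff_forall_integral_tendsto.1 hΛ f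
  have h2 := ProbabilityMeasure.tendsto_iff_forall_integral_tendsto.1 hΛ
    (f.compContinuous ⟨shift, continuous_shift⟩)
  have h3 : Tendsto (fun n : ℕ => 2 * ‖f‖ * ((φ n : ℝ) + 1)⁻¹) atTop (𝓝 0) := by
    have h4 : Tendsto (fun n : ℕ => ((n : ℝ) + 1)⁻¹) atTop (𝓝 0) := by
      simpa using tendsto_one_div_add_atTop_nhds_zero_nat (𝕜 := ℝ)
    simpa using (h4.comp hφ.tendsto_atTop).const_mul (2 * ‖f‖)
  have h5 := squeeze_zero_norm (f := fun n =>
    ∫ σ, f (shift σ) ∂M.occupation x (φ n) - ∫ σ, f σ ∂M.occupation x (φ n))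
    (fun n => M.integral_shift_occupation_sub x (φ n) f) h3
  exact sub_eq_zero.1 (tendsto_nhds_unique (h2.sub h1) h5)

end MarkovSystem

/-! ### Limits of functions of finite windows -/

namespace CodeSpace

variable {E : Type*}

/-- A function on the code space that depends on the coordinates `-l, …, 0` only. -/
def WindowDetermined {Y : Type*} (l : ℕ) (g : CodeSpace E → Y) : Prop :=
  ∀ σ τ, (∀ k : ℕ, k ≤ l → σ (-(k : ℤ)) = τ (-(k : ℤ))) → g σ = g τ

lemma WindowDetermined.pastDetermined {Y : Type*} {l : ℕ} {g : CodeSpace E → Y}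
    (h : WindowDetermined l g) : PastDetermined g := fun σ τ hστ =>
  h σ τ fun _ _ => hστ _ (by omega)

lemma PastDetermined.indicator_one {s : Set (CodeSpace E)} (h : PastDetermined (· ∈ s)) :
    PastDetermined (s.indicator (1 : CodeSpace E → ℝ≥0∞)) := by
  intro σ τ hστ
  by_cases hσ : σ ∈ s
  · rw [indicator_of_mem hσ, indicator_of_mem ((h σ τ hστ).mp hσ)]
    rfl
  · rw [indicator_of_notMem hσ, indicator_of_notMem fun hτ => hσ ((h σ τ hστ).mpr hτ)]

/-- The sequences whose coordinates `-l, …, 0` are edges. -/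
def edgeWindow (l : ℕ) : Set (CodeSpace E) :=
  {σ | ∀ k : ℕ, k ≤ l → ∃ e, σ (-(k : ℤ)) = Alphabet.letter e}

/-- Edges are isolated letters, so that conditions on finitely many coordinates which are all
edges are open. -/
lemma isOpen_of_subset_edgeWindow {l : ℕ} {s : Set (CodeSpace E)} (h1 : s ⊆ edgeWindow l)
    (h2 : WindowDetermined l (· ∈ s)) : IsOpen s := by
  refine isOpen_iff_forall_mem_open.2 fun σ hσ => ?_
  refine ⟨⋂ k ∈ Finset.range (l + 1), (fun τ : CodeSpace E => τ (-(k : ℤ))) ⁻¹' {σ (-(k : ℤ))},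
    fun τ hτ => ?_, ?_, ?_⟩
  · simp only [Finset.mem_range, mem_iInter, mem_preimage, mem_singleton_iff] at hτ
    exact (h2 τ σ fun k hk => hτ k (by omega)).mpr hσ
  · refine isOpen_biInter_finset fun k hk => ?_
    obtain ⟨e, he⟩ := h1 hσ k (by simpa [Nat.lt_succ_iff] using hk)
    rw [he]
    exact (Alphabet.isOpen_singleton_letter e).preimage
      (continuous_apply (A := fun _ : ℤ => Alphabet E) _)
  · simp

end CodeSpace

namespace MarkovSystem

open CodeSpace

variable {X E : Type*} [MetricSpace X] [MeasurableSpace X] (M : MarkovSystem X E)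

lemma window_subset_edgeWindow (l : ℕ) : M.window l ⊆ edgeWindow l := fun _ hσ => hσ.1

lemma windowDetermined_mem_window (l : ℕ) : WindowDetermined l (· ∈ M.window l) := by
  intro σ τ h
  exact propext ⟨M.mem_window_congr h, M.mem_window_congr fun k hk => (h k hk).symm⟩

namespace IsOccupationLimit

variable {M} {x : X} {φ : ℕ → ℕ} {Λ : Measure (CodeSpace E)}

lemma ae_shiftBy (h : M.IsOccupationLimit x φ Λ) {P : CodeSpace E → Prop}
    (hP : ∀ᵐ σ ∂Λ, P σ) (m : ℤ) : ∀ᵐ σ ∂Λ, P (shiftBy m σ) := by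
  rw [← map_shiftBy h.map_shift m] at hP
  exact ae_of_ae_map (measurable_shiftBy m).aemeasurable hP

/-- Lower semicontinuity under weak convergence, for functions of finite windows supported on
sequences of edges. -/
lemma lintegral_le_liminf [Countable E] (h : M.IsOccupationLimit x φ Λ) {l : ℕ}
    {g : CodeSpace E → ℝ≥0} (hg : Measurable g) (hw : WindowDetermined l g)
    (hs : ∀ σ ∉ edgeWindow l, g σ = 0) :
    ∫⁻ σ, (g σ : ℝ≥0∞) ∂Λ ≤ atTop.liminf fun n => ∫⁻ σ, (g σ : ℝ≥0∞) ∂M.occupation x (φ n) := by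
  have hlayer : ∀ μ : Measure (CodeSpace E), ∫⁻ σ, (g σ : ℝ≥0∞) ∂μ =
      ∫⁻ t in Ioi (0 : ℝ), μ {σ | t < g σ} := by
    intro μ
    have := lintegral_eq_lintegral_meas_lt μ (f := fun σ => (g σ : ℝ))
      (ae_of_all _ fun σ => (g σ).2) hg.coe_nnreal_real.aemeasurable
    simpa using this
  have hopen : ∀ t ∈ Ioi (0 : ℝ), IsOpen {σ | t < g σ} := by
    intro t ht
    refine isOpen_of_subset_edgeWindow (l := l) (fun σ hσ => ?_) fun σ τ hστ => ?_
    · by_contra hn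
      have h0 : t < g σ := hσ
      rw [hs σ hn] at h0
      exact absurd ht (not_lt.2 h0.le)
    · simp only [mem_ofPred_eq, hw σ τ hστ]
  simp_rw [hlayer]
  refine (setLIntegral_mono' measurableSet_Ioi fun t ht => h.le_liminf _ (hopen t ht)).trans ?_
  exact lintegral_liminf_le fun n => Antitone.measurable fun s t hst =>
    measure_mono fun σ hσ => lt_of_le_of_lt (b := t) hst hσ

end IsOccupationLimit

/-! ### Tightness of the letters -/

/-- The tail of the dominating Markov chain is uniformly small on finitely many vertices. -/
lemma exists_finset_tsum_p_le (hdom : M.HasDominatingMarkovChain) (V : Finset M.N) {ε : ℝ≥0∞}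
    (hε : 0 < ε) : ∃ F : Finset E, ∀ j ∈ V, ∀ y ∈ M.vertex j,
      ∑' e, (M.p e y : ℝ≥0∞) * ((F : Set E)ᶜ.indicator 1 e) ≤ ε := by
  classical
  have hF : ∀ j, ∃ F : Finset {e : E // M.i e = j},
      ∑' e : {e // e ∉ F}, ⨆ y ∈ M.vertex j, (M.p (e : {e : E // M.i e = j}) y : ℝ≥0∞) < ε :=
    fun j => ((ENNReal.tendsto_tsum_compl_atTop_zero (hdom j).ne).eventually_lt_const hε).exists
  choose F hF using hF
  refine ⟨V.biUnion fun j => (F j).image Subtype.val, fun j hj y hy => ?_⟩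
  rw [M.tsum_p_mul_eq hy]
  refine le_trans ?_ (hF j).le
  refine le_trans ?_ (tsum_subtype {e | e ∉ F j} fun e : {e : E // M.i e = j} =>
    ⨆ y ∈ M.vertex j, (M.p e y : ℝ≥0∞)).ge
  refine ENNReal.tsum_le_tsum fun e => ?_
  by_cases he : e ∈ F j
  · rw [indicator_of_notMem, mul_zero]
    · exact zero_le
    · simp only [mem_compl_iff, not_not, Finset.mem_coe, Finset.mem_biUnion]
      exact ⟨j, hj, Finset.mem_image_of_mem _ he⟩
  · rw [indicator_of_mem (show e ∈ {e | e ∉ F j} from he)]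
    calc (M.p e y : ℝ≥0∞) * _ ≤ M.p e y * 1 := by
          gcongr
          exact indicator_le_self _ _ _
      _ ≤ _ := by
          rw [mul_one]
          exact le_iSup₂_of_le y hy le_rfl

/-- Recurrence and the dominating Markov chain keep the letters in a finite set of edges. -/
lemma exists_finset_occupation_le [Countable E] [BorelSpace X]
    (hdom : M.HasDominatingMarkovChain) {x : X}
    (hx : ∀ ε > (0 : ℝ≥0∞), ∃ V : Finset M.N, ∀ n ≥ 1,
      M.averagedVertexMeasure x n ((V : Set M.N)ᶜ) < ε) {ε : ℝ≥0∞} (hε : 0 < ε) :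
    ∃ F : Finset E, ∀ n : ℕ, M.occupation x n {σ | ∀ e ∈ F, σ 0 ≠ Alphabet.letter e} ≤
      ((n + 1 : ℕ) : ℝ≥0∞)⁻¹ + (ε + ε) := by
  have hNc := M.countable_vertices
  have hprob := fun k => M.isProbabilityMeasure_process (Measure.dirac x) k
  obtain ⟨V, hV⟩ := hx ε hε
  obtain ⟨F, hF⟩ := M.exists_finset_tsum_p_le hdom V hε
  refine ⟨F, fun n => ?_⟩
  set s : Set (CodeSpace E) := {σ | ∀ e ∈ F, σ 0 ≠ Alphabet.letter e} with hs
  have hsm : MeasurableSet s :=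
    measurable_pi_apply (X := fun _ : ℤ => Alphabet E) (0 : ℤ)
      (MeasurableSet.of_discrete (s := {a | ∀ e ∈ F, a ≠ Alphabet.letter e}))
  set W : Set X := ⋃ j ∈ (V : Set M.N)ᶜ, M.vertex j with hW
  have hWm : MeasurableSet W :=
    MeasurableSet.biUnion (to_countable _) fun j _ => M.measurableSet_vertex j
  set r : ℕ → ℝ≥0∞ := fun k => ∫⁻ z, s.indicator 1 z.2 ∂M.process (Measure.dirac x) (k + 1)
    with hr
  have hr1 : ∀ k, r k ≤ 1 := by
    intro k
    refine (lintegral_mono fun z : X × CodeSpace E =>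
      indicator_le_self s (1 : CodeSpace E → ℝ≥0∞) z.2).trans ?_
    simp
  have hpt : ∀ y, ∑' e, (M.p e y : ℝ≥0∞) * ((F : Set E)ᶜ.indicator 1 e) ≤
      W.indicator 1 y + ε := by
    intro y
    obtain ⟨j, hj⟩ := M.exists_mem_vertex y
    by_cases hjV : j ∈ V
    · exact (hF j hjV y hj).trans le_add_self
    · have hyW : y ∈ W := mem_biUnion (show j ∈ (V : Set M.N)ᶜ from hjV) hj
      rw [indicator_of_mem hyW]
      refine le_trans ?_ le_self_add
      refine le_trans (ENNReal.tsum_le_tsum fun e => ?_) (M.tsum_p y).le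
      exact mul_le_of_le_one_right' (indicator_le_self _ _ _)
  have hr2 : ∀ k, r (k + 1) ≤ (M.adjoint^[k + 1] (Measure.dirac x)) W + ε := by
    intro k
    rw [hr]
    beta_reduce
    rw [process_succ, M.lintegral_skewAdjoint _ (f := fun z => s.indicator 1 z.2)
      ((measurable_one.indicator hsm).comp measurable_snd)]
    have hle : ∀ z : X × CodeSpace E,
        ∑' e, (M.p e z.1 : ℝ≥0∞) * s.indicator 1 (M.skew e z).2 ≤ W.indicator 1 z.1 + ε := by
      intro z
      refine le_trans (ENNReal.tsum_le_tsum fun e => ?_) (hpt z.1)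
      gcongr
      by_cases he : e ∈ F
      · rw [indicator_of_notMem]
        · exact zero_le
        · exact fun h => h e he (push_zero e z.2)
      · rw [indicator_of_mem (show e ∈ (F : Set E)ᶜ from he)]
        exact indicator_le_self _ _ _
    refine (lintegral_mono hle).trans ?_
    rw [lintegral_add_right _ measurable_const, lintegral_const, measure_univ, mul_one,
      ← M.map_fst_process, ← lintegral_indicator_one hWm,
      lintegral_map (measurable_one.indicator hWm) measurable_fst]
  have hocc : M.occupation x n s =
      ((n + 1 : ℕ) : ℝ≥0∞)⁻¹ * ∑ k ∈ Finset.range (n + 1), r k := by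
    rw [← lintegral_indicator_one hsm, M.lintegral_occupation x n (measurable_one.indicator hsm)]
    refine PastDetermined.indicator_one fun σ τ hστ => ?_
    simp only [hs, mem_ofPred_eq, hστ 0 le_rfl]
  have hn0 : ((n + 1 : ℕ) : ℝ≥0∞) ≠ 0 := by simp
  have hsum : ∑ k ∈ Finset.range (n + 1), r k ≤ 1 +
      (∑ k ∈ Finset.Icc 1 (n + 1), (M.adjoint^[k] (Measure.dirac x)) W + (n + 1 : ℕ) * ε) := by
    rw [Finset.sum_range_succ', add_comm]
    refine add_le_add (hr1 0) ?_
    rw [← Finset.Ico_add_one_right_eq_Icc, Finset.sum_Ico_eq_sum_range]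
    calc ∑ k ∈ Finset.range n, r (k + 1)
        ≤ ∑ k ∈ Finset.range (n + 1), r (k + 1) :=
          Finset.sum_le_sum_of_subset (Finset.range_mono (by omega))
      _ ≤ ∑ k ∈ Finset.range (n + 1), ((M.adjoint^[k + 1] (Measure.dirac x)) W + ε) :=
          Finset.sum_le_sum fun k _ => hr2 k
      _ = _ := by
          rw [Finset.sum_add_distrib]
          simp only [Finset.sum_const, Finset.card_range, nsmul_eq_mul]
          congr 1
          exact Finset.sum_congr (by simp) fun k _ => by rw [add_comm]
  rw [hocc]
  calc ((n + 1 : ℕ) : ℝ≥0∞)⁻¹ * ∑ k ∈ Finset.range (n + 1), r k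
      ≤ ((n + 1 : ℕ) : ℝ≥0∞)⁻¹ * (1 + (∑ k ∈ Finset.Icc 1 (n + 1),
          (M.adjoint^[k] (Measure.dirac x)) W + (n + 1 : ℕ) * ε)) := by gcongr
    _ = ((n + 1 : ℕ) : ℝ≥0∞)⁻¹ + (M.averagedVertexMeasure x (n + 1) ((V : Set M.N)ᶜ) + ε) := by
        rw [averagedVertexMeasure_apply, mul_add, mul_one, mul_add, ← mul_assoc,
          ENNReal.inv_mul_cancel hn0 (ENNReal.natCast_ne_top _), one_mul]
    _ ≤ _ := by
        gcongr
        exact (hV (n + 1) (by omega)).le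

namespace IsOccupationLimit

variable {M} {x : X} {φ : ℕ → ℕ} {Λ : Measure (CodeSpace E)}

lemma tendsto_inv (h : M.IsOccupationLimit x φ Λ) :
    Tendsto (fun n => ((φ n + 1 : ℕ) : ℝ≥0∞)⁻¹) atTop (𝓝 0) :=
  ENNReal.tendsto_inv_nat_nhds_zero.comp
    ((tendsto_add_atTop_nat 1).comp h.strictMono.tendsto_atTop)

lemma ae_exists_letter [Countable E] [BorelSpace X] (h : M.IsOccupationLimit x φ Λ)
    (hdom : M.HasDominatingMarkovChain)
    (hx : ∀ ε > (0 : ℝ≥0∞), ∃ V : Finset M.N, ∀ n ≥ 1,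
      M.averagedVertexMeasure x n ((V : Set M.N)ᶜ) < ε) :
    ∀ᵐ σ ∂Λ, ∃ e, σ 0 = Alphabet.letter e := by
  rw [ae_iff]
  refine le_antisymm (ENNReal.le_of_forall_pos_le_add fun δ hδ _ => ?_) zero_le
  obtain ⟨F, hF⟩ := M.exists_finset_occupation_le hdom hx
    (ε := (δ : ℝ≥0∞) / 2) (ENNReal.half_pos (by exact_mod_cast hδ.ne'))
  have hopen : IsOpen {σ : CodeSpace E | ∀ e ∈ F, σ 0 ≠ Alphabet.letter e} := by
    have : {σ : CodeSpace E | ∀ e ∈ F, σ 0 ≠ Alphabet.letter e} =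
        (fun σ : CodeSpace E => σ 0) ⁻¹' (Alphabet.letter '' (F : Set E))ᶜ := by
      ext σ
      simp [eq_comm]
    rw [this]
    exact ((F.finite_toSet.image _).isClosed.isOpen_compl).preimage (continuous_apply 0)
  calc Λ {σ | ¬ ∃ e, σ 0 = Alphabet.letter e}
      ≤ Λ {σ | ∀ e ∈ F, σ 0 ≠ Alphabet.letter e} :=
        measure_mono fun σ hσ e _ he => hσ ⟨e, he⟩
    _ ≤ _ := h.le_liminf _ hopen
    _ ≤ atTop.liminf fun n => ((φ n + 1 : ℕ) : ℝ≥0∞)⁻¹ + δ := by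
        refine liminf_le_liminf (Eventually.of_forall fun n => (hF (φ n)).trans_eq ?_)
        rw [ENNReal.add_halves]
    _ = 0 + δ := (h.tendsto_inv.add_const _).liminf_eq

lemma ae_i'_eq_t' [Countable E] (h : M.IsOccupationLimit x φ Λ)
    (hlet : ∀ᵐ σ ∂Λ, ∃ e, σ 0 = Alphabet.letter e) :
    ∀ᵐ σ ∂Λ, M.i' (σ 0) = M.t' (σ (-1)) := by
  let bad : Set (CodeSpace E) := {σ | σ ∈ edgeWindow 1 ∧ M.i' (σ 0) ≠ M.t' (σ (-1))}
  have hdet : WindowDetermined 1 (· ∈ bad) := by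
    intro σ τ hστ
    have h0 := hστ 0 (by omega)
    have h1 := hστ 1 le_rfl
    simp only [Nat.cast_zero, neg_zero, Nat.cast_one] at h0 h1
    simp only [bad, edgeWindow, mem_ofPred_eq, h0, h1]
    congr 1
    refine propext (forall₂_congr fun k hk => ?_)
    rw [hστ k hk]
  have hopen : IsOpen bad := isOpen_of_subset_edgeWindow (fun σ hσ => hσ.1) hdet
  have hocc : ∀ n, M.occupation x n bad = 0 := by
    intro n
    rw [← lintegral_indicator_one hopen.measurableSet, M.lintegral_occupation x n
      (measurable_one.indicator hopen.measurableSet)]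
    · rw [Finset.sum_eq_zero, mul_zero]
      intro k _
      have : ∀ᵐ z ∂M.process (Measure.dirac x) (k + 1),
          z ∈ Prod.snd ⁻¹' (badᶜ : Set (CodeSpace E)) := by
        rw [process_succ]
        refine M.ae_skewAdjoint (measurable_snd hopen.measurableSet.compl) ?_
        filter_upwards [M.ae_process_mem_vertex (Measure.dirac x) k] with z hz e hp hbad
        obtain ⟨h1, h2⟩ := hbad
        have h3 := push_neg_succ e z.2 0
        simp only [Nat.cast_zero, neg_zero, zero_add] at h3
        have h4 : z.2 ∈ M.window 0 := by
          refine ⟨fun m hm => ?_, fun m hm => absurd hm (by omega)⟩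
          obtain rfl : m = 0 := by omega
          have := h1 1 le_rfl
          simp only [Nat.cast_one, skew, h3] at this
          simpa using this
        refine h2 ?_
        simp only [skew, push_zero, i'_letter, h3]
        exact M.eq_of_mem_vertex (M.mem_vertex_of_p_ne_zero hp) (hz h4)
      refine (lintegral_congr_ae ?_).trans lintegral_zero
      filter_upwards [this] with z hz
      exact indicator_of_notMem hz _
    · exact hdet.pastDetermined.indicator_one
  have hbad : Λ bad = 0 := by
    refine le_antisymm ((h.le_liminf _ hopen).trans ?_) zero_le
    simp [hocc]
  have hbad' : ∀ᵐ σ ∂Λ, σ ∉ bad := measure_eq_zero_iff_ae_notMem.1 hbad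
  filter_upwards [hbad', hlet, h.ae_shiftBy hlet (-1)] with σ h1 h2 h3
  by_contra h4
  refine h1 ⟨fun k hk => ?_, h4⟩
  interval_cases k
  · simpa using h2
  · simpa [shiftBy] using h3

/-- The limit is carried by the paths. -/
lemma ae_mem_pathSpace [Countable E] [BorelSpace X] (h : M.IsOccupationLimit x φ Λ)
    (hdom : M.HasDominatingMarkovChain)
    (hx : ∀ ε > (0 : ℝ≥0∞), ∃ V : Finset M.N, ∀ n ≥ 1,
      M.averagedVertexMeasure x n ((V : Set M.N)ᶜ) < ε) :
    ∀ᵐ σ ∂Λ, σ ∈ M.pathSpace := by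
  have h1 := h.ae_exists_letter hdom hx
  have h2 := h.ae_i'_eq_t' h1
  have h3 : ∀ᵐ σ ∂Λ, ∀ m : ℤ, ∃ e, shiftBy m σ 0 = Alphabet.letter e :=
    ae_all_iff.2 fun m => h.ae_shiftBy h1 m
  have h4 : ∀ᵐ σ ∂Λ, ∀ m : ℤ, M.i' (shiftBy m σ 0) = M.t' (shiftBy m σ (-1)) :=
    ae_all_iff.2 fun m => h.ae_shiftBy h2 m
  filter_upwards [h3, h4] with σ h5 h6 n
  refine ⟨by simpa [shiftBy] using h5 n, ?_⟩
  have := h6 (n + 1)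
  simp only [shiftBy, zero_add] at this
  rwa [show -1 + (n + 1) = n by ring] at this

/-! ### Convergence of the backward compositions -/

/-- A function of the history that is bounded in mean along the process has the same bound under
the limit. -/
lemma lintegral_le_of_process [Countable E] (h : M.IsOccupationLimit x φ Λ) {l : ℕ}
    {g : CodeSpace E → ℝ≥0} (hg : Measurable g) (hw : WindowDetermined l g)
    (hs : ∀ σ ∉ edgeWindow l, g σ = 0) {c : ℝ≥0∞}
    (hc : ∀ k, ∫⁻ z, (g z.2 : ℝ≥0∞) ∂M.process (Measure.dirac x) k ≤ c) :
    ∫⁻ σ, (g σ : ℝ≥0∞) ∂Λ ≤ c := by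
  refine (h.lintegral_le_liminf hg hw hs).trans ?_
  have : ∀ n, ∫⁻ σ, (g σ : ℝ≥0∞) ∂M.occupation x (φ n) ≤ c := by
    intro n
    rw [M.lintegral_occupation x (φ n) (g := fun σ => (g σ : ℝ≥0∞)) hg.coe_nnreal_ennreal
      fun σ τ hστ => congrArg _ (hw.pastDetermined σ τ hστ)]
    exact inv_mul_sum_le fun k => hc (k + 1)
  exact (liminf_le_liminf (Eventually.of_forall this)).trans_eq (by simp)

lemma ae_mem_convergenceSet [Countable E] [BorelSpace X] [CompleteSpace X]
    (h : M.IsOccupationLimit x φ Λ) {x₀ : M.N → X} {a : ℝ≥0∞} (ha1 : a < 1) {c : ℝ≥0∞}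
    (hc : c ≠ ∞)
    (hgap : ∀ l k, ∫⁻ z, M.gap x₀ l z ∂M.process (Measure.dirac x) k ≤ a ^ (l + 1) * c)
    (hpath : ∀ᵐ σ ∂Λ, σ ∈ M.pathSpace) : ∀ᵐ σ ∂Λ, σ ∈ M.convergenceSet x₀ := by
  let g : ℕ → CodeSpace E → ℝ≥0 := fun l =>
    (M.window (l + 1)).indicator fun σ => nndist (M.approx x₀ l σ) (M.approx x₀ (l + 1) σ)
  have hgm : ∀ l, Measurable (g l) := by
    intro l
    refine Measurable.indicator ?_ (M.measurableSet_window (l + 1))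
    simpa only [dist_nndist, Real.toNNReal_coe] using ((M.stronglyMeasurable_approx x₀ l).dist
      (M.stronglyMeasurable_approx x₀ (l + 1))).measurable.real_toNNReal
  have hgw : ∀ l, WindowDetermined (l + 1) (g l) := by
    intro l σ τ hστ
    have h1 := M.windowDetermined_mem_window (l + 1) σ τ hστ
    have h2 := M.approx_congr x₀ hστ
    have h3 := M.approx_congr x₀ (l := l) fun k hk => hστ k (by omega)
    simp only [g, indicator, h2, h3]
    congr 1
  have hgs : ∀ l, ∀ σ ∉ edgeWindow (l + 1), g l σ = 0 := fun l σ hσ =>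
    indicator_of_notMem (fun hw => hσ (M.window_subset_edgeWindow _ hw)) _
  have hgc : ∀ l k, ∫⁻ z, (g l z.2 : ℝ≥0∞) ∂M.process (Measure.dirac x) k ≤
      a ^ (l + 1) * c + a ^ (l + 2) * c := by
    intro l k
    refine le_trans ?_ (add_le_add (hgap l k) (hgap (l + 1) k))
    rw [← lintegral_add_left (M.measurable_gap x₀ l)]
    refine lintegral_mono_ae ?_
    filter_upwards [M.ae_process_mem_good (Measure.dirac x) l k,
      M.ae_process_mem_good (Measure.dirac x) (l + 1) k] with z h1 h2
    by_cases hz : z.2 ∈ M.window (l + 1)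
    · have h3 := h1 (M.window_mono (Nat.le_succ l) hz)
      simp only [g, gap, indicator_of_mem hz, indicator_of_mem h3, indicator_of_mem (h2 hz)]
      rw [← edist_nndist]
      exact edist_triangle_left _ _ _
    · simp [g, indicator_of_notMem hz]
  have hint : ∀ l, ∫⁻ σ, (g l σ : ℝ≥0∞) ∂Λ ≤ a ^ (l + 1) * c + a ^ (l + 2) * c := fun l =>
    h.lintegral_le_of_process (hgm l) (hgw l) (hgs l) (hgc l)
  have hsum : ∫⁻ σ, ∑' l, (g l σ : ℝ≥0∞) ∂Λ ≠ ∞ := by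
    rw [lintegral_tsum fun l => (hgm l).coe_nnreal_ennreal.aemeasurable]
    refine ne_top_of_le_ne_top ?_ (ENNReal.tsum_le_tsum hint)
    have hgeo : ∑' l : ℕ, a ^ l ≠ ∞ := by
      rw [ENNReal.tsum_geometric]
      exact ENNReal.inv_ne_top.2 (tsub_pos_of_lt ha1).ne'
    have hs : ∀ m : ℕ, ∑' l : ℕ, a ^ (l + m) * c ≠ ∞ := by
      intro m
      simp_rw [pow_add, mul_assoc]
      rw [ENNReal.tsum_mul_right]
      exact ENNReal.mul_ne_top hgeo
        (ENNReal.mul_ne_top (ENNReal.pow_ne_top (ha1.trans ENNReal.one_lt_top).ne) hc)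
    rw [ENNReal.tsum_add]
    exact ENNReal.add_ne_top.2 ⟨hs 1, hs 2⟩
  filter_upwards [hpath, ae_lt_top (Measurable.tsum fun l => (hgm l).coe_nnreal_ennreal) hsum]
    with σ h1 h2
  refine ⟨h1, cauchySeq_tendsto_of_complete
    (cauchySeq_of_edist_le_of_tsum_ne_top (fun l => (g l σ : ℝ≥0∞)) (fun l => ?_) h2.ne)⟩
  simp only [g, indicator_of_mem (M.pathSpace_subset_window (l + 1) h1), edist_nndist, le_refl]

end IsOccupationLimit

end MarkovSystem

/-! ### The conditional law of the next edge -/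

namespace CodeSpace

lemma measurableSet_next {E : Type*} (e : E) : MeasurableSet (next e) :=
  measurable_pi_apply (X := fun _ : ℤ => Alphabet E) 1
    (MeasurableSet.of_discrete (s := {Alphabet.letter e}))

end CodeSpace

namespace MarkovSystem

open CodeSpace

variable {X E : Type*} [MetricSpace X] [MeasurableSpace X] (M : MarkovSystem X E)

lemma tendsto_approx_codingMap {x₀ : M.N → X} {σ : CodeSpace E} (hσ : σ ∈ M.convergenceSet x₀) :
    Tendsto (fun n => M.approx x₀ n σ) atTop (𝓝 (M.codingMap x₀ σ)) := by
  rw [codingMap, dif_pos hσ]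
  exact hσ.2.choose_spec

/-- The conditional probability, prescribed for asymptotic states, that the next edge is `e`. -/
def transition (x₀ : M.N → X) (e : E) : CodeSpace E → ℝ≥0 :=
  (M.endsAt (M.i e)).indicator fun σ => M.pBar e (M.codingMap x₀ σ)

variable {M} in
lemma IsUniformlyContinuous.tendsto_pBar (h : M.IsUniformlyContinuous) (e : E) {y : X}
    (hy : y ∈ closure (M.vertex (M.i e))) :
    Tendsto (M.p e) (𝓝[M.vertex (M.i e)] y) (𝓝 (M.pBar e y)) := by
  rw [pBar, indicator_of_mem hy]
  have : (𝓝[M.vertex (M.i e)] y).NeBot := mem_closure_iff_nhdsWithin_neBot.1 hy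
  have hc : Cauchy (𝓝[M.vertex (M.i e)] y) := cauchy_nhds.mono inf_le_left
  exact tendsto_extendFrom (cauchy_map_iff_exists_tendsto.1 (hc.map_of_le (h e).2 inf_le_right))

lemma tendsto_p_approx {x₀ : M.N → X} (hx₀ : ∀ j, x₀ j ∈ M.vertex j)
    (hunif : M.IsUniformlyContinuous) (e : E) {σ : CodeSpace E}
    (hσ : σ ∈ M.convergenceSet x₀) :
    Tendsto (fun n => M.p e (M.approx x₀ n σ)) atTop (𝓝 (M.transition x₀ e σ)) := by
  have hmem : ∀ n, M.approx x₀ n σ ∈ M.vertex (M.t' (σ 0)) := fun n =>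
    M.approx_mem_vertex hx₀ (M.pathSpace_subset_window n hσ.1)
  have hlim := M.tendsto_approx_codingMap hσ
  by_cases ht : M.t' (σ 0) = M.i e
  · rw [transition, indicator_of_mem (show σ ∈ M.endsAt (M.i e) from ⟨hσ.1, ht⟩)]
    rw [ht] at hmem
    exact (hunif.tendsto_pBar e (mem_closure_of_tendsto hlim (Eventually.of_forall hmem))).comp
      (tendsto_nhdsWithin_iff.2 ⟨hlim, Eventually.of_forall hmem⟩)
  · rw [transition, indicator_of_notMem fun h => ht h.2]
    refine tendsto_const_nhds.congr fun n => (M.p_eq_zero e _ fun h => ht ?_).symm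
    exact M.eq_of_mem_vertex (hmem n) h

/-- Uniform continuity together with boundedness gives an affine modulus of continuity. -/
lemma exists_p_le {e : E} (hunif : UniformContinuousOn (M.p e) (M.vertex (M.i e))) {ε : ℝ≥0}
    (hε : 0 < ε) : ∃ K : ℝ≥0∞, K ≠ ∞ ∧ ∀ x ∈ M.vertex (M.i e), ∀ y ∈ M.vertex (M.i e),
      (M.p e x : ℝ≥0∞) ≤ M.p e y + ε + K * edist x y := by
  obtain ⟨δ, hδ, h⟩ := Metric.uniformContinuousOn_iff.1 hunif ε (by exact_mod_cast hε)
  refine ⟨ENNReal.ofReal δ⁻¹, ENNReal.ofReal_ne_top, fun x hx y hy => ?_⟩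
  by_cases hd : dist x y < δ
  · refine le_trans ?_ le_self_add
    have h1 := h x hx y hy hd
    rw [NNReal.dist_eq] at h1
    have h2 : (M.p e x : ℝ) ≤ M.p e y + ε := by linarith [(abs_lt.1 h1).2]
    exact_mod_cast h2
  · refine le_trans ?_ le_add_self
    refine (M.p_le_one e x).trans ?_
    rw [edist_dist, ← ENNReal.ofReal_mul (inv_pos.2 hδ).le, ← ENNReal.ofReal_one]
    refine ENNReal.ofReal_le_ofReal ?_
    rw [inv_mul_eq_div, one_le_div hδ]
    exact not_lt.1 hd

namespace IsOccupationLimit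

variable {M} {x : X} {φ : ℕ → ℕ} {Λ : Measure (CodeSpace E)}

/-- Weak convergence for bounded functions of finite windows, although these need not be
continuous at sequences containing the letter `∞`. -/
lemma tendsto_lintegral [Countable E] (h : M.IsOccupationLimit x φ Λ) {l : ℕ}
    (hΛ : ∀ᵐ σ ∂Λ, σ ∈ edgeWindow l) {g : CodeSpace E → ℝ≥0} (hg : Measurable g)
    (hw : WindowDetermined l g) (hs : ∀ σ ∉ edgeWindow l, g σ = 0) (h1 : ∀ σ, g σ ≤ 1) :
    Tendsto (fun n => ∫⁻ σ, (g σ : ℝ≥0∞) ∂M.occupation x (φ n)) atTop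
      (𝓝 (∫⁻ σ, (g σ : ℝ≥0∞) ∂Λ)) := by
  have hprob := h.isProbabilityMeasure
  refine tendsto_of_le_liminf_of_limsup_le (h.lintegral_le_liminf hg hw hs) ?_
  have hdet : WindowDetermined l (· ∈ (edgeWindow l : Set (CodeSpace E))) := by
    intro σ τ hστ
    exact propext (forall₂_congr fun k hk => by rw [hστ k hk])
  have hm : MeasurableSet (edgeWindow l : Set (CodeSpace E)) :=
    (isOpen_of_subset_edgeWindow Subset.rfl hdet).measurableSet
  let g' : CodeSpace E → ℝ≥0 := (edgeWindow l).indicator fun σ => 1 - g σ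
  have hg' : Measurable g' := (measurable_const.sub hg).indicator hm
  have hw' : WindowDetermined l g' := by
    intro σ τ hστ
    have h2 := hdet σ τ hστ
    by_cases hσ : σ ∈ edgeWindow l
    · simp only [g', indicator_of_mem hσ, indicator_of_mem (h2.mp hσ), hw σ τ hστ]
    · simp only [g', indicator_of_notMem hσ, indicator_of_notMem fun hτ => hσ (h2.mpr hτ)]
  have hlim := h.lintegral_le_liminf hg' hw' fun σ hσ => indicator_of_notMem hσ _
  have hle : ∀ n, ∫⁻ σ, (g' σ : ℝ≥0∞) ∂M.occupation x (φ n) ≤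
      1 - ∫⁻ σ, (g σ : ℝ≥0∞) ∂M.occupation x (φ n) := by
    intro n
    have hfin : ∫⁻ σ, (g σ : ℝ≥0∞) ∂M.occupation x (φ n) ≠ ∞ := by
      refine ne_top_of_le_ne_top ENNReal.one_ne_top
        ((lintegral_mono fun σ => (by exact_mod_cast h1 σ : (g σ : ℝ≥0∞) ≤ 1)).trans ?_)
      simp
    refine ENNReal.le_sub_of_add_le_right hfin ?_
    rw [← lintegral_add_left hg'.coe_nnreal_ennreal]
    refine (lintegral_mono (g := fun _ => 1) fun σ => ?_).trans (by simp)
    have : g' σ + g σ ≤ 1 := by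
      by_cases hσ : σ ∈ edgeWindow l
      · simp only [g', indicator_of_mem hσ]
        exact (tsub_add_cancel_of_le (h1 σ)).le
      · simp [g', indicator_of_notMem hσ, h1 σ]
    beta_reduce
    exact_mod_cast this
  have heq : ∫⁻ σ, (g' σ : ℝ≥0∞) ∂Λ + ∫⁻ σ, (g σ : ℝ≥0∞) ∂Λ = 1 := by
    rw [← lintegral_add_left hg'.coe_nnreal_ennreal]
    refine (lintegral_congr_ae (g := fun _ => (1 : ℝ≥0∞)) ?_).trans (by simp)
    filter_upwards [hΛ] with σ hσ
    have : g' σ + g σ = 1 := by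
      simp only [g', indicator_of_mem hσ]
      exact tsub_add_cancel_of_le (h1 σ)
    exact_mod_cast this
  have hsup : ∫⁻ σ, (g' σ : ℝ≥0∞) ∂Λ ≤
      1 - atTop.limsup fun n => ∫⁻ σ, (g σ : ℝ≥0∞) ∂M.occupation x (φ n) := by
    rw [← ENNReal.liminf_const_sub _ _ ENNReal.one_ne_top]
    exact hlim.trans (liminf_le_liminf (Eventually.of_forall hle))
  have hs1 : (atTop.limsup fun n => ∫⁻ σ, (g σ : ℝ≥0∞) ∂M.occupation x (φ n)) ≤ 1 := by
    refine (limsup_le_limsup (v := fun _ => (1 : ℝ≥0∞)) (Eventually.of_forall fun n => ?_)).trans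
      (by simp)
    refine (lintegral_mono fun σ => (by exact_mod_cast h1 σ : (g σ : ℝ≥0∞) ≤ 1)).trans ?_
    simp
  have hg'fin : ∫⁻ σ, (g' σ : ℝ≥0∞) ∂Λ ≠ ∞ :=
    ne_top_of_le_ne_top ENNReal.one_ne_top (heq ▸ le_self_add)
  refine (ENNReal.add_le_add_iff_left hg'fin).1 ?_
  rw [heq]
  exact (add_le_add_left hsup _).trans_eq (tsub_add_cancel_of_le hs1)

end IsOccupationLimit

/-- The sequences in `A`, advanced by one step along the edge `e`. -/
def pushedSet (e : E) (A : Set (CodeSpace E)) (l : ℕ) : Set (CodeSpace E) :=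
  {σ | σ ∈ M.window (l + 1) ∧ shiftBy (-1) σ ∈ A ∧ σ 0 = Alphabet.letter e}

lemma measurableSet_pushedSet [Countable E] (e : E) {A : Set (CodeSpace E)}
    (hA : MeasurableSet A) (l : ℕ) : MeasurableSet (M.pushedSet e A l) :=
  (M.measurableSet_window (l + 1)).inter (((measurable_shiftBy (-1)) hA).inter
    (measurable_pi_apply (X := fun _ : ℤ => Alphabet E) 0
      (MeasurableSet.of_discrete (s := {Alphabet.letter e}))))

lemma windowDetermined_mem_pushedSet (e : E) {A : Set (CodeSpace E)} {l : ℕ}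
    (hA : WindowDetermined l (· ∈ A)) : WindowDetermined (l + 1) (· ∈ M.pushedSet e A l) := by
  intro σ τ hστ
  have h1 := M.windowDetermined_mem_window (l + 1) σ τ hστ
  have h2 := hA (shiftBy (-1) σ) (shiftBy (-1) τ) fun k hk => by
    simp only [shiftBy]
    rw [show -(k : ℤ) + -1 = -((k + 1 : ℕ) : ℤ) by push_cast; ring]
    exact hστ (k + 1) (by omega)
  have h3 := hστ 0 (by omega)
  simp only [Nat.cast_zero, neg_zero] at h3
  beta_reduce at h1 h2
  simp only [pushedSet, mem_ofPred_eq, h1, h2, h3]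

lemma push_mem_pushedSet {e e' : E} {A : Set (CodeSpace E)} {l : ℕ}
    (hA : WindowDetermined l (· ∈ A)) {σ : CodeSpace E} :
    push e' σ ∈ M.pushedSet e A l ↔ (σ ∈ M.window l ∧ M.i e' = M.t' (σ 0)) ∧ σ ∈ A ∧ e' = e := by
  have h1 : shiftBy (-1) (push e' σ) ∈ A ↔ σ ∈ A := by
    refine iff_of_eq (hA _ _ fun k hk => ?_)
    simp only [shiftBy]
    rw [push_of_ne _ _ (by omega)]
    congr 1
    ring
  simp only [pushedSet, mem_ofPred_eq, M.push_mem_window_succ, h1, push_zero,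
    letter_injective.eq_iff]

/-- One step of the process: the next edge is chosen according to the current point. -/
lemma process_succ_pushedSet [Countable E] (ν : Measure X) (k : ℕ) (e : E)
    {A : Set (CodeSpace E)} (hAm : MeasurableSet A) {l : ℕ} (hA : WindowDetermined l (· ∈ A)) :
    ∫⁻ z, (M.pushedSet e A l).indicator 1 z.2 ∂M.process ν (k + 1) =
      ∫⁻ z, (A ∩ M.window l).indicator (fun _ => (M.p e z.1 : ℝ≥0∞)) z.2 ∂M.process ν k := by
  rw [process_succ, M.lintegral_skewAdjoint _ (f := fun z => (M.pushedSet e A l).indicator 1 z.2)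
    ((measurable_one.indicator (M.measurableSet_pushedSet e hAm l)).comp measurable_snd)]
  refine lintegral_congr_ae ?_
  filter_upwards [M.ae_process_mem_good ν l k] with z hz
  rw [tsum_eq_single e]
  · by_cases hp : M.p e z.1 = 0
    · simp [hp, indicator]
    · by_cases hzA : z.2 ∈ A ∩ M.window l
      · rw [indicator_of_mem hzA, indicator_of_mem]
        · simp
        · exact (M.push_mem_pushedSet hA).2 ⟨⟨hzA.2, M.eq_of_mem_vertex
            (M.mem_vertex_of_p_ne_zero hp) (hz hzA.2).2⟩, hzA.1, rfl⟩
      · rw [indicator_of_notMem hzA, indicator_of_notMem, mul_zero]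
        intro hmem
        obtain ⟨h1, h2⟩ := (M.push_mem_pushedSet hA).1 hmem
        exact hzA ⟨h2.1, h1.1⟩
  · intro e' he'
    rw [indicator_of_notMem, mul_zero]
    exact fun hmem => he' ((M.push_mem_pushedSet hA).1 hmem).2.2

/-- The approximate transition function, computed from the last `l + 1` edges. -/
def approxTransition (x₀ : M.N → X) (e : E) (A : Set (CodeSpace E)) (l : ℕ) : CodeSpace E → ℝ≥0 :=
  (A ∩ M.window l).indicator fun σ => M.p e (M.approx x₀ l σ)

lemma measurable_approxTransition [Countable E] [BorelSpace X] (x₀ : M.N → X) (e : E)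
    {A : Set (CodeSpace E)} (hA : MeasurableSet A) (l : ℕ) :
    Measurable (M.approxTransition x₀ e A l) :=
  ((M.measurable_p e).comp (M.measurable_approx x₀ l)).indicator
    (hA.inter (M.measurableSet_window l))

lemma windowDetermined_approxTransition (x₀ : M.N → X) (e : E) {A : Set (CodeSpace E)} {l : ℕ}
    (hA : WindowDetermined l (· ∈ A)) : WindowDetermined l (M.approxTransition x₀ e A l) := by
  intro σ τ hστ
  have h1 := hA σ τ hστ
  have h2 := M.windowDetermined_mem_window l σ τ hστ
  beta_reduce at h1 h2
  have h3 := M.approx_congr x₀ hστ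
  by_cases hσ : σ ∈ A ∩ M.window l
  · have hτ : τ ∈ A ∩ M.window l := ⟨h1.mp hσ.1, h2.mp hσ.2⟩
    rw [approxTransition, indicator_of_mem hσ, indicator_of_mem hτ, h3]
  · have hτ : τ ∉ A ∩ M.window l := fun hτ => hσ ⟨h1.mpr hτ.1, h2.mpr hτ.2⟩
    rw [approxTransition, indicator_of_notMem hσ, indicator_of_notMem hτ]

lemma p_le_one_nnreal (e : E) (x : X) : M.p e x ≤ 1 := by exact_mod_cast M.p_le_one e x

lemma approxTransition_le_one (x₀ : M.N → X) (e : E) (A : Set (CodeSpace E)) (l : ℕ)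
    (σ : CodeSpace E) : M.approxTransition x₀ e A l σ ≤ 1 :=
  indicator_apply_le' (fun _ => M.p_le_one_nnreal e _) fun _ => zero_le

/-- Along the process, the transition probability and its approximation from the history are close
to each other. -/
lemma lintegral_transition_approx_le [Countable E] [BorelSpace X] {x₀ : M.N → X}
    (hx₀ : ∀ j, x₀ j ∈ M.vertex j) {ν : Measure X} [IsProbabilityMeasure ν] {l k : ℕ}
    {c : ℝ≥0∞} (hgap : ∫⁻ z, M.gap x₀ l z ∂M.process ν k ≤ c) {e : E} {A : Set (CodeSpace E)}
    (hA : MeasurableSet A) {ε : ℝ≥0} {K : ℝ≥0∞} (hK : ∀ x ∈ M.vertex (M.i e),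
      ∀ y ∈ M.vertex (M.i e), (M.p e x : ℝ≥0∞) ≤ M.p e y + ε + K * edist x y) :
    ∫⁻ z, (A ∩ M.window l).indicator (fun _ => (M.p e z.1 : ℝ≥0∞)) z.2 ∂M.process ν k ≤
      ∫⁻ z, (M.approxTransition x₀ e A l z.2 : ℝ≥0∞) ∂M.process ν k + (ε + K * c) ∧
    ∫⁻ z, (M.approxTransition x₀ e A l z.2 : ℝ≥0∞) ∂M.process ν k ≤
      ∫⁻ z, (A ∩ M.window l).indicator (fun _ => (M.p e z.1 : ℝ≥0∞)) z.2 ∂M.process ν k +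
        (ε + K * c) := by
  have hprob := M.isProbabilityMeasure_process ν k
  have herr : ∫⁻ z, ((ε : ℝ≥0∞) + K * M.gap x₀ l z) ∂M.process ν k ≤ ε + K * c := by
    rw [lintegral_add_left measurable_const, lintegral_const, measure_univ, mul_one,
      lintegral_const_mul _ (M.measurable_gap x₀ l)]
    gcongr
  have hm1 : Measurable fun z : X × CodeSpace E => (M.approxTransition x₀ e A l z.2 : ℝ≥0∞) :=
    ((M.measurable_approxTransition x₀ e hA l).comp measurable_snd).coe_nnreal_ennreal
  have hm2 : Measurable fun z : X × CodeSpace E =>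
      (A ∩ M.window l).indicator (fun _ => (M.p e z.1 : ℝ≥0∞)) z.2 := by
    have := ((M.measurable_p_ennreal e).comp (measurable_fst (α := X) (β := CodeSpace E))).indicator
      (measurable_snd (hA.inter (M.measurableSet_window l)))
    exact this
  have hpt : ∀ᵐ z ∂M.process ν k,
      (A ∩ M.window l).indicator (fun _ => (M.p e z.1 : ℝ≥0∞)) z.2 ≤
        M.approxTransition x₀ e A l z.2 + (ε + K * M.gap x₀ l z) ∧
      (M.approxTransition x₀ e A l z.2 : ℝ≥0∞) ≤
        (A ∩ M.window l).indicator (fun _ => (M.p e z.1 : ℝ≥0∞)) z.2 +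
          (ε + K * M.gap x₀ l z) := by
    filter_upwards [M.ae_process_mem_good ν l k] with z hz
    by_cases hzA : z.2 ∈ A ∩ M.window l
    · have hg := hz hzA.2
      have hy := M.approx_mem_vertex hx₀ hzA.2
      rw [approxTransition, indicator_of_mem hzA, indicator_of_mem hzA, gap, indicator_of_mem hg]
      by_cases ht : M.t' (z.2 0) = M.i e
      · rw [ht] at hy
        have hx : z.1 ∈ M.vertex (M.i e) := ht ▸ hg.2
        rw [← add_assoc, ← add_assoc]
        refine ⟨hK _ hx _ hy, ?_⟩
        rw [edist_comm]
        exact hK _ hy _ hx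
      · rw [M.p_eq_zero e z.1 fun h => ht (M.eq_of_mem_vertex hg.2 h),
          M.p_eq_zero e _ fun h => ht (M.eq_of_mem_vertex hy h)]
        simp
    · rw [approxTransition, indicator_of_notMem hzA, indicator_of_notMem hzA]
      simp
  constructor
  · refine (lintegral_mono_ae (hpt.mono fun z h => h.1)).trans ?_
    rw [lintegral_add_left hm1]
    gcongr
  · refine (lintegral_mono_ae (hpt.mono fun z h => h.2)).trans ?_
    rw [lintegral_add_left hm2]
    gcongr

/-- The preceding comparison, averaged over time; the term `1 / (n + 1)` is a boundary term. -/
lemma occupation_pushedSet_le [Countable E] [BorelSpace X] {x₀ : M.N → X}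
    (hx₀ : ∀ j, x₀ j ∈ M.vertex j) {x : X} {l : ℕ} {c : ℝ≥0∞}
    (hgap : ∀ k, ∫⁻ z, M.gap x₀ l z ∂M.process (Measure.dirac x) k ≤ c) {e : E}
    {A : Set (CodeSpace E)} (hA : MeasurableSet A) (hAw : WindowDetermined l (· ∈ A))
    {ε : ℝ≥0} {K : ℝ≥0∞} (hK : ∀ x ∈ M.vertex (M.i e),
      ∀ y ∈ M.vertex (M.i e), (M.p e x : ℝ≥0∞) ≤ M.p e y + ε + K * edist x y) (n : ℕ) :
    M.occupation x n (M.pushedSet e A l) ≤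
      ∫⁻ σ, (M.approxTransition x₀ e A l σ : ℝ≥0∞) ∂M.occupation x n + (ε + K * c) ∧
    ∫⁻ σ, (M.approxTransition x₀ e A l σ : ℝ≥0∞) ∂M.occupation x n ≤
      M.occupation x n (M.pushedSet e A l) + (((n + 1 : ℕ) : ℝ≥0∞)⁻¹ + (ε + K * c)) := by
  have hprob := fun k => M.isProbabilityMeasure_process (Measure.dirac x) k
  set δ : ℝ≥0∞ := ε + K * c
  set N : ℝ≥0∞ := ((n + 1 : ℕ) : ℝ≥0∞) with hN
  have hN0 : N ≠ 0 := by simp [hN]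
  have hNtop : N ≠ ∞ := ENNReal.natCast_ne_top _
  have hBm := M.measurableSet_pushedSet e hA l
  let f : ℕ → ℝ≥0∞ := fun k =>
    ∫⁻ z, (A ∩ M.window l).indicator (fun _ => (M.p e z.1 : ℝ≥0∞)) z.2
      ∂M.process (Measure.dirac x) k
  let u : ℕ → ℝ≥0∞ := fun k =>
    ∫⁻ z, (M.approxTransition x₀ e A l z.2 : ℝ≥0∞) ∂M.process (Measure.dirac x) k
  have h1 : M.occupation x n (M.pushedSet e A l) = N⁻¹ * ∑ k ∈ Finset.range (n + 1), f k := by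
    rw [← lintegral_indicator_one hBm, M.lintegral_occupation x n (measurable_one.indicator hBm)
      (M.windowDetermined_mem_pushedSet e hAw).pastDetermined.indicator_one]
    congr 1
    exact Finset.sum_congr rfl fun k _ => M.process_succ_pushedSet _ k e hA hAw
  have h2 : ∫⁻ σ, (M.approxTransition x₀ e A l σ : ℝ≥0∞) ∂M.occupation x n =
      N⁻¹ * ∑ k ∈ Finset.range (n + 1), u (k + 1) :=
    M.lintegral_occupation x n (g := fun σ => (M.approxTransition x₀ e A l σ : ℝ≥0∞))
      (M.measurable_approxTransition x₀ e hA l).coe_nnreal_ennreal fun σ τ hστ =>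
        congrArg _ ((M.windowDetermined_approxTransition x₀ e hAw).pastDetermined σ τ hστ)
  have hfu : ∀ k, f k ≤ u k + δ ∧ u k ≤ f k + δ := fun k =>
    M.lintegral_transition_approx_le hx₀ (hgap k) hA hK
  have hf1 : ∀ k, f k ≤ 1 := by
    intro k
    refine (lintegral_mono (g := fun _ => 1) fun z => ?_).trans (by simp)
    exact indicator_apply_le' (fun _ => M.p_le_one e _) fun _ => zero_le
  have hf0 : f 0 = 0 := by
    change ∫⁻ z, _ ∂M.process (Measure.dirac x) 0 = 0
    have : ∀ᵐ z ∂M.process (Measure.dirac x) 0, z.2 ∈ ((M.window l)ᶜ : Set _) := by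
      rw [process, Function.iterate_zero, id, ae_map_iff measurable_start.aemeasurable
        (measurable_snd (α := X) (M.measurableSet_window l).compl)]
      exact ae_of_all _ fun y => M.infty_notMem_window l
    refine (lintegral_congr_ae ?_).trans lintegral_zero
    filter_upwards [this] with z hz
    exact indicator_of_notMem (fun h => hz h.2) _
  have hsum : ∀ g : ℕ → ℝ≥0∞, N⁻¹ * ∑ k ∈ Finset.range (n + 1), (g k + δ) =
      N⁻¹ * ∑ k ∈ Finset.range (n + 1), g k + δ := by
    intro g
    rw [Finset.sum_add_distrib, Finset.sum_const, Finset.card_range, nsmul_eq_mul, mul_add,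
      ← mul_assoc, ENNReal.inv_mul_cancel hN0 hNtop, one_mul]
  have hshift1 : ∑ k ∈ Finset.range (n + 1), f k ≤ ∑ k ∈ Finset.range (n + 1), f (k + 1) := by
    rw [Finset.sum_range_succ', hf0, add_zero]
    exact Finset.sum_le_sum_of_subset (Finset.range_mono (by omega))
  have hshift2 : ∑ k ∈ Finset.range (n + 1), f (k + 1) ≤ ∑ k ∈ Finset.range (n + 1), f k + 1 := by
    calc ∑ k ∈ Finset.range (n + 1), f (k + 1) ≤ ∑ k ∈ Finset.range (n + 2), f k := by
          rw [Finset.sum_range_succ' f]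
          exact le_self_add
      _ ≤ _ := by
          rw [Finset.sum_range_succ f]
          gcongr
          exact hf1 _
  rw [h1, h2]
  constructor
  · rw [← hsum fun k => u (k + 1)]
    gcongr N⁻¹ * ?_
    exact hshift1.trans (Finset.sum_le_sum fun k _ => (hfu (k + 1)).1)
  · calc N⁻¹ * ∑ k ∈ Finset.range (n + 1), u (k + 1)
        ≤ N⁻¹ * ∑ k ∈ Finset.range (n + 1), (f (k + 1) + δ) := by
          gcongr with k _
          exact (hfu (k + 1)).2
      _ = N⁻¹ * ∑ k ∈ Finset.range (n + 1), f (k + 1) + δ := hsum _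
      _ ≤ N⁻¹ * (∑ k ∈ Finset.range (n + 1), f k + 1) + δ := by gcongr
      _ = _ := by rw [mul_add, mul_one, add_assoc]

namespace IsOccupationLimit

variable {M} {x : X} {φ : ℕ → ℕ} {Λ : Measure (CodeSpace E)}

/-- The conditional law of the next edge, tested on a set of pasts given by a finite window. -/
lemma measure_inter_next [Countable E] [BorelSpace X] (h : M.IsOccupationLimit x φ Λ)
    {x₀ : M.N → X} (hx₀ : ∀ j, x₀ j ∈ M.vertex j) (hunif : M.IsUniformlyContinuous)
    {a : ℝ≥0∞} (ha1 : a < 1) {c : ℝ≥0∞} (hc : c ≠ ∞)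
    (hgap : ∀ l k, ∫⁻ z, M.gap x₀ l z ∂M.process (Measure.dirac x) k ≤ a ^ (l + 1) * c)
    (hconv : ∀ᵐ σ ∂Λ, σ ∈ M.convergenceSet x₀) (e : E) {A : Set (CodeSpace E)}
    (hA : MeasurableSet A) {m : ℕ} (hAw : ∀ l ≥ m, WindowDetermined l (· ∈ A)) :
    Λ (A ∩ next e) = ∫⁻ σ in A, (M.transition x₀ e σ : ℝ≥0∞) ∂Λ := by
  have hprob := h.isProbabilityMeasure
  have hpath : ∀ᵐ σ ∂Λ, σ ∈ M.pathSpace := hconv.mono fun σ hσ => hσ.1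
  have hwin : ∀ l, ∀ᵐ σ ∂Λ, σ ∈ M.window l := fun l =>
    hpath.mono fun σ hσ => M.pathSpace_subset_window l hσ
  have hedge : ∀ l, ∀ᵐ σ ∂Λ, σ ∈ (edgeWindow l : Set (CodeSpace E)) := fun l =>
    (hwin l).mono fun σ hσ => M.window_subset_edgeWindow l hσ
  let u := M.approxTransition x₀ e A
  have hum : ∀ l, Measurable (u l) := fun l => M.measurable_approxTransition x₀ e hA l
  have hB : ∀ l, Λ (M.pushedSet e A l) = Λ (A ∩ next e) := by
    intro l
    conv_rhs => rw [← map_shiftBy h.map_shift (-1)]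
    rw [Measure.map_apply (measurable_shiftBy _) (hA.inter (measurableSet_next e))]
    refine measure_congr ?_
    filter_upwards [hwin (l + 1)] with σ hσ
    refine propext ?_
    change (σ ∈ M.window (l + 1) ∧ shiftBy (-1) σ ∈ A ∧ σ 0 = Alphabet.letter e) ↔
      (shiftBy (-1) σ ∈ A ∧ σ (1 + -1) = Alphabet.letter e)
    rw [add_neg_cancel]
    exact and_iff_right hσ
  have hlim : Tendsto (fun l => ∫⁻ σ, (u l σ : ℝ≥0∞) ∂Λ) atTop
      (𝓝 (∫⁻ σ in A, (M.transition x₀ e σ : ℝ≥0∞) ∂Λ)) := by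
    rw [← lintegral_indicator hA]
    refine tendsto_lintegral_of_dominated_convergence (fun _ => 1)
      (fun l => (hum l).coe_nnreal_ennreal)
      (fun l => ae_of_all _ fun σ =>
        ENNReal.coe_le_one_iff.2 (M.approxTransition_le_one x₀ e A l σ))
      (by simp) ?_
    filter_upwards [hconv] with σ hσ
    by_cases hσA : σ ∈ A
    · rw [indicator_of_mem hσA]
      refine (ENNReal.tendsto_coe.2 (M.tendsto_p_approx hx₀ hunif e hσ)).congr fun l => ?_
      simp only [u, approxTransition]
      rw [indicator_of_mem (show σ ∈ A ∩ M.window l from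
        ⟨hσA, M.pathSpace_subset_window l hσ.1⟩)]
    · rw [indicator_of_notMem hσA]
      refine tendsto_const_nhds.congr fun l => ?_
      simp only [u, approxTransition]
      rw [indicator_of_notMem (show σ ∉ A ∩ M.window l from fun h => hσA h.1), ENNReal.coe_zero]
  -- For fixed `l` the comparison along the process passes to the limit in `n`, where the boundary
  -- term vanishes; then `l` tends to infinity.
  have hkey : ∀ ε : ℝ≥0, 0 < ε →
      Λ (A ∩ next e) ≤ ∫⁻ σ in A, (M.transition x₀ e σ : ℝ≥0∞) ∂Λ + ε ∧
      ∫⁻ σ in A, (M.transition x₀ e σ : ℝ≥0∞) ∂Λ ≤ Λ (A ∩ next e) + ε := by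
    intro ε hε
    obtain ⟨K, hK, hmod⟩ := M.exists_p_le (hunif e).2 hε
    have hδ : Tendsto (fun l : ℕ => (ε : ℝ≥0∞) + K * (a ^ (l + 1) * c)) atTop (𝓝 ε) := by
      have h1 : Tendsto (fun l : ℕ => a ^ (l + 1) * c) atTop (𝓝 0) := by
        simpa using ENNReal.Tendsto.mul_const ((tendsto_add_atTop_iff_nat 1).2
          (ENNReal.tendsto_pow_atTop_nhds_zero_of_lt_one ha1)) (Or.inr hc)
      simpa using (ENNReal.Tendsto.const_mul h1 (Or.inr hK)).const_add (ε : ℝ≥0∞)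
    have hl : ∀ l ≥ m,
        Λ (A ∩ next e) ≤ ∫⁻ σ, (u l σ : ℝ≥0∞) ∂Λ + (ε + K * (a ^ (l + 1) * c)) ∧
        ∫⁻ σ, (u l σ : ℝ≥0∞) ∂Λ ≤ Λ (A ∩ next e) + (ε + K * (a ^ (l + 1) * c)) := by
      intro l hlm
      have hAl := hAw l hlm
      have hBm := M.measurableSet_pushedSet e hA l
      have hdet := M.windowDetermined_mem_pushedSet e hAl
      have ht1 := h.tendsto_lintegral (hedge l) (hum l)
        (M.windowDetermined_approxTransition x₀ e hAl)
        (fun σ hσ => indicator_of_notMem (fun h => hσ (M.window_subset_edgeWindow l h.2)) _)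
        (M.approxTransition_le_one x₀ e A l)
      have ht2 : Tendsto (fun n => M.occupation x (φ n) (M.pushedSet e A l)) atTop
          (𝓝 (Λ (A ∩ next e))) := by
        have h2 := h.tendsto_lintegral (l := l + 1) (g := (M.pushedSet e A l).indicator 1)
          (hedge (l + 1)) (measurable_one.indicator hBm)
          (fun σ τ hστ => by
            have h3 := hdet σ τ hστ
            by_cases hσ : σ ∈ M.pushedSet e A l
            · rw [indicator_of_mem hσ, indicator_of_mem (h3.mp hσ)]
              rfl
            · rw [indicator_of_notMem hσ, indicator_of_notMem fun hτ => hσ (h3.mpr hτ)])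
          (fun σ hσ => indicator_of_notMem
            (fun h => hσ (M.window_subset_edgeWindow (l + 1) h.1)) _)
          (fun σ => indicator_le_self _ _ σ)
        have h4 : ∀ μ : Measure (CodeSpace E), ∫⁻ σ, (((M.pushedSet e A l).indicator
            (1 : CodeSpace E → ℝ≥0) σ : ℝ≥0) : ℝ≥0∞) ∂μ = μ (M.pushedSet e A l) := by
          intro μ
          rw [← lintegral_indicator_one hBm]
          refine lintegral_congr fun σ => ?_
          by_cases hσ : σ ∈ M.pushedSet e A l <;> simp [hσ]
        simpa only [h4, hB] using h2
      have hle := fun n => M.occupation_pushedSet_le hx₀ (hgap l) hA hAl hmod (φ n)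
      refine ⟨le_of_tendsto_of_tendsto' ht2 (ht1.add_const _) fun n => (hle n).1, ?_⟩
      have ht3 := ht2.add (h.tendsto_inv.add_const ((ε : ℝ≥0∞) + K * (a ^ (l + 1) * c)))
      rw [zero_add] at ht3
      exact le_of_tendsto_of_tendsto' ht1 ht3 fun n => (hle n).2
    constructor
    · refine ge_of_tendsto (hlim.add hδ) ?_
      filter_upwards [eventually_ge_atTop m] with l hlm using (hl l hlm).1
    · refine le_of_tendsto_of_tendsto hlim (hδ.const_add _) ?_
      filter_upwards [eventually_ge_atTop m] with l hlm using (hl l hlm).2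
  exact le_antisymm (ENNReal.le_of_forall_pos_le_add fun ε hε _ => (hkey ε hε).1)
    (ENNReal.le_of_forall_pos_le_add fun ε hε _ => (hkey ε hε).2)

end IsOccupationLimit

end MarkovSystem

/-! ### The `σ`-algebra of the past -/

namespace CodeSpace

variable {E : Type*}

lemma isPiSystem_cylinder :
    IsPiSystem {A : Set (CodeSpace E) | ∃ m ≤ (0 : ℤ), ∃ e, A = cylinder m 0 e} := by
  rintro _ ⟨m, hm, e, rfl⟩ _ ⟨m', hm', e', rfl⟩ ⟨σ, hσ, hσ'⟩
  refine ⟨min m m', by omega, σ, ?_⟩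
  ext τ
  constructor
  · rintro ⟨h1, h2⟩ k hk hk0
    rcases min_le_iff.1 hk with h | h
    · rw [h1 k h hk0, hσ k h hk0]
    · rw [h2 k h hk0, hσ' k h hk0]
  · intro h
    refine ⟨fun k hk hk0 => ?_, fun k hk hk0 => ?_⟩
    · rw [h k (by omega) hk0, hσ k hk hk0]
    · rw [h k (by omega) hk0, hσ' k hk hk0]

lemma measurable_past_apply [Countable E] {n : ℤ} (hn : n ≤ 0) :
    Measurable[past E] fun σ : CodeSpace E => σ n := by
  refine @measurable_to_countable' _ _ _ _ (past E) _ fun a => ?_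
  have : (fun σ : CodeSpace E => σ n) ⁻¹' {a} =
      ⋃ f ∈ {f : Finset.Icc n 0 → Alphabet E | f ⟨n, by simp [hn]⟩ = a},
        cylinder n 0 fun k => if h : k ∈ Finset.Icc n 0 then f ⟨k, h⟩ else a := by
    ext σ
    simp only [mem_preimage, mem_singleton_iff, mem_iUnion, exists_prop, mem_ofPred_eq]
    constructor
    · intro h
      refine ⟨fun k => σ k, h, fun k hk hk0 => ?_⟩
      beta_reduce
      rw [dif_pos (Finset.mem_Icc.2 ⟨hk, hk0⟩)]
    · rintro ⟨f, hf, h⟩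
      rw [h n le_rfl hn]
      beta_reduce
      rw [dif_pos (Finset.mem_Icc.2 ⟨le_rfl, hn⟩), hf]
  rw [this]
  refine MeasurableSet.biUnion (to_countable _) fun f _ => ?_
  exact MeasurableSpace.measurableSet_generateFrom ⟨n, hn, _, rfl⟩

/-- Measurable functions of the coordinates `≤ 0` are measurable with respect to the past. -/
lemma PastDetermined.measurable [Countable E] {Y : Type*} [MeasurableSpace Y]
    {f : CodeSpace E → Y} (hf : PastDetermined f) (hm : Measurable f) : Measurable[past E] f := by
  let trunc : CodeSpace E → CodeSpace E := fun σ n => if n ≤ 0 then σ n else σ 0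
  have ht : Measurable[past E] trunc := by
    refine @measurable_pi_lambda _ _ _ (past E) _ _ fun n => ?_
    by_cases hn : n ≤ 0
    · simpa only [trunc, hn, if_true] using measurable_past_apply hn
    · simpa only [trunc, hn, if_false] using measurable_past_apply le_rfl
  have : f = f ∘ trunc := by
    funext σ
    exact hf _ _ fun n hn => (if_pos hn).symm
  rw [this]
  exact hm.comp ht

lemma measurableSet_cylinder [Countable E] {m : ℤ} (hm : m ≤ 0) (e : ℤ → Alphabet E) :
    MeasurableSet (cylinder m 0 e) :=
  past_le _ (MeasurableSpace.measurableSet_generateFrom ⟨m, hm, e, rfl⟩)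

lemma windowDetermined_mem_cylinder {m : ℤ} {l : ℕ} (hl : -(l : ℤ) ≤ m) (e : ℤ → Alphabet E) :
    WindowDetermined l (· ∈ cylinder m 0 e) := by
  intro σ τ h
  refine propext (forall₃_congr fun k hk hk0 => ?_)
  obtain ⟨r, rfl⟩ : ∃ r : ℕ, k = -(r : ℤ) := ⟨k.natAbs, by omega⟩
  rw [h r (by omega)]

end CodeSpace

namespace MarkovSystem

open CodeSpace

variable {X E : Type*} [MetricSpace X] [MeasurableSpace X] (M : MarkovSystem X E)

lemma coe_transition (x₀ : M.N → X) (e : E) :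
    (M.endsAt (M.i e)).indicator (fun σ => (M.pBar e (M.codingMap x₀ σ) : ℝ)) =
      fun σ => (M.transition x₀ e σ : ℝ) := by
  funext σ
  by_cases h : σ ∈ M.endsAt (M.i e)
  · simp [transition, h]
  · simp [transition, h]

lemma transition_le_one {x₀ : M.N → X} (hx₀ : ∀ j, x₀ j ∈ M.vertex j)
    (hunif : M.IsUniformlyContinuous) (e : E) {σ : CodeSpace E}
    (hσ : σ ∈ M.convergenceSet x₀) : M.transition x₀ e σ ≤ 1 :=
  le_of_tendsto' (M.tendsto_p_approx hx₀ hunif e hσ) fun _ => M.p_le_one_nnreal e _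

lemma aestronglyMeasurable_transition [Countable E] [BorelSpace X] {x₀ : M.N → X}
    (hx₀ : ∀ j, x₀ j ∈ M.vertex j) (hunif : M.IsUniformlyContinuous)
    {Λ : Measure (CodeSpace E)} (hconv : ∀ᵐ σ ∂Λ, σ ∈ M.convergenceSet x₀) (e : E) :
    AEStronglyMeasurable[past E] (fun σ => (M.transition x₀ e σ : ℝ)) Λ := by
  let f : CodeSpace E → ℝ := fun σ =>
    (limsup (fun n => (M.p e (M.approx x₀ n σ) : ℝ≥0∞)) atTop).toReal
  have hd : PastDetermined f := fun σ τ h => by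
    have h1 : ∀ n, M.approx x₀ n σ = M.approx x₀ n τ := fun n =>
      M.approx_congr x₀ fun k _ => h _ (by omega)
    simp only [f, h1]
  have hm : Measurable f := (Measurable.limsup fun n =>
    (M.measurable_p_ennreal e).comp (M.measurable_approx x₀ n)).ennreal_toReal
  refine ⟨f, (hd.measurable hm).stronglyMeasurable, ?_⟩
  filter_upwards [hconv] with σ hσ
  simp only [f]
  rw [(ENNReal.tendsto_coe.2 (M.tendsto_p_approx hx₀ hunif e hσ)).limsup_eq, ENNReal.coe_toReal]

lemma integrable_transition [Countable E] [BorelSpace X] {x₀ : M.N → X}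
    (hx₀ : ∀ j, x₀ j ∈ M.vertex j) (hunif : M.IsUniformlyContinuous)
    {Λ : Measure (CodeSpace E)} [IsProbabilityMeasure Λ]
    (hconv : ∀ᵐ σ ∂Λ, σ ∈ M.convergenceSet x₀) (e : E) :
    Integrable (fun σ => (M.transition x₀ e σ : ℝ)) Λ := by
  refine Integrable.of_bound ((M.aestronglyMeasurable_transition hx₀ hunif hconv e).mono past_le)
    1 ?_
  filter_upwards [hconv] with σ hσ
  simpa using M.transition_le_one hx₀ hunif e hσ

lemma setIntegral_transition [Countable E] [BorelSpace X] {x₀ : M.N → X}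
    (hx₀ : ∀ j, x₀ j ∈ M.vertex j) (hunif : M.IsUniformlyContinuous)
    {Λ : Measure (CodeSpace E)} [IsProbabilityMeasure Λ]
    (hconv : ∀ᵐ σ ∂Λ, σ ∈ M.convergenceSet x₀) (e : E) (s : Set (CodeSpace E)) :
    ENNReal.ofReal (∫ σ in s, (M.transition x₀ e σ : ℝ) ∂Λ) =
      ∫⁻ σ in s, (M.transition x₀ e σ : ℝ≥0∞) ∂Λ := by
  rw [ofReal_integral_eq_lintegral_ofReal
    (M.integrable_transition hx₀ hunif hconv e).integrableOn
    (ae_of_all _ fun σ => NNReal.coe_nonneg _)]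
  simp

/-- The conditional law of the next edge is determined by its values on cylinder sets. -/
lemma mem_asymptoticStates [Countable E] [CompleteSpace X] [BorelSpace X] {x₀ : M.N → X}
    (hx₀ : ∀ j, x₀ j ∈ M.vertex j) (hunif : M.IsUniformlyContinuous)
    {Λ : Measure (CodeSpace E)} [IsProbabilityMeasure Λ] (hshift : Λ.map shift = Λ)
    (hconv : ∀ᵐ σ ∂Λ, σ ∈ M.convergenceSet x₀)
    (hcyl : ∀ e, ∀ m ≤ (0 : ℤ), ∀ w, Λ (cylinder m 0 w ∩ next e) =
      ∫⁻ σ in cylinder m 0 w, (M.transition x₀ e σ : ℝ≥0∞) ∂Λ) :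
    Λ ∈ M.asymptoticStates x₀ := by
  refine ⟨⟨inferInstance, hshift⟩,
    (prob_compl_eq_zero_iff (M.measurableSet_convergenceSet x₀)).1 hconv, fun e => ?_⟩
  have hq := M.aestronglyMeasurable_transition hx₀ hunif hconv e
  have hint := M.integrable_transition hx₀ hunif hconv e
  have hlint : ∫⁻ σ, (M.transition x₀ e σ : ℝ≥0∞) ∂Λ ≠ ∞ := by
    have := M.setIntegral_transition hx₀ hunif hconv e univ
    rw [Measure.restrict_univ] at this
    rw [← this]
    exact ENNReal.ofReal_ne_top
  have hfin : IsFiniteMeasure (Λ.withDensity fun σ => (M.transition x₀ e σ : ℝ≥0∞)) :=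
    isFiniteMeasure_withDensity hlint
  -- Two finite measures on the past which agree on cylinder sets.
  have htrim : (Λ.restrict (next e)).trim past_le =
      (Λ.withDensity fun σ => (M.transition x₀ e σ : ℝ≥0∞)).trim past_le := by
    refine @Measure.ext_of_generateFrom_of_cover_subset _ (past E) _ _ _
      (range fun a : Alphabet E => cylinder 0 0 fun _ => a) rfl isPiSystem_cylinder ?_
      (countable_range _) ?_ ?_ ?_
    · rintro _ ⟨a, rfl⟩
      exact ⟨0, le_rfl, _, rfl⟩
    · refine eq_univ_of_forall fun σ => mem_sUnion.2 ⟨_, ⟨σ 0, rfl⟩, fun k h1 h2 => ?_⟩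
      rw [le_antisymm h2 h1]
    · intro s _
      exact measure_ne_top _ _
    · rintro _ ⟨m, hm, w, rfl⟩
      have hms : MeasurableSet[past E] (cylinder m 0 w) :=
        MeasurableSpace.measurableSet_generateFrom ⟨m, hm, w, rfl⟩
      rw [trim_measurableSet_eq _ hms, trim_measurableSet_eq _ hms,
        Measure.restrict_apply (past_le _ hms), withDensity_apply _ (past_le _ hms)]
      exact hcyl e m hm w
  rw [coe_transition]
  refine (ae_eq_condExp_of_forall_setIntegral_eq past_le
    ((integrable_const 1).indicator (measurableSet_next e)) (fun s _ _ => hint.integrableOn)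
    (fun s hs _ => ?_) hq).symm
  have hs' := past_le _ hs
  have h1 : Λ (s ∩ next e) = ∫⁻ σ in s, (M.transition x₀ e σ : ℝ≥0∞) ∂Λ := by
    have := congrArg (fun ν => ν s) htrim
    beta_reduce at this
    rwa [trim_measurableSet_eq _ hs, trim_measurableSet_eq _ hs, Measure.restrict_apply hs',
      withDensity_apply _ hs'] at this
  rw [integral_indicator_const _ (measurableSet_next e), smul_eq_mul, mul_one,
    measureReal_restrict_apply (measurableSet_next e), inter_comm, measureReal_def, h1,
    ← M.setIntegral_transition hx₀ hunif hconv e s, ENNReal.toReal_ofReal]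
  exact integral_nonneg fun σ => NNReal.coe_nonneg _

/-- For an asymptotic state, the law of the next edge given an event of the past. -/
lemma measure_inter_next_of_mem_asymptoticStates [Countable E] [BorelSpace X] {x₀ : M.N → X}
    (hx₀ : ∀ j, x₀ j ∈ M.vertex j) (hunif : M.IsUniformlyContinuous)
    {Λ : Measure (CodeSpace E)} (hΛ : Λ ∈ M.asymptoticStates x₀)
    (hconv : ∀ᵐ σ ∂Λ, σ ∈ M.convergenceSet x₀) (e : E) {s : Set (CodeSpace E)}
    (hs : MeasurableSet[past E] s) :
    Λ (s ∩ next e) = ∫⁻ σ in s, (M.transition x₀ e σ : ℝ≥0∞) ∂Λ := by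
  have hprob := hΛ.1.1
  have h1 := hΛ.2.2 e
  rw [coe_transition] at h1
  have h2 := setIntegral_condExp (μ := Λ) past_le
    ((integrable_const (1 : ℝ)).indicator (measurableSet_next e)) hs
  rw [setIntegral_congr_ae (past_le _ hs) (h1.mono fun σ h _ => h),
    integral_indicator_const _ (measurableSet_next e), smul_eq_mul, mul_one,
    measureReal_restrict_apply (measurableSet_next e), inter_comm, measureReal_def] at h2
  rw [← M.setIntegral_transition hx₀ hunif hconv e s, h2,
    ENNReal.ofReal_toReal (measure_ne_top _ _)]

/-! ### Existence of an asymptotic state -/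

lemma asymptoticStates_nonempty [Countable E] [CompleteSpace X] [BorelSpace X] {x₀ : M.N → X}
    (hx₀ : ∀ j, x₀ j ∈ M.vertex j) (hcontr : M.IsContractive) (hunif : M.IsUniformlyContinuous)
    (hb : M.b x₀ < ∞) (hdom : M.HasDominatingMarkovChain) (hrec : M.IsRecurrent) :
    (M.asymptoticStates x₀).Nonempty := by
  obtain ⟨x, hx⟩ := hrec
  obtain ⟨a, ha1, ha⟩ := hcontr.exists_rate
  obtain ⟨φ, Λ, h⟩ := M.exists_isOccupationLimit x
  have hprob := h.isProbabilityMeasure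
  have hc : M.distBase x₀ x + (1 - a)⁻¹ * M.b x₀ ≠ ∞ := ENNReal.add_ne_top.2
    ⟨M.distBase_ne_top x, ENNReal.mul_ne_top (ENNReal.inv_ne_top.2 (tsub_pos_of_lt ha1).ne') hb.ne⟩
  have hgap := M.lintegral_gap_le hx₀ ha (M.lintegral_distBase_adjoint_dirac_le hx₀ ha1 ha x)
  have hconv := h.ae_mem_convergenceSet ha1 hc hgap (h.ae_mem_pathSpace hdom hx)
  refine ⟨Λ, M.mem_asymptoticStates hx₀ hunif h.map_shift hconv fun e m hm w => ?_⟩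
  exact h.measure_inter_next hx₀ hunif ha1 hc hgap hconv e (measurableSet_cylinder hm w)
    (m := m.natAbs) fun l hl => windowDetermined_mem_cylinder (by omega) w

/-! ### An invariant measure from a non-degenerate asymptotic state -/

open Classical in
/-- The limit of the backward compositions, where it exists, whether or not the sequence is a
path. In contrast to the coding map, this is a function of the past. -/
def pastLimit (x₀ : M.N → X) (σ : CodeSpace E) : X :=
  if h : ∃ y, Tendsto (fun n => M.approx x₀ n σ) atTop (𝓝 y) then h.choose else x₀ (M.t' (σ 0))

lemma tendsto_pastLimit {x₀ : M.N → X} {σ : CodeSpace E} (hσ : σ ∈ M.convergenceSet x₀) :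
    Tendsto (fun n => M.approx x₀ n σ) atTop (𝓝 (M.pastLimit x₀ σ)) := by
  rw [pastLimit, dif_pos hσ.2]
  exact hσ.2.choose_spec

lemma pastLimit_eq_codingMap {x₀ : M.N → X} {σ : CodeSpace E} (hσ : σ ∈ M.convergenceSet x₀) :
    M.pastLimit x₀ σ = M.codingMap x₀ σ :=
  tendsto_nhds_unique (M.tendsto_pastLimit hσ) (M.tendsto_approx_codingMap hσ)

lemma measurable_past_pastLimit [Countable E] [CompleteSpace X] [BorelSpace X] (x₀ : M.N → X) :
    Measurable[past E] (M.pastLimit x₀) := by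
  classical
  have hm : Measurable (M.pastLimit x₀) := by
    have hD : MeasurableSet {σ | ∃ y, Tendsto (fun n => M.approx x₀ n σ) atTop (𝓝 y)} :=
      StronglyMeasurable.measurableSet_exists_tendsto (M.stronglyMeasurable_approx x₀)
    have h0 : Measurable fun σ : CodeSpace E => x₀ (M.t' (σ 0)) :=
      (Measurable.of_discrete (f := fun a => x₀ (M.t' a))).comp (measurable_pi_apply 0)
    refine measurable_of_tendsto_metrizable (f := fun n σ =>
      if σ ∈ {σ | ∃ y, Tendsto (fun n => M.approx x₀ n σ) atTop (𝓝 y)} then M.approx x₀ n σ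
      else x₀ (M.t' (σ 0))) (fun n => Measurable.ite hD (M.measurable_approx x₀ n) h0) ?_
    refine tendsto_pi_nhds.2 fun σ => ?_
    by_cases h : ∃ y, Tendsto (fun n => M.approx x₀ n σ) atTop (𝓝 y)
    · simpa [pastLimit, h] using h.choose_spec
    · simp [pastLimit, h]
  refine PastDetermined.measurable (fun σ τ h => ?_) hm
  have h1 : ∀ n, M.approx x₀ n σ = M.approx x₀ n τ := fun n =>
    M.approx_congr x₀ fun k _ => h _ (by omega)
  simp only [pastLimit, h1, h 0 le_rfl]

/-- The sequences coded into the terminal vertex set of their last edge. -/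
def codedSet (x₀ : M.N → X) : Set (CodeSpace E) := {σ | M.pastLimit x₀ σ ∈ M.vertex (M.t' (σ 0))}

lemma measurableSet_past_codedSet [Countable E] [CompleteSpace X] [BorelSpace X]
    (x₀ : M.N → X) : MeasurableSet[past E] (M.codedSet x₀) := by
  have : M.codedSet x₀ = ⋃ a : Alphabet E, (M.pastLimit x₀ ⁻¹' M.vertex (M.t' a)) ∩
      ((fun σ : CodeSpace E => σ 0) ⁻¹' {a}) := by
    ext σ
    simp [codedSet]
  rw [this]
  exact MeasurableSet.iUnion fun a => (M.measurable_past_pastLimit x₀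
    (M.measurableSet_vertex _)).inter (measurable_past_apply le_rfl MeasurableSet.of_discrete)

/-- On the coded set, the limit moves along the next edge. -/
lemma pastLimit_shift {x₀ : M.N → X} (hx₀ : ∀ j, x₀ j ∈ M.vertex j)
    (hunif : M.IsUniformlyContinuous) {σ : CodeSpace E} (h1 : σ ∈ M.convergenceSet x₀)
    (h2 : shift σ ∈ M.convergenceSet x₀) (hσ : σ ∈ M.codedSet x₀) {e : E}
    (he : σ ∈ next e) :
    M.pastLimit x₀ σ ∈ M.vertex (M.i e) ∧
      M.pastLimit x₀ (shift σ) = M.w e (M.pastLimit x₀ σ) := by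
  have he1 : σ 1 = Alphabet.letter e := he
  have hpush : push e σ = shift σ := by
    rw [push, ← he1]
    exact Function.update_eq_self 0 (shift σ)
  have hi : M.i e = M.t' (σ 0) := by
    have := (h1.1 0).2
    rwa [zero_add, he1] at this
  have hmem : M.pastLimit x₀ σ ∈ M.vertex (M.i e) := hi ▸ hσ
  refine ⟨hmem, ?_⟩
  have h3 : Tendsto (fun n => M.w e (M.approx x₀ n σ)) atTop (𝓝 (M.w e (M.pastLimit x₀ σ))) := by
    refine ((hunif e).1.continuousOn _ hmem).tendsto.comp (tendsto_nhdsWithin_iff.2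
      ⟨M.tendsto_pastLimit h1, Eventually.of_forall fun n => ?_⟩)
    rw [hi]
    exact M.approx_mem_vertex hx₀ (M.pathSpace_subset_window n h1.1)
  have h4 := (tendsto_add_atTop_iff_nat 1).2 (M.tendsto_pastLimit h2)
  simp_rw [← hpush, approx_push_succ] at h4
  rw [hpush] at h4
  exact tendsto_nhds_unique h4 h3

/-- On the coded set, the conditional law of the next edge is given by the probability functions
themselves. -/
lemma transition_eq {x₀ : M.N → X} (hunif : M.IsUniformlyContinuous) {σ : CodeSpace E}
    (h1 : σ ∈ M.convergenceSet x₀) (hσ : σ ∈ M.codedSet x₀) (e : E) :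
    M.transition x₀ e σ = M.p e (M.pastLimit x₀ σ) := by
  by_cases ht : M.t' (σ 0) = M.i e
  · have hmem : M.pastLimit x₀ σ ∈ M.vertex (M.i e) := ht ▸ hσ
    rw [transition, indicator_of_mem (show σ ∈ M.endsAt (M.i e) from ⟨h1.1, ht⟩),
      ← M.pastLimit_eq_codingMap h1, pBar, indicator_of_mem (subset_closure hmem),
      extendFrom_extends (hunif e).2.continuousOn _ hmem]
  · rw [transition, indicator_of_notMem fun h => ht h.2]
    exact (M.p_eq_zero e _ fun h => ht (M.eq_of_mem_vertex hσ h)).symm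

/-- An asymptotic state that charges the coded set, conditioned on this set, is mapped by the
coding map to an invariant measure. -/
lemma nonempty_of_isNondegenerate [Countable E] [CompleteSpace X] [BorelSpace X] {x₀ : M.N → X}
    (hx₀ : ∀ j, x₀ j ∈ M.vertex j) (hunif : M.IsUniformlyContinuous)
    (hnd : M.IsNondegenerate x₀) (hne : (M.asymptoticStates x₀).Nonempty) :
    M.invariantMeasures.Nonempty := by
  obtain ⟨Λ, hΛ⟩ := hne
  have hprob := hΛ.1.1
  have hconv : ∀ᵐ σ ∂Λ, σ ∈ M.convergenceSet x₀ := by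
    rw [ae_iff]
    exact (prob_compl_eq_zero_iff (M.measurableSet_convergenceSet x₀)).2 hΛ.2.1
  have hshift : MeasurePreserving shift Λ Λ := ⟨measurable_shift, hΛ.1.2⟩
  have hconv' : ∀ᵐ σ ∂Λ, shift σ ∈ M.convergenceSet x₀ :=
    hshift.quasiMeasurePreserving.ae hconv
  set A := M.codedSet x₀ with hA
  set H := M.pastLimit x₀ with hH
  have hAp := M.measurableSet_past_codedSet x₀
  have hHp := M.measurable_past_pastLimit x₀
  have hAm : MeasurableSet A := past_le _ hAp
  have hHm : Measurable H := hHp.mono past_le le_rfl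
  have hApos : Λ A ≠ 0 := by
    obtain ⟨j, hj⟩ := hnd Λ hΛ
    refine (hj.trans_le (measure_mono_ae ?_)).ne'
    filter_upwards [hconv] with σ hσ h
    change M.pastLimit x₀ σ ∈ M.vertex (M.t' (σ 0))
    rw [M.pastLimit_eq_codingMap hσ, h.1.2]
    exact h.2
  have hedge : ∀ᵐ σ ∂Λ, ∃ e, σ ∈ next e := hconv.mono fun σ hσ => (hσ.1 1).1
  -- The coded set is forward invariant, hence invariant up to a null set.
  have hAinv : (shift ⁻¹' A : Set (CodeSpace E)) =ᵐ[Λ] A := by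
    have hsub : A ≤ᵐ[Λ] (shift ⁻¹' A : Set (CodeSpace E)) := by
      filter_upwards [hconv, hconv', hedge] with σ h1 h2 ⟨e, he⟩ hσ
      obtain ⟨h3, h4⟩ := M.pastLimit_shift hx₀ hunif h1 h2 hσ he
      change M.pastLimit x₀ (shift σ) ∈ M.vertex (M.t' (shift σ 0))
      have h5 : shift σ 0 = Alphabet.letter e := he
      rw [h4, h5, t'_letter]
      exact M.mapsTo_w e h3
    exact (ae_eq_of_ae_subset_of_measure_ge hsub
      (hshift.measure_preimage hAm.nullMeasurableSet).le hAm.nullMeasurableSet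
      (measure_ne_top _ _)).symm
  set μ : Measure X := (Λ A)⁻¹ • (Λ.restrict A).map H with hμ
  have hμapply : ∀ B, MeasurableSet B → μ B = (Λ A)⁻¹ * Λ (A ∩ H ⁻¹' B) := by
    intro B hB
    rw [hμ, Measure.smul_apply, Measure.map_apply hHm hB, Measure.restrict_apply (hHm hB),
      inter_comm, smul_eq_mul]
  refine ⟨μ, ⟨?_⟩, ?_⟩
  · rw [hμapply _ MeasurableSet.univ, preimage_univ, inter_univ]
    exact ENNReal.inv_mul_cancel hApos (measure_ne_top _ _)
  refine Measure.ext fun B hB => ?_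
  have hterm : ∀ e, ((μ.withDensity fun x => (M.p e x : ℝ≥0∞)).map (M.w e)) B =
      (Λ A)⁻¹ * Λ ((A ∩ H ⁻¹' (M.w e ⁻¹' B)) ∩ next e) := by
    intro e
    have hwB := M.measurable_w e hB
    rw [Measure.map_apply (M.measurable_w e) hB, withDensity_apply _ hwB, hμ,
      Measure.restrict_smul, lintegral_smul_measure, smul_eq_mul,
      setLIntegral_map hwB (M.measurable_p_ennreal e) hHm,
      Measure.restrict_restrict (hHm hwB), inter_comm,
      M.measure_inter_next_of_mem_asymptoticStates hx₀ hunif hΛ hconv e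
        (hAp.inter (hHp hwB))]
    congr 1
    refine setLIntegral_congr_fun_ae (hAm.inter (hHm hwB)) ?_
    filter_upwards [hconv] with σ h1 h2
    rw [M.transition_eq hunif h1 h2.1]
  rw [adjoint, Measure.sum_apply _ hB]
  simp_rw [hterm]
  rw [ENNReal.tsum_mul_left, hμapply B hB]
  congr 1
  calc ∑' e, Λ ((A ∩ H ⁻¹' (M.w e ⁻¹' B)) ∩ next e)
      = Λ (⋃ e, (A ∩ H ⁻¹' (M.w e ⁻¹' B)) ∩ next e) := by
        refine (measure_iUnion (fun e e' hee' => ?_) fun e => ?_).symm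
        · refine Set.disjoint_left.2 fun σ h h' => hee' ?_
          exact letter_injective (h.2.symm.trans h'.2)
        · exact (hAm.inter (hHm (M.measurable_w e hB))).inter (measurableSet_next e)
    _ = Λ (A ∩ shift ⁻¹' (H ⁻¹' B)) := by
        refine measure_congr ?_
        filter_upwards [hconv, hconv', hedge] with σ h1 h2 ⟨e, he⟩
        refine propext ?_
        change σ ∈ (⋃ e, (A ∩ H ⁻¹' (M.w e ⁻¹' B)) ∩ next e) ↔ σ ∈ A ∩ shift ⁻¹' (H ⁻¹' B)
        constructor
        · intro h
          obtain ⟨e', ⟨h3, h4⟩, he'⟩ := mem_iUnion.1 h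
          refine ⟨h3, ?_⟩
          change M.pastLimit x₀ (shift σ) ∈ B
          rw [(M.pastLimit_shift hx₀ hunif h1 h2 h3 he').2]
          exact h4
        · rintro ⟨h3, h4⟩
          refine mem_iUnion.2 ⟨e, ⟨h3, ?_⟩, he⟩
          change M.pastLimit x₀ (shift σ) ∈ B at h4
          rwa [(M.pastLimit_shift hx₀ hunif h1 h2 h3 he).2] at h4
    _ = Λ (shift ⁻¹' (A ∩ H ⁻¹' B)) := by
        rw [preimage_inter]
        exact measure_congr (hAinv.symm.inter (ae_eq_refl _))
    _ = Λ (A ∩ H ⁻¹' B) := hshift.measure_preimage (hAm.inter (hHm hB)).nullMeasurableSet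

end MarkovSystem
end

theorem corollary2 {X E : Type*} [MetricSpace X] [CompleteSpace X] [MeasurableSpace X]
    [BorelSpace X] [Countable E] (M : MarkovSystem X E)
    (x₀ : M.N → X) (hx₀ : ∀ j, x₀ j ∈ M.vertex j)
    (hcontr : M.IsContractive) (hunif : M.IsUniformlyContinuous) (hb : M.b x₀ < ∞) :
    (M.IsNondegenerate x₀ → M.HasDominatingMarkovChain →
      (M.invariantMeasures.Nonempty ↔ M.IsRecurrent)) ∧
    (M.IsConsistent x₀ → M.HasDominatingMarkovChain → M.IsRecurrent →
      M.invariantMeasures.Nonempty) ∧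
    (∀ μ ∈ M.invariantMeasures, IsTightMeasureSet {μ}) ∧
    ((∀ j, {e | M.i e = j}.Finite ∧ {e | M.t e = j}.Finite) →
      ∀ c : Finset M.N, ∀ ε > (0 : ℝ), ∃ C : Set X, IsCompact C ∧
        ∀ μ ∈ M.invariantMeasures, μ.real (⋃ j ∈ c, M.vertex j) - ε < μ.real C) ∧
    (Finite E → IsTightMeasureSet M.invariantMeasures) := by
  refine ⟨fun hnd hdom => ⟨fun h => M.isRecurrent_of_nonempty h, fun hrec => ?_⟩,
    fun hcons hdom hrec => ?_, fun μ hμ => ?_, fun hfin c ε hε => ?_, fun _ => ?_⟩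
  · exact M.nonempty_of_isNondegenerate hx₀ hunif hnd
      (M.asymptoticStates_nonempty hx₀ hcontr hunif hb hdom hrec)
  · obtain ⟨Λ, hΛ⟩ := M.asymptoticStates_nonempty hx₀ hcontr hunif hb hdom hrec
    exact ⟨_, hcons Λ hΛ⟩
  · exact M.isTightMeasureSet_singleton_of_mem_invariantMeasures hx₀ hcontr hb hμ
  · exact M.exists_isCompact_measureReal_lt hx₀ hcontr hb (fun j => (hfin j).2) c hε
  · exact M.isTightMeasureSet_invariantMeasures hx₀ hcontr hb
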